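/- All functions below are considered on the Riemann surface of the logarithm, whose points $z$ are given by a modulus $|z|>0$ and an argument $\arg z\in\mathbb{R}$ (not reduced modulo $2\pi$); powers are $z^a=\exp\left(a\log|z|+ia\arg z\right)$, and $J_\nu,Y_\nu,K_\nu$ denote the analytic continuations to this surface of the Bessel functions of the first and second kind and of the modified Bessel function of the second kind. Primes on $J_\nu,Y_\nu,K_\nu$ denote $d/dz$, and empty sums are $0$, empty products $1$. Put $b_0(\nu)=1$ and, for $n\ge1$, $$b_n(\nu)=\frac{\big((4\nu^2-1^2)(4\nu^2-3^2)\cdots(4\nu^2-(2n-3)^2)\big)(4\nu^2+4n^2-1)}{8^n\,n!},$$ and let $\omega=z-\frac{\pi}{2}\nu-\frac{\pi}{4}$. The remainders $R_N^{(K')}(z,\nu)$ and $R_N^{(J')}(z,\nu)$ ($N\ge0$) are defined by $$K_\nu'(z)=-\Big(\frac{\pi}{2z}\Big)^{1/2}e^{-z}\Big(\sum_{n=0}^{N-1}\frac{b_n(\nu)}{z^n}+R_N^{(K')}(z,\nu)\Big)$$ and by the pair of equations, for all integers $N,M\ge 0$, $$J_\nu'(z)=-\Big(\frac{2}{\pi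 z}\Big)^{1/2}\Big(\sin\omega\Big(\sum_{n=0}^{N-1}(-1)^n\frac{b_{2n}(\nu)}{z^{2n}}+R_{2N}^{(J')}(z,\nu)\Big)+\cos\omega\Big(\sum_{m=0}^{M-1}(-1)^m\frac{b_{2m+1}(\nu)}{z^{2m+1}}-R_{2M+1}^{(J')}(z,\nu)\Big)\Big),$$ $$Y_\nu'(z)=\Big(\frac{2}{\pi z}\Big)^{1/2}\Big(\cos\omega\Big(\sum_{n=0}^{N-1}(-1)^n\frac{b_{2n}(\nu)}{z^{2n}}+R_{2N}^{(J')}(z,\nu)\Big)-\sin\omega\Big(\sum_{m=0}^{M-1}(-1)^m\frac{b_{2m+1}(\nu)}{z^{2m+1}}-R_{2M+1}^{(J')}(z,\nu)\Big)\Big),$$ which together determine $R_{2N}^{(J')}$ and $R_{2M+1}^{(J')}$ uniquely. The basic terminants are $$\Lambda_p(w)=w^pe^w\,\Gamma(1-p,w),\qquad \Pi_p(w)=\tfrac12\left(\Lambda_p(we^{\frac{\pi}{2}i})+\Lambda_p(we^{-\frac{\pi}{2}i})\right),$$ where $\Gamma(a,w)=\int_w^{+\infty}t^{a-1}e^{-t}\,dt$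 is the incomplete gamma function, analytically continued to the same surface. **Theorem.** Let $N$ be a positive integer and let $\nu$ be a real number with $|\nu|<N-\frac12$. Then $$\big|R_N^{(K')}(z,\nu)\big|\le\frac{|b_N(\nu)|}{|z|^N}\sup_{r\ge1}\big|\Lambda_N(2zr)\big|\qquad\text{for all } z \text{ with } |\arg z|<\tfrac{3\pi}{2},$$ and $$\big|R_N^{(J')}(z,\nu)\big|\le\frac{|b_N(\nu)|}{|z|^N}\sup_{r\ge1}\big|\Pi_N(2zr)\big|\qquad\text{for all } z \text{ with } |\arg z|<\pi,$$ where both suprema are finite. -/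

import Mathlib

open Filter Topology

/-!
Functions on the Riemann surface of the logarithm.  A point of that surface with modulus `ρ > 0`
and argument `θ ∈ ℝ` is represented by its logarithm `ζ = log ρ + i θ : ℂ`.  So `ζ` stands for the
point `z` with value `exp ζ`, modulus `exp ζ.re = ‖exp ζ‖` and argument `arg z = ζ.im`, which is not
reduced modulo `2 π`; every point of the surface corresponds to exactly one `ζ`.  Multiplication of
`z` by `e^{iα}` is `ζ ↦ ζ + i α`, multiplication by `s > 0` is `ζ ↦ ζ + log s`, and the power `z^a`
on the surface is `exp (a * ζ)`.
-/

noncomputable section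

namespace BesselExpansion

/-- The Bessel function `J_ν(z) = (z/2)^ν ∑ₖ (-1)^k (z²/4)^k / (k! Γ(ν+k+1))`, at the point `z` with
logarithm `ζ`.  (`(Complex.Gamma s)⁻¹` is the entire function `1/Γ(s)`, with the value `0` at the
poles of `Γ`.) -/
def besselJ (ν ζ : ℂ) : ℂ :=
  Complex.exp (ν * (ζ - Real.log 2)) *
    ∑' k : ℕ, (-1) ^ k * (Complex.exp ζ ^ 2 / 4) ^ k / (Nat.factorial k : ℂ) *
      (Complex.Gamma (ν + k + 1))⁻¹

/-- The modified Bessel function `I_ν(z) = (z/2)^ν ∑ₖ (z²/4)^k / (k! Γ(ν+k+1))`, at the point `z`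
with logarithm `ζ`. -/
def besselI (ν ζ : ℂ) : ℂ :=
  Complex.exp (ν * (ζ - Real.log 2)) *
    ∑' k : ℕ, (Complex.exp ζ ^ 2 / 4) ^ k / (Nat.factorial k : ℂ) *
      (Complex.Gamma (ν + k + 1))⁻¹

open Classical in
/-- The Bessel function of the second kind
`Y_ν(z) = (J_ν(z) cos(πν) - J_{-ν}(z)) / sin(πν)`, with the limiting value at integers `ν`. -/
def besselY (ν ζ : ℂ) : ℂ :=
  let q : ℂ → ℂ := fun μ =>
    (besselJ μ ζ * Complex.cos (Real.pi * μ) - besselJ (-μ) ζ) / Complex.sin (Real.pi * μ)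
  if ∃ n : ℤ, ν = n then limUnder (𝓝[≠] ν) q else q ν

open Classical in
/-- The modified Bessel function of the second kind
`K_ν(z) = (π/2) (I_{-ν}(z) - I_ν(z)) / sin(πν)`, with the limiting value at integers `ν`. -/
def besselK (ν ζ : ℂ) : ℂ :=
  let q : ℂ → ℂ := fun μ =>
    (Real.pi / 2 : ℂ) * (besselI (-μ) ζ - besselI μ ζ) / Complex.sin (Real.pi * μ)
  if ∃ n : ℤ, ν = n then limUnder (𝓝[≠] ν) q else q ν

/-- The derivative with respect to `z = exp ζ` of a function on the Riemann surface of the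
logarithm: `df/dz = e^{-ζ} df/dζ`. -/
def zderiv (f : ℂ → ℂ) (ζ : ℂ) : ℂ := Complex.exp (-ζ) * deriv f ζ

/-- The coefficients `b₀(ν) = 1` and, for `n ≥ 1`,
`b_n(ν) = ((4ν²-1²)(4ν²-3²)⋯(4ν²-(2n-3)²)) (4ν²+4n²-1) / (8^n n!)`. -/
def coeffB (n : ℕ) (ν : ℝ) : ℝ :=
  if n = 0 then 1
  else (∏ k ∈ Finset.Icc 1 (n - 1), (4 * ν ^ 2 - (2 * (k : ℝ) - 1) ^ 2)) *
    (4 * ν ^ 2 + 4 * (n : ℝ) ^ 2 - 1) / (8 ^ n * (Nat.factorial n : ℝ))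

/-- The factor `(π/(2z))^{1/2} e^{-z}`. -/
def prefactorK (ζ : ℂ) : ℂ :=
  (Real.sqrt (Real.pi / 2) : ℂ) * Complex.exp (-ζ / 2) * Complex.exp (-Complex.exp ζ)

/-- The factor `(2/(πz))^{1/2}`. -/
def prefactorJ (ζ : ℂ) : ℂ :=
  (Real.sqrt (2 / Real.pi) : ℂ) * Complex.exp (-ζ / 2)

/-- The phase `ω = z - πν/2 - π/4`. -/
def phase (ν : ℝ) (ζ : ℂ) : ℂ :=
  Complex.exp ζ - (Real.pi / 2 : ℂ) * ν - (Real.pi / 4 : ℂ)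

/-- The remainder `R_N^{(K')}(z,ν)`, defined by
`K'_ν(z) = -(π/(2z))^{1/2} e^{-z} (∑_{n<N} b_n(ν)/z^n + R_N^{(K')}(z,ν))`. -/
def remK' (N : ℕ) (ν : ℝ) (ζ : ℂ) : ℂ :=
  -zderiv (besselK ν) ζ / prefactorK ζ -
    ∑ n ∈ Finset.range N, (coeffB n ν : ℂ) / Complex.exp ζ ^ n

/-- The even remainder `R_{2N}^{(J')}(z,ν)`.  Together with `remJ'Odd` it is the unique solution of
the two equations that express `J'_ν(z)` and `Y'_ν(z)` through the remainders, see
`besselJ_deriv_eq`, `besselY_deriv_eq` and `remJ'_unique`. -/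
def remJ'Even (N : ℕ) (ν : ℝ) (ζ : ℂ) : ℂ :=
  (zderiv (besselY ν) ζ * Complex.cos (phase ν ζ) -
      zderiv (besselJ ν) ζ * Complex.sin (phase ν ζ)) / prefactorJ ζ -
    ∑ n ∈ Finset.range N, (-1) ^ n * (coeffB (2 * n) ν : ℂ) / Complex.exp ζ ^ (2 * n)

/-- The odd remainder `R_{2M+1}^{(J')}(z,ν)`; see `remJ'Even`. -/
def remJ'Odd (M : ℕ) (ν : ℝ) (ζ : ℂ) : ℂ :=
  (zderiv (besselJ ν) ζ * Complex.cos (phase ν ζ) +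
      zderiv (besselY ν) ζ * Complex.sin (phase ν ζ)) / prefactorJ ζ +
    ∑ m ∈ Finset.range M, (-1) ^ m * (coeffB (2 * m + 1) ν : ℂ) / Complex.exp ζ ^ (2 * m + 1)

/-- The remainder `R_N^{(J')}(z,ν)` for `N` of either parity. -/
def remJ' (N : ℕ) (ν : ℝ) (ζ : ℂ) : ℂ :=
  if Even N then remJ'Even (N / 2) ν ζ else remJ'Odd (N / 2) ν ζ

/-- The incomplete gamma function `Γ(a,w) = ∫_w^∞ t^{a-1} e^{-t} dt` on the Riemann surface of the
logarithm, at the point `w = r e^{iθ}` with logarithm `ζ = log r + iθ`.  The path of integration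
(on the surface) is the circular arc `t = r e^{is}` with `s` from `θ` to `0`, followed by the ray
from `r` to `+∞`. -/
def incGamma (a ζ : ℂ) : ℂ :=
  (∫ t in Set.Ioi (Real.exp ζ.re), (t : ℂ) ^ (a - 1) * Complex.exp (-(t : ℂ))) -
    Complex.I * ∫ s in (0 : ℝ)..ζ.im,
      Complex.exp (a * (ζ.re + s * Complex.I)) *
        Complex.exp (-Complex.exp (ζ.re + s * Complex.I))

/-- The basic terminant `Λ_p(w) = w^p e^w Γ(1-p,w)`, at the point `w` with logarithm `ζ`. -/
def terminantL (p ζ : ℂ) : ℂ :=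
  Complex.exp (p * ζ) * Complex.exp (Complex.exp ζ) * incGamma (1 - p) ζ

/-- The basic terminant `Π_p(w) = (Λ_p(w e^{iπ/2}) + Λ_p(w e^{-iπ/2})) / 2`, at the point `w` with
logarithm `ζ`. -/
def terminantP (p ζ : ℂ) : ℂ :=
  (terminantL p (ζ + Real.pi / 2 * Complex.I) + terminantL p (ζ - Real.pi / 2 * Complex.I)) / 2

theorem prefactorK_ne_zero (ζ : ℂ) : prefactorK ζ ≠ 0 := by
  have h : Real.sqrt (Real.pi / 2) ≠ 0 := by positivity
  unfold prefactorK
  exact mul_ne_zero (mul_ne_zero (by exact_mod_cast h) (Complex.exp_ne_zero _))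
    (Complex.exp_ne_zero _)

theorem prefactorJ_ne_zero (ζ : ℂ) : prefactorJ ζ ≠ 0 := by
  have h : Real.sqrt (2 / Real.pi) ≠ 0 := by positivity
  unfold prefactorJ
  exact mul_ne_zero (by exact_mod_cast h) (Complex.exp_ne_zero _)

/-- The defining expansion of `K'_ν`. -/
theorem besselK_deriv_eq (N : ℕ) (ν : ℝ) (ζ : ℂ) :
    zderiv (besselK ν) ζ = -prefactorK ζ *
      (∑ n ∈ Finset.range N, (coeffB n ν : ℂ) / Complex.exp ζ ^ n + remK' N ν ζ) := by
  have h := prefactorK_ne_zero ζ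
  unfold remK'
  field_simp
  ring

/-- The expansion of `J'_ν`. -/
theorem besselJ_deriv_eq (N M : ℕ) (ν : ℝ) (ζ : ℂ) :
    zderiv (besselJ ν) ζ = -prefactorJ ζ *
      (Complex.sin (phase ν ζ) *
        (∑ n ∈ Finset.range N, (-1) ^ n * (coeffB (2 * n) ν : ℂ) / Complex.exp ζ ^ (2 * n) +
          remJ' (2 * N) ν ζ) +
      Complex.cos (phase ν ζ) *
        (∑ m ∈ Finset.range M,
          (-1) ^ m * (coeffB (2 * m + 1) ν : ℂ) / Complex.exp ζ ^ (2 * m + 1) -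
          remJ' (2 * M + 1) ν ζ)) := by
  have h := prefactorJ_ne_zero ζ
  have h1 := Complex.sin_sq_add_cos_sq (phase ν ζ)
  have e1 : remJ' (2 * N) ν ζ = remJ'Even N ν ζ := by simp [remJ']
  have e2 : remJ' (2 * M + 1) ν ζ = remJ'Odd M ν ζ := by
    simp [remJ', show (2 * M + 1) / 2 = M by omega]
  rw [e1, e2]
  unfold remJ'Even remJ'Odd
  field_simp
  linear_combination (-zderiv (besselJ ν) ζ) * h1

/-- The expansion of `Y'_ν`, with the same remainders. -/
theorem besselY_deriv_eq (N M : ℕ) (ν : ℝ) (ζ : ℂ) :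
    zderiv (besselY ν) ζ = prefactorJ ζ *
      (Complex.cos (phase ν ζ) *
        (∑ n ∈ Finset.range N, (-1) ^ n * (coeffB (2 * n) ν : ℂ) / Complex.exp ζ ^ (2 * n) +
          remJ' (2 * N) ν ζ) -
      Complex.sin (phase ν ζ) *
        (∑ m ∈ Finset.range M,
          (-1) ^ m * (coeffB (2 * m + 1) ν : ℂ) / Complex.exp ζ ^ (2 * m + 1) -
          remJ' (2 * M + 1) ν ζ)) := by
  have h := prefactorJ_ne_zero ζ
  have h1 := Complex.sin_sq_add_cos_sq (phase ν ζ)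
  have e1 : remJ' (2 * N) ν ζ = remJ'Even N ν ζ := by simp [remJ']
  have e2 : remJ' (2 * M + 1) ν ζ = remJ'Odd M ν ζ := by
    simp [remJ', show (2 * M + 1) / 2 = M by omega]
  rw [e1, e2]
  unfold remJ'Even remJ'Odd
  field_simp
  linear_combination (-zderiv (besselY ν) ζ) * h1

/-- The two expansions determine the remainders. -/
theorem remJ'_unique (N M : ℕ) (ν : ℝ) (ζ R S : ℂ)
    (hJ : zderiv (besselJ ν) ζ = -prefactorJ ζ *
      (Complex.sin (phase ν ζ) *
        (∑ n ∈ Finset.range N, (-1) ^ n * (coeffB (2 * n) ν : ℂ) / Complex.exp ζ ^ (2 * n) + R) +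
      Complex.cos (phase ν ζ) *
        (∑ m ∈ Finset.range M,
          (-1) ^ m * (coeffB (2 * m + 1) ν : ℂ) / Complex.exp ζ ^ (2 * m + 1) - S)))
    (hY : zderiv (besselY ν) ζ = prefactorJ ζ *
      (Complex.cos (phase ν ζ) *
        (∑ n ∈ Finset.range N, (-1) ^ n * (coeffB (2 * n) ν : ℂ) / Complex.exp ζ ^ (2 * n) + R) -
      Complex.sin (phase ν ζ) *
        (∑ m ∈ Finset.range M,
          (-1) ^ m * (coeffB (2 * m + 1) ν : ℂ) / Complex.exp ζ ^ (2 * m + 1) - S))) :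
    R = remJ' (2 * N) ν ζ ∧ S = remJ' (2 * M + 1) ν ζ := by
  have h := prefactorJ_ne_zero ζ
  have h1 := Complex.sin_sq_add_cos_sq (phase ν ζ)
  have e1 : remJ' (2 * N) ν ζ = remJ'Even N ν ζ := by simp [remJ']
  have e2 : remJ' (2 * M + 1) ν ζ = remJ'Odd M ν ζ := by
    simp [remJ', show (2 * M + 1) / 2 = M by omega]
  rw [e1, e2]
  unfold remJ'Even remJ'Odd
  rw [hJ, hY]
  set A := ∑ n ∈ Finset.range N, (-1) ^ n * (coeffB (2 * n) ν : ℂ) / Complex.exp ζ ^ (2 * n)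
  set B := ∑ m ∈ Finset.range M,
    (-1) ^ m * (coeffB (2 * m + 1) ν : ℂ) / Complex.exp ζ ^ (2 * m + 1)
  constructor
  · field_simp
    linear_combination (-(A + R)) * h1
  · field_simp
    linear_combination (B - S) * h1

end BesselExpansion

end

/-!
# Error bounds for the large-argument expansions of `K_ν'`, `J_ν'` and `Y_ν'`

For `x > 0` the normalized derivative `Q(x) = -(2x/π)^{1/2} e^x K_ν'(x)` has the representation
`Q(x) = (2x/π)^{1/2} ∫ cosh(2νb) cosh(2b) e^{-2x sinh² b} db` (`scaledK`). The bound rests on two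
properties of `Q`.

* `Q` reproduces itself in the remainder. The function `cosh(2νb) cosh(2b) / cosh b` expands in
  powers of `sinh² b`, and the error after `N` terms is a dispersion integral
  (`cosh_mul_cosh_two_mul_eq`), which converges because `|ν| < N - 1/2`. Integrating against the
  Gaussian in `w = sinh b` turns the polynomial into `∑ b_n(ν) / x^n`; in the remaining double
  integral the scaling `w = v cosh a` brings back the integral for `Q`, so that
  `R_N(x) = ((-1)^{N+1} cos(πν) / π) ∫ |v|^{2N-1} / (1+v²) e^{-2xv²} Q(xv²) dv`
  (`scaledK_eq_sum_add_integral`).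
* `Q` is completely monotone: `Q(t) = ∫ e^{-2tρ} dm(ρ)` with a positive measure `m` on `[0, ∞)`
  (`exists_measure_scaledK`). This comes from an integration by parts, as `cosh(2νb) cosh(2b) /
  cosh b` increases for `b > 0`, and from Craig's formula for the complementary error function.

Inserting the second fact into the first and integrating over `v` gives the terminant
`Γ(N) X^{-N} Λ_N(X)` at `X = 2x(1+ρ)`. Hence `R_N(x) = c x^{-N} ∫ Λ_N(2x(1+ρ)) dμ(ρ)` with a finite
positive measure `μ`, and a comparison of the expansions with `N` and `N + 1` terms shows
`b_N(ν) = c μ(ℝ)` (`exists_measure_remainder`). Rotating the path of integration shows that `Λ_N`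
is bounded in the closed subsectors of `|arg w| < 3π/2` (`norm_terminantL_le`), so both sides of the
formula for `R_N` are analytic in `|arg z| < 3π/2` and agree there (`exists_measure_remK'`). Since
`1 + ρ ≥ 1`, estimating the terminant by its supremum leaves `|c| μ(ℝ) = |b_N(ν)|`.

For `J_ν'` and `Y_ν'`, the connection formulas express the remainder through `R_N^{(K')}` at
`z e^{±iπ/2}` (`remJ'Even_eq`, `remJ'Odd_eq`), and the two values of `Λ_N` combine to `Π_N`.
-/

noncomputable section

namespace BesselExpansion

/-! ### The entire series behind the Bessel functions -/

/-- The function `∑ₖ x^k / (k! Γ(μ+k+1))`, entire in both variables; the Bessel functions are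
`I_μ(z) = (z/2)^μ φ_μ(z²/4)` and `J_μ(z) = (z/2)^μ φ_μ(-z²/4)`. -/
def phi (μ x : ℂ) : ℂ := ∑' k : ℕ, x ^ k / (Nat.factorial k : ℂ) * (Complex.Gamma (μ + k + 1))⁻¹

/-- The numbers `1 / Γ(μ+k+1)` are bounded uniformly in `k` and in `μ` from a disc: beyond the
modulus of `μ` the recurrence of `Γ` makes them decrease. -/
theorem exists_bound_inv_Gamma (R : ℝ) :
    ∃ C : ℝ, ∀ μ : ℂ, ‖μ‖ ≤ R → ∀ k : ℕ, ‖(Complex.Gamma (μ + k + 1))⁻¹‖ ≤ C := by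
  obtain ⟨K, hK⟩ := exists_nat_ge R
  have hb : ∀ k : ℕ, ∃ C : ℝ, ∀ μ : ℂ, ‖μ‖ ≤ R → ‖(Complex.Gamma (μ + k + 1))⁻¹‖ ≤ C := by
    intro k
    have hc : Continuous fun μ : ℂ => (Complex.Gamma (μ + k + 1))⁻¹ :=
      Complex.differentiable_one_div_Gamma.continuous.comp (by fun_prop)
    obtain ⟨C, hC⟩ := (isCompact_closedBall (0 : ℂ) R).exists_bound_of_continuousOn hc.continuousOn
    exact ⟨C, fun μ hμ => hC μ (by simpa using hμ)⟩
  choose C hC using hb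
  refine ⟨∑ k ∈ Finset.range (K + 1), |C k|, fun μ hμ => ?_⟩
  have small : ∀ k ≤ K, ‖(Complex.Gamma (μ + k + 1))⁻¹‖ ≤ ∑ k ∈ Finset.range (K + 1), |C k| := by
    intro k hk
    refine ((hC k μ hμ).trans (le_abs_self _)).trans ?_
    exact Finset.single_le_sum (f := fun k => |C k|) (fun i _ => abs_nonneg _)
      (Finset.mem_range.2 (by omega))
  have large : ∀ j : ℕ, ‖(Complex.Gamma (μ + (K + j : ℕ) + 1))⁻¹‖ ≤
      ∑ k ∈ Finset.range (K + 1), |C k| := by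
    intro j
    induction j with
    | zero => exact small K le_rfl
    | succ j ih =>
      have h1 := Complex.one_div_Gamma_eq_self_mul_one_div_Gamma_add_one (μ + (K + j : ℕ) + 1)
      have h2 : (1 : ℝ) ≤ ‖μ + (K + j : ℕ) + 1‖ := by
        have h3 : ‖((K + j : ℕ) + 1 : ℂ)‖ = (K + j : ℕ) + 1 := by
          have := Complex.norm_natCast (K + j + 1)
          push_cast at this ⊢
          exact this
        have h4 : ‖((K + j : ℕ) + 1 : ℂ)‖ ≤ ‖μ + (K + j : ℕ) + 1‖ + ‖μ‖ := by
          have := norm_sub_le (μ + (K + j : ℕ) + 1) μ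
          rwa [show μ + ((K + j : ℕ) : ℂ) + 1 - μ = ((K + j : ℕ) + 1 : ℂ) by ring] at this
        rw [h3] at h4
        push_cast at h4 ⊢
        have : (0 : ℝ) ≤ j := by positivity
        linarith
      rw [h1, norm_mul] at ih
      have h5 : μ + ((K + (j + 1) : ℕ) : ℂ) + 1 = μ + (K + j : ℕ) + 1 + 1 := by push_cast; ring
      rw [h5]
      nlinarith [norm_nonneg ((Complex.Gamma (μ + (K + j : ℕ) + 1 + 1))⁻¹)]
  intro k
  rcases le_total k K with h | h
  · exact small k h
  · obtain ⟨j, rfl⟩ := Nat.exists_eq_add_of_le h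
    exact large j

theorem norm_phi_term_le {C R : ℝ} {μ x : ℂ} (hx : ‖x‖ ≤ R) {k : ℕ}
    (hC : ‖(Complex.Gamma (μ + k + 1))⁻¹‖ ≤ C) :
    ‖x ^ k / (Nat.factorial k : ℂ) * (Complex.Gamma (μ + k + 1))⁻¹‖ ≤
      R ^ k / (Nat.factorial k : ℝ) * C := by
  rw [norm_mul, norm_div, norm_pow, Complex.norm_natCast]
  have hR : 0 ≤ R := (norm_nonneg x).trans hx
  gcongr

theorem summable_phi (μ x : ℂ) :
    Summable fun k : ℕ => x ^ k / (Nat.factorial k : ℂ) * (Complex.Gamma (μ + k + 1))⁻¹ := by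
  obtain ⟨C, hC⟩ := exists_bound_inv_Gamma ‖μ‖
  exact Summable.of_norm_bounded ((Real.summable_pow_div_factorial ‖x‖).mul_right C)
    fun k => norm_phi_term_le le_rfl (hC μ le_rfl k)

theorem differentiable_inv_Gamma_shift (k : ℕ) :
    Differentiable ℂ fun μ : ℂ => (Complex.Gamma (μ + k + 1))⁻¹ :=
  Complex.differentiable_one_div_Gamma.comp (by fun_prop)

theorem hasDerivAt_phi_left (μ x : ℂ) :
    HasDerivAt (fun μ => phi μ x)
      (∑' k : ℕ, x ^ k / (Nat.factorial k : ℂ) *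
        deriv (fun μ : ℂ => (Complex.Gamma (μ + k + 1))⁻¹) μ) μ := by
  obtain ⟨C, hC⟩ := exists_bound_inv_Gamma (‖μ‖ + 1)
  have hu := (Real.summable_pow_div_factorial ‖x‖).mul_right C
  have hd : ∀ k : ℕ, DifferentiableOn ℂ
      (fun μ : ℂ => x ^ k / (Nat.factorial k : ℂ) * (Complex.Gamma (μ + k + 1))⁻¹)
      (Metric.ball 0 (‖μ‖ + 1)) :=
    fun k => ((differentiable_inv_Gamma_shift k).const_mul _).differentiableOn
  have hle : ∀ k : ℕ, ∀ w ∈ Metric.ball (0 : ℂ) (‖μ‖ + 1),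
      ‖x ^ k / (Nat.factorial k : ℂ) * (Complex.Gamma (w + k + 1))⁻¹‖ ≤
        ‖x‖ ^ k / (Nat.factorial k : ℝ) * C :=
    fun k w hw => norm_phi_term_le le_rfl (hC w (by simpa using (mem_ball_zero_iff.1 hw).le) k)
  have hmem : μ ∈ Metric.ball (0 : ℂ) (‖μ‖ + 1) := by simp
  have h1 := (Complex.differentiableOn_tsum_of_summable_norm hu hd Metric.isOpen_ball hle
    ).differentiableAt (Metric.isOpen_ball.mem_nhds hmem)
  have h2 := Complex.hasSum_deriv_of_summable_norm hu hd Metric.isOpen_ball hle hmem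
  have h3 := h1.hasDerivAt
  rw [← h2.tsum_eq] at h3
  refine h3.congr_deriv (tsum_congr fun k => ?_)
  exact deriv_const_mul _ (differentiable_inv_Gamma_shift k μ)

theorem differentiable_phi_left (x : ℂ) : Differentiable ℂ fun μ => phi μ x :=
  fun μ => (hasDerivAt_phi_left μ x).differentiableAt

theorem hasDerivAt_phi (μ x : ℂ) : HasDerivAt (phi μ) (phi (μ + 1) x) x := by
  obtain ⟨C, hC⟩ := exists_bound_inv_Gamma ‖μ‖
  have hu := (Real.summable_pow_div_factorial (‖x‖ + 1)).mul_right C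
  have hd : ∀ k : ℕ, DifferentiableOn ℂ
      (fun x : ℂ => x ^ k / (Nat.factorial k : ℂ) * (Complex.Gamma (μ + k + 1))⁻¹)
      (Metric.ball 0 (‖x‖ + 1)) := fun k => by fun_prop
  have hle : ∀ k : ℕ, ∀ w ∈ Metric.ball (0 : ℂ) (‖x‖ + 1),
      ‖w ^ k / (Nat.factorial k : ℂ) * (Complex.Gamma (μ + k + 1))⁻¹‖ ≤
        (‖x‖ + 1) ^ k / (Nat.factorial k : ℝ) * C :=
    fun k w hw => norm_phi_term_le (mem_ball_zero_iff.1 hw).le (hC μ le_rfl k)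
  have hmem : x ∈ Metric.ball (0 : ℂ) (‖x‖ + 1) := by simp
  have h1 := (Complex.differentiableOn_tsum_of_summable_norm hu hd Metric.isOpen_ball hle
    ).differentiableAt (Metric.isOpen_ball.mem_nhds hmem)
  have h2 := Complex.hasSum_deriv_of_summable_norm hu hd Metric.isOpen_ball hle hmem
  have h3 := h1.hasDerivAt
  rw [← h2.tsum_eq, h2.summable.tsum_eq_zero_add] at h3
  refine h3.congr_deriv ?_
  have h0 : deriv (fun x : ℂ => x ^ 0 / (Nat.factorial 0 : ℂ) *
      (Complex.Gamma (μ + (0 : ℕ) + 1))⁻¹) x = 0 := by simp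
  rw [h0, zero_add]
  refine tsum_congr fun k => ?_
  have hk : ((k : ℂ) + 1) ≠ 0 := by exact_mod_cast Nat.succ_ne_zero k
  have hk' : (Nat.factorial k : ℂ) ≠ 0 := by exact_mod_cast Nat.factorial_ne_zero k
  have h4 : HasDerivAt (fun x : ℂ => x ^ (k + 1) / (Nat.factorial (k + 1) : ℂ) *
      (Complex.Gamma (μ + (k + 1 : ℕ) + 1))⁻¹)
      (((k + 1 : ℕ) : ℂ) * x ^ k / (Nat.factorial (k + 1) : ℂ) *
        (Complex.Gamma (μ + (k + 1 : ℕ) + 1))⁻¹) x := by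
    simpa using ((hasDerivAt_pow (k + 1) x).div_const _).mul_const _
  rw [h4.deriv, Nat.factorial_succ, show μ + ((k + 1 : ℕ) : ℂ) + 1 = μ + 1 + k + 1 by
    push_cast; ring]
  push_cast
  field_simp

theorem differentiable_phi (μ : ℂ) : Differentiable ℂ (phi μ) :=
  fun x => (hasDerivAt_phi μ x).differentiableAt

/-- The contiguity relation of `φ_μ` in the order. -/
theorem phi_sub_one (μ x : ℂ) : phi (μ - 1) x = μ * phi μ x + x * phi (μ + 1) x := by
  have e : ∀ k : ℕ, x ^ k / (Nat.factorial k : ℂ) * (Complex.Gamma (μ - 1 + k + 1))⁻¹ =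
      μ * (x ^ k / (Nat.factorial k : ℂ) * (Complex.Gamma (μ + k + 1))⁻¹) +
      k * (x ^ k / (Nat.factorial k : ℂ) * (Complex.Gamma (μ + k + 1))⁻¹) := by
    intro k
    have h1 := Complex.one_div_Gamma_eq_self_mul_one_div_Gamma_add_one (μ + k)
    rw [show μ - 1 + k + 1 = μ + (k : ℂ) by ring, h1]
    ring
  have e2 : ∀ k : ℕ, ((k + 1 : ℕ) : ℂ) * (x ^ (k + 1) / (Nat.factorial (k + 1) : ℂ) *
      (Complex.Gamma (μ + (k + 1 : ℕ) + 1))⁻¹) =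
      x * (x ^ k / (Nat.factorial k : ℂ) * (Complex.Gamma (μ + 1 + k + 1))⁻¹) := by
    intro k
    have hk : ((k : ℂ) + 1) ≠ 0 := by exact_mod_cast Nat.succ_ne_zero k
    have hk' : (Nat.factorial k : ℂ) ≠ 0 := by exact_mod_cast Nat.factorial_ne_zero k
    rw [Nat.factorial_succ, show μ + ((k + 1 : ℕ) : ℂ) + 1 = μ + 1 + k + 1 by push_cast; ring]
    push_cast
    field_simp
    ring
  have s2 : Summable fun k : ℕ => (k : ℂ) * (x ^ k / (Nat.factorial k : ℂ) *
      (Complex.Gamma (μ + k + 1))⁻¹) := by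
    rw [← summable_nat_add_iff 1]
    refine ((summable_phi (μ + 1) x).mul_left x).congr fun k => (e2 k).symm
  unfold phi
  rw [tsum_congr e, ((summable_phi μ x).mul_left μ).tsum_add s2, tsum_mul_left,
    s2.tsum_eq_zero_add, tsum_congr e2, tsum_mul_left]
  simp

/-- The derivative of `φ_μ(x)` in the order is entire in `x`. It enters `K_n` for integers `n`. -/
theorem differentiable_deriv_phi_left (μ : ℂ) :
    Differentiable ℂ fun x => deriv (fun μ => phi μ x) μ := by
  intro x
  obtain ⟨C, hC⟩ := exists_bound_inv_Gamma (‖μ‖ + 1)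
  have hu := (Real.summable_pow_div_factorial (‖x‖ + 1)).mul_right C
  have hb : ∀ k : ℕ, ‖deriv (fun μ : ℂ => (Complex.Gamma (μ + k + 1))⁻¹) μ‖ ≤ C := by
    intro k
    have := Complex.norm_deriv_le_of_forall_mem_sphere_norm_le (c := μ) one_pos
      (differentiable_inv_Gamma_shift k).diffContOnCl (C := C) (fun z hz => hC z (by
        have h1 : ‖z - μ‖ = 1 := by simpa [dist_eq_norm] using hz
        have h2 := norm_add_le (z - μ) μ
        rw [sub_add_cancel, h1] at h2
        linarith) k)
    simpa using this
  have h1 := (Complex.differentiableOn_tsum_of_summable_norm hu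
    (F := fun (k : ℕ) (x : ℂ) => x ^ k / (Nat.factorial k : ℂ) *
        deriv (fun μ : ℂ => (Complex.Gamma (μ + k + 1))⁻¹) μ)
    (U := Metric.ball 0 (‖x‖ + 1)) (fun k => by fun_prop) Metric.isOpen_ball
    (fun k w hw => by
      rw [norm_mul, norm_div, norm_pow, Complex.norm_natCast]
      have h1 : ‖w‖ ≤ ‖x‖ + 1 := (mem_ball_zero_iff.1 hw).le
      have h2 := hb k
      gcongr)).differentiableAt
    (Metric.isOpen_ball.mem_nhds (show x ∈ Metric.ball (0 : ℂ) (‖x‖ + 1) by simp))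
  rwa [show (fun x => deriv (fun μ => phi μ x) μ) = _ from
    funext fun y => (hasDerivAt_phi_left μ y).deriv]

theorem phi_neg_nat (n : ℕ) (x : ℂ) : phi (-n) x = x ^ n * phi n x := by
  unfold phi
  rw [← (summable_phi (-n) x).sum_add_tsum_nat_add n, ← tsum_mul_left]
  have h0 : ∑ k ∈ Finset.range n, x ^ k / (Nat.factorial k : ℂ) *
      (Complex.Gamma (-n + k + 1))⁻¹ = 0 := by
    refine Finset.sum_eq_zero fun k hk => ?_
    have hk := Finset.mem_range.1 hk
    have : (-(n : ℂ) + k + 1) = -((n - 1 - k : ℕ) : ℂ) := by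
      obtain ⟨j, rfl⟩ := Nat.exists_eq_add_of_lt hk
      rw [show k + j + 1 - 1 - k = j by omega]
      push_cast; ring
    rw [this, Complex.Gamma_neg_nat_eq_zero]
    simp
  rw [h0, zero_add]
  refine tsum_congr fun k => ?_
  have e1 : (-(n : ℂ) + ((k + n : ℕ) : ℂ) + 1) = (k : ℂ) + 1 := by push_cast; ring
  have e2 : ((n : ℂ) + (k : ℂ) + 1) = ((k + n : ℕ) : ℂ) + 1 := by push_cast; ring
  rw [e1, e2, Complex.Gamma_nat_eq_factorial, Complex.Gamma_nat_eq_factorial, pow_add]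
  ring

/-! ### Analyticity of `K_ν` and the connection formulas -/

/-- The quotient `(π/2) (I_{-μ}(z) - I_μ(z)) / sin(πμ)`, equal to `K_μ(z)` for non-integer `μ`. -/
def quotK (ζ μ : ℂ) : ℂ :=
  (Real.pi / 2 : ℂ) * (besselI (-μ) ζ - besselI μ ζ) / Complex.sin (Real.pi * μ)

/-- The quotient `(J_μ(z) cos(πμ) - J_{-μ}(z)) / sin(πμ)`, equal to `Y_μ(z)` for non-integer `μ`. -/
def quotY (ζ μ : ℂ) : ℂ :=
  (besselJ μ ζ * Complex.cos (Real.pi * μ) - besselJ (-μ) ζ) / Complex.sin (Real.pi * μ)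

theorem besselI_eq (ν ζ : ℂ) :
    besselI ν ζ = Complex.exp (ν * (ζ - Real.log 2)) * phi ν (Complex.exp ζ ^ 2 / 4) := rfl

theorem besselJ_eq (ν ζ : ℂ) :
    besselJ ν ζ = Complex.exp (ν * (ζ - Real.log 2)) * phi ν (-(Complex.exp ζ ^ 2 / 4)) := by
  unfold besselJ phi
  congr 1
  refine tsum_congr fun k => ?_
  rw [neg_pow (Complex.exp ζ ^ 2 / 4)]

theorem differentiable_besselI_left (ζ : ℂ) : Differentiable ℂ fun μ => besselI μ ζ := by
  simp only [besselI_eq]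
  exact (by fun_prop : Differentiable ℂ fun μ : ℂ => Complex.exp (μ * (ζ - Real.log 2))).mul
    (differentiable_phi_left _)

theorem differentiable_besselJ_left (ζ : ℂ) : Differentiable ℂ fun μ => besselJ μ ζ := by
  simp only [besselJ_eq]
  exact (by fun_prop : Differentiable ℂ fun μ : ℂ => Complex.exp (μ * (ζ - Real.log 2))).mul
    (differentiable_phi_left _)

theorem differentiable_besselI (μ : ℂ) : Differentiable ℂ (besselI μ) := by
  have h := differentiable_phi μ
  rw [show besselI μ = _ from funext (besselI_eq μ)]
  fun_prop

theorem besselI_neg_nat (n : ℕ) (ζ : ℂ) : besselI (-n) ζ = besselI n ζ := by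
  have h2 : Complex.exp (Real.log 2 : ℝ) = 2 := by
    rw [← Complex.ofReal_exp, Real.exp_log two_pos]; norm_num
  have h3 : Complex.exp ζ ^ 2 / 4 = Complex.exp (ζ - Real.log 2) ^ 2 := by
    rw [Complex.exp_sub, h2]; ring
  rw [besselI_eq, besselI_eq, phi_neg_nat, h3, ← mul_assoc]
  congr 1
  rw [← pow_mul, ← Complex.exp_nat_mul, ← Complex.exp_add]
  congr 1
  push_cast
  ring

theorem besselI_neg_int (n : ℤ) (ζ : ℂ) : besselI (-n) ζ = besselI n ζ := by
  obtain ⟨k, rfl | rfl⟩ := n.eq_nat_or_neg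
  · exact_mod_cast besselI_neg_nat k ζ
  · have := (besselI_neg_nat k ζ).symm
    push_cast
    rwa [neg_neg]

theorem hasDerivAt_besselI_left (μ ζ : ℂ) :
    HasDerivAt (fun μ => besselI μ ζ)
      ((ζ - Real.log 2) * besselI μ ζ + Complex.exp (μ * (ζ - Real.log 2)) *
        deriv (fun μ => phi μ (Complex.exp ζ ^ 2 / 4)) μ) μ := by
  have e : (fun μ => besselI μ ζ) = fun μ => Complex.exp (μ * (ζ - Real.log 2)) *
      phi μ (Complex.exp ζ ^ 2 / 4) := funext fun μ => besselI_eq μ ζ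
  rw [e, besselI_eq]
  have h1 : HasDerivAt (fun μ : ℂ => Complex.exp (μ * (ζ - Real.log 2)))
      (Complex.exp (μ * (ζ - Real.log 2)) * (ζ - Real.log 2)) μ := by
    simpa using ((hasDerivAt_id μ).mul_const (ζ - Real.log 2 : ℂ)).cexp
  refine (h1.mul (differentiable_phi_left (Complex.exp ζ ^ 2 / 4) μ).hasDerivAt).congr_deriv ?_
  ring

theorem differentiable_deriv_besselI_left (μ : ℂ) :
    Differentiable ℂ fun ζ => deriv (fun μ => besselI μ ζ) μ := by
  rw [show (fun ζ => deriv (fun μ => besselI μ ζ) μ) = _ from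
    funext fun ζ => (hasDerivAt_besselI_left μ ζ).deriv]
  have h1 := differentiable_besselI μ
  have h2 : Differentiable ℂ fun ζ : ℂ => deriv (fun μ => phi μ (Complex.exp ζ ^ 2 / 4)) μ :=
    (differentiable_deriv_phi_left μ).comp (by fun_prop)
  fun_prop

theorem tendsto_div_of_hasDerivAt {f g : ℂ → ℂ} {f' g' a : ℂ} (hf : HasDerivAt f f' a)
    (hg : HasDerivAt g g' a) (hg' : g' ≠ 0) (hfa : f a = 0) (hga : g a = 0) :
    Tendsto (fun x => f x / g x) (𝓝[≠] a) (𝓝 (f' / g')) := by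
  refine ((hf.tendsto_slope).div (hg.tendsto_slope) hg').congr' ?_
  filter_upwards [self_mem_nhdsWithin] with x hx
  have : x - a ≠ 0 := sub_ne_zero.2 hx
  rw [Pi.div_apply, slope_def_field, slope_def_field, hfa, hga, sub_zero, sub_zero,
    div_div_div_cancel_right₀ this]

theorem sin_pi_mul_int (n : ℤ) : Complex.sin (Real.pi * (n : ℂ)) = 0 := by
  rw [mul_comm]; exact Complex.sin_int_mul_pi n

theorem sin_pi_mul_ne_zero {μ : ℂ} (h : ¬ ∃ n : ℤ, μ = n) : Complex.sin (Real.pi * μ) ≠ 0 := by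
  rw [Complex.sin_ne_zero_iff]
  intro k hk
  have hp : (Real.pi : ℂ) ≠ 0 := by exact_mod_cast Real.pi_ne_zero
  exact h ⟨k, by rw [mul_comm] at hk; exact mul_right_cancel₀ hp hk⟩

theorem eventually_not_int (ν : ℂ) : ∀ᶠ μ : ℂ in 𝓝[≠] ν, ¬ ∃ n : ℤ, μ = n := by
  have h : Differentiable ℂ fun μ : ℂ => Complex.sin (Real.pi * μ) := by fun_prop
  have h1 := (h.analyticAt ν).eventually_eq_zero_or_eventually_ne_zero
  rcases h1 with h1 | h1
  · exfalso
    have h2 := AnalyticOnNhd.eqOn_zero_of_preconnected_of_eventuallyEq_zero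
      (fun z _ => h.analyticAt z) isPreconnected_univ (Set.mem_univ ν) h1
    have h3 := h2 (Set.mem_univ (1 / 2 : ℂ))
    have h4 : (Real.pi : ℂ) * (1 / 2) = Real.pi / 2 := by ring
    simp only [h4, Complex.sin_pi_div_two, Pi.zero_apply, one_ne_zero] at h3
  · filter_upwards [h1] with μ hμ
    rintro ⟨n, rfl⟩
    exact hμ (sin_pi_mul_int n)

theorem hasDerivAt_sin_pi_mul (μ : ℂ) :
    HasDerivAt (fun μ : ℂ => Complex.sin (Real.pi * μ))
      (Complex.cos (Real.pi * μ) * Real.pi) μ := by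
  simpa using ((hasDerivAt_id μ).const_mul (Real.pi : ℂ)).csin

theorem cos_pi_mul_int_ne_zero (n : ℤ) : Complex.cos (Real.pi * (n : ℂ)) ≠ 0 := by
  intro h
  have := Complex.sin_sq_add_cos_sq (Real.pi * (n : ℂ))
  rw [sin_pi_mul_int, h] at this
  norm_num at this

theorem tendsto_quotK_int (n : ℤ) (ζ : ℂ) :
    Tendsto (quotK ζ) (𝓝[≠] (n : ℂ)) (𝓝 ((Real.pi / 2 : ℂ) *
      (-deriv (fun μ => besselI μ ζ) (-n) - deriv (fun μ => besselI μ ζ) n) /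
        (Complex.cos (Real.pi * (n : ℂ)) * Real.pi))) := by
  have hI := differentiable_besselI_left ζ
  have h1 : HasDerivAt (fun μ => besselI (-μ) ζ) (-deriv (fun μ => besselI μ ζ) (-n)) (n : ℂ) := by
    have := (hI (-n)).hasDerivAt.comp (n : ℂ) (hasDerivAt_neg (n : ℂ))
    simpa using! this
  refine tendsto_div_of_hasDerivAt ((h1.sub (hI n).hasDerivAt).const_mul _)
    (hasDerivAt_sin_pi_mul n) ?_ ?_ (sin_pi_mul_int n)
  · exact mul_ne_zero (cos_pi_mul_int_ne_zero n) (by exact_mod_cast Real.pi_ne_zero)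
  · simp [besselI_neg_int]

/-- The limit in the definition of `K_ν` at integers exists, so `K_ν` is the limit of the quotients
at every order. -/
theorem tendsto_quotK (ν ζ : ℂ) : Tendsto (quotK ζ) (𝓝[≠] ν) (𝓝 (besselK ν ζ)) := by
  by_cases h : ∃ n : ℤ, ν = n
  · have e : besselK ν ζ = limUnder (𝓝[≠] ν) (quotK ζ) := by
      simp only [besselK, if_pos h]; rfl
    obtain ⟨n, rfl⟩ := h
    rw [e]
    exact tendsto_nhds_limUnder ⟨_, tendsto_quotK_int n ζ⟩
  · have e : besselK ν ζ = quotK ζ ν := by simp only [besselK, if_neg h]; rfl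
    rw [e]
    have hI := differentiable_besselI_left ζ
    refine ContinuousAt.tendsto (x := ν) ?_ |>.mono_left nhdsWithin_le_nhds
    have h0 := sin_pi_mul_ne_zero h
    have hc : Continuous fun μ => besselI μ ζ := hI.continuous
    unfold quotK
    exact ContinuousAt.div (by fun_prop) (by fun_prop) h0

theorem differentiable_besselK (ν : ℂ) : Differentiable ℂ (besselK ν) := by
  by_cases h : ∃ n : ℤ, ν = n
  · obtain ⟨n, rfl⟩ := h
    have e : besselK n = _ :=
      funext fun ζ => tendsto_nhds_unique (tendsto_quotK n ζ) (tendsto_quotK_int n ζ)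
    rw [e]
    have h1 := differentiable_deriv_besselI_left n
    have h2 := differentiable_deriv_besselI_left (-n)
    fun_prop
  · have e : besselK ν = fun ζ => quotK ζ ν := by
      funext ζ; simp only [besselK, if_neg h]; rfl
    rw [e]
    have h1 := differentiable_besselI ν
    have h2 := differentiable_besselI (-ν)
    unfold quotK
    fun_prop

theorem besselI_add_half_pi (μ ζ : ℂ) :
    besselI μ (ζ + Real.pi / 2 * Complex.I) =
      Complex.exp (μ * (Real.pi / 2 * Complex.I)) * besselJ μ ζ := by
  have h : Complex.exp (ζ + Real.pi / 2 * Complex.I) ^ 2 / 4 = -(Complex.exp ζ ^ 2 / 4) := by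
    rw [Complex.exp_add, Complex.exp_pi_div_two_mul_I, mul_pow, Complex.I_sq]; ring
  rw [besselI_eq, besselJ_eq, h, ← mul_assoc, ← Complex.exp_add]
  congr 2; ring

theorem besselI_sub_half_pi (μ ζ : ℂ) :
    besselI μ (ζ - Real.pi / 2 * Complex.I) =
      Complex.exp (-(μ * (Real.pi / 2 * Complex.I))) * besselJ μ ζ := by
  have h : Complex.exp (ζ - Real.pi / 2 * Complex.I) ^ 2 / 4 = -(Complex.exp ζ ^ 2 / 4) := by
    rw [Complex.exp_sub, Complex.exp_pi_div_two_mul_I, div_pow, Complex.I_sq]; ring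
  rw [besselI_eq, besselJ_eq, h, ← mul_assoc, ← Complex.exp_add]
  congr 2; ring

theorem exp_half_pi_mul_sq (μ : ℂ) :
    Complex.exp (μ * (Real.pi / 2 * Complex.I)) ^ 2 =
      Complex.cos (Real.pi * μ) + Complex.sin (Real.pi * μ) * Complex.I := by
  rw [← Complex.exp_mul_I, ← Complex.exp_nat_mul]
  congr 1; push_cast; ring

theorem exp_neg_half_pi_mul_sq (μ : ℂ) :
    Complex.exp (-(μ * (Real.pi / 2 * Complex.I))) ^ 2 =
      Complex.cos (Real.pi * μ) - Complex.sin (Real.pi * μ) * Complex.I := by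
  have := exp_half_pi_mul_sq (-μ)
  rw [mul_neg, Complex.cos_neg, Complex.sin_neg] at this
  rw [← neg_mul, this]; ring

/-- `J_ν` through the values of `K_ν` at `z e^{±πi/2}`. -/
theorem besselJ_eq_besselK (ν ζ : ℂ) :
    besselJ ν ζ = Complex.I / Real.pi *
      (Complex.exp (ν * (Real.pi / 2 * Complex.I)) * besselK ν (ζ + Real.pi / 2 * Complex.I) -
        Complex.exp (-(ν * (Real.pi / 2 * Complex.I))) *
          besselK ν (ζ - Real.pi / 2 * Complex.I)) := by
  have hp : (Real.pi : ℂ) ≠ 0 := by exact_mod_cast Real.pi_ne_zero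
  have h1 : Tendsto (fun μ => besselJ μ ζ) (𝓝[≠] ν) (𝓝 (besselJ ν ζ)) :=
    ((differentiable_besselJ_left ζ).continuous.tendsto ν).mono_left nhdsWithin_le_nhds
  have c1 : Tendsto (fun μ : ℂ => Complex.exp (μ * (Real.pi / 2 * Complex.I))) (𝓝[≠] ν)
      (𝓝 (Complex.exp (ν * (Real.pi / 2 * Complex.I)))) :=
    (Continuous.tendsto (by fun_prop) ν).mono_left nhdsWithin_le_nhds
  have c2 : Tendsto (fun μ : ℂ => Complex.exp (-(μ * (Real.pi / 2 * Complex.I)))) (𝓝[≠] ν)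
      (𝓝 (Complex.exp (-(ν * (Real.pi / 2 * Complex.I))))) :=
    (Continuous.tendsto (by fun_prop) ν).mono_left nhdsWithin_le_nhds
  have h2 := ((c1.mul (tendsto_quotK ν (ζ + Real.pi / 2 * Complex.I))).sub
    (c2.mul (tendsto_quotK ν (ζ - Real.pi / 2 * Complex.I)))).const_mul (Complex.I / Real.pi)
  refine tendsto_nhds_unique h1 (h2.congr' ?_)
  filter_upwards [eventually_not_int ν] with μ hμ
  have h0 := sin_pi_mul_ne_zero hμ
  have e1 := exp_half_pi_mul_sq μ
  have e2 := exp_neg_half_pi_mul_sq μ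
  have e3 : Complex.exp (μ * (Real.pi / 2 * Complex.I)) *
    Complex.exp (-(μ * (Real.pi / 2 * Complex.I))) = 1 := by
      rw [← Complex.exp_add, add_neg_cancel, Complex.exp_zero]
  simp only [quotK, besselI_add_half_pi, besselI_sub_half_pi, neg_mul, neg_neg]
  generalize Complex.exp (μ * (Real.pi / 2 * Complex.I)) = E at *
  generalize Complex.exp (-(μ * (Real.pi / 2 * Complex.I))) = E' at *
  field_simp
  linear_combination (-Complex.I * besselJ μ ζ) * e1 + (Complex.I * besselJ μ ζ) * e2 -
    2 * Complex.sin (Real.pi * μ) * besselJ μ ζ * Complex.I_sq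

/-- `Y_ν` through the values of `K_ν` at `z e^{±πi/2}`. -/
theorem besselY_eq_besselK (ν ζ : ℂ) :
    besselY ν ζ = -(1 / Real.pi) *
      (Complex.exp (ν * (Real.pi / 2 * Complex.I)) * besselK ν (ζ + Real.pi / 2 * Complex.I) +
        Complex.exp (-(ν * (Real.pi / 2 * Complex.I))) *
          besselK ν (ζ - Real.pi / 2 * Complex.I)) := by
  have hp : (Real.pi : ℂ) ≠ 0 := by exact_mod_cast Real.pi_ne_zero
  have c1 : Tendsto (fun μ : ℂ => Complex.exp (μ * (Real.pi / 2 * Complex.I))) (𝓝[≠] ν)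
      (𝓝 (Complex.exp (ν * (Real.pi / 2 * Complex.I)))) :=
    (Continuous.tendsto (by fun_prop) ν).mono_left nhdsWithin_le_nhds
  have c2 : Tendsto (fun μ : ℂ => Complex.exp (-(μ * (Real.pi / 2 * Complex.I)))) (𝓝[≠] ν)
      (𝓝 (Complex.exp (-(ν * (Real.pi / 2 * Complex.I))))) :=
    (Continuous.tendsto (by fun_prop) ν).mono_left nhdsWithin_le_nhds
  have h2 := ((c1.mul (tendsto_quotK ν (ζ + Real.pi / 2 * Complex.I))).add
    (c2.mul (tendsto_quotK ν (ζ - Real.pi / 2 * Complex.I)))).const_mul (-(1 / Real.pi : ℂ))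
  have key : ∀ μ : ℂ, (¬ ∃ n : ℤ, μ = n) → -(1 / Real.pi : ℂ) *
      (Complex.exp (μ * (Real.pi / 2 * Complex.I)) * quotK (ζ + Real.pi / 2 * Complex.I) μ +
        Complex.exp (-(μ * (Real.pi / 2 * Complex.I))) *
          quotK (ζ - Real.pi / 2 * Complex.I) μ) = quotY ζ μ := by
    intro μ hμ
    have h0 := sin_pi_mul_ne_zero hμ
    have e1 := exp_half_pi_mul_sq μ
    have e2 := exp_neg_half_pi_mul_sq μ
    have e3 : Complex.exp (μ * (Real.pi / 2 * Complex.I)) *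
      Complex.exp (-(μ * (Real.pi / 2 * Complex.I))) = 1 := by
        rw [← Complex.exp_add, add_neg_cancel, Complex.exp_zero]
    simp only [quotK, quotY, besselI_add_half_pi, besselI_sub_half_pi, neg_mul, neg_neg]
    generalize Complex.exp (μ * (Real.pi / 2 * Complex.I)) = E at *
    generalize Complex.exp (-(μ * (Real.pi / 2 * Complex.I))) = E' at *
    field_simp
    linear_combination (besselJ μ ζ) * e1 + (besselJ μ ζ) * e2 - 2 * besselJ (-μ) ζ * e3
  have h3 : Tendsto (quotY ζ) (𝓝[≠] ν) (𝓝 (-(1 / Real.pi) *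
      (Complex.exp (ν * (Real.pi / 2 * Complex.I)) * besselK ν (ζ + Real.pi / 2 * Complex.I) +
        Complex.exp (-(ν * (Real.pi / 2 * Complex.I))) *
          besselK ν (ζ - Real.pi / 2 * Complex.I)))) := by
    refine h2.congr' ?_
    filter_upwards [eventually_not_int ν] with μ hμ using key μ hμ
  by_cases h : ∃ n : ℤ, ν = n
  · have e : besselY ν ζ = limUnder (𝓝[≠] ν) (quotY ζ) := by
      simp only [besselY, if_pos h]; rfl
    rw [e]
    exact h3.limUnder_eq
  · have e : besselY ν ζ = quotY ζ ν := by simp only [besselY, if_neg h]; rfl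
    have e' : ∀ ζ, besselK ν ζ = quotK ζ ν := by
      intro ζ; simp only [besselK, if_neg h]; rfl
    rw [e, e', e', key ν h]

open MeasureTheory

/-! ### Two-sided Laplace integrals -/

/-- Agreement near a point of the real line suffices for the identity theorem in `ℂ`. -/
theorem frequently_ofReal_of_eventually {p : ℂ → Prop} {s₀ : ℝ} (h : ∀ᶠ s : ℝ in 𝓝 s₀, p s) :
    ∃ᶠ z in 𝓝[≠] (s₀ : ℂ), p z := by
  have h1 : Tendsto (fun s : ℝ => (s : ℂ)) (𝓝[≠] s₀) (𝓝[≠] (s₀ : ℂ)) := by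
    refine tendsto_nhdsWithin_of_tendsto_nhds_of_eventually_within _
      ((Complex.continuous_ofReal.tendsto s₀).mono_left nhdsWithin_le_nhds) ?_
    filter_upwards [self_mem_nhdsWithin] with s hs
    simpa using hs
  exact h1.frequently (h.filter_mono nhdsWithin_le_nhds).frequently

/-- A two-sided Laplace transform is analytic inside its strip of convergence, being the complex
moment generating function of the measure with density `g`. -/
theorem analyticOnNhd_integral_cexp_mul {g : ℝ → ℝ} (hg0 : ∀ u, 0 ≤ g u) (hgm : Measurable g)
    {S : Set ℝ} (hS : IsOpen S) (hint : ∀ s ∈ S, Integrable fun u : ℝ => Real.exp (s * u) * g u) :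
    AnalyticOnNhd ℂ (fun ν : ℂ => ∫ u : ℝ, Complex.exp (ν * u) * g u) {ν | ν.re ∈ S} := by
  set μ : Measure ℝ := volume.withDensity fun u => ENNReal.ofReal (g u) with hμ
  have h1 : S ⊆ ProbabilityTheory.integrableExpSet id μ := by
    intro s hs
    have h2 := hint s hs
    show Integrable _ μ
    rw [hμ, integrable_withDensity_iff (by fun_prop) (by simp)]
    simpa [ENNReal.toReal_ofReal, hg0] using h2
  have h2 : S ⊆ interior (ProbabilityTheory.integrableExpSet id μ) := interior_maximal h1 hS
  have h3 := (ProbabilityTheory.analyticOnNhd_complexMGF (X := id) (μ := μ)).mono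
    (fun ν (hν : ν.re ∈ S) => h2 hν)
  have e : ProbabilityTheory.complexMGF id μ =
      fun ν : ℂ => ∫ u : ℝ, Complex.exp (ν * u) * g u := by
    funext ν
    unfold ProbabilityTheory.complexMGF
    rw [hμ, integral_withDensity_eq_integral_toReal_smul (by fun_prop) (by simp)]
    refine integral_congr_ae (Eventually.of_forall fun u => ?_)
    simp [ENNReal.toReal_ofReal, hg0, mul_comm]
  rwa [e] at h3

theorem integrable_exp_sub_exp_sub_exp (s : ℝ) {c d : ℝ} (hc : 0 < c) (hd : 0 < d) :
    Integrable fun u : ℝ => Real.exp (s * u - c * Real.exp u - d * Real.exp (-u)) := by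
  set k := min c d with hk
  have hk0 : 0 < k := lt_min hc hd
  refine Integrable.mono' ((integrable_exp_neg_mul_sq (b := k / 4) (by positivity)).const_mul
    (Real.exp (s ^ 2 / k))) (by fun_prop) (Eventually.of_forall fun u => ?_)
  rw [Real.norm_eq_abs, Real.abs_exp, ← Real.exp_add]
  refine Real.exp_le_exp.2 ?_
  have h1 : k * Real.exp u ≤ c * Real.exp u := by gcongr; exact min_le_left _ _
  have h2 : k * Real.exp (-u) ≤ d * Real.exp (-u) := by gcongr; exact min_le_right _ _
  have h3 : u ^ 2 / 2 ≤ Real.exp u + Real.exp (-u) := by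
    have h4 := Real.quadratic_le_exp_of_nonneg (abs_nonneg u)
    have h5 := Real.exp_abs_le u
    rw [sq_abs] at h4
    linarith [abs_nonneg u]
  have h5 : s * u ≤ k / 4 * u ^ 2 + s ^ 2 / k := by
    have : k / 4 * u ^ 2 + s ^ 2 / k - s * u = (k * u / 2 - s) ^ 2 / k := by
      field_simp; ring
    have h6 : 0 ≤ (k * u / 2 - s) ^ 2 / k := by positivity
    linarith
  nlinarith

/-- Euler's integral for `Γ(s)` after the substitution `t = e^u`. -/
theorem integrable_exp_sub_exp_and_integral {s : ℝ} (hs : 0 < s) :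
    (Integrable fun u : ℝ => Real.exp (s * u - Real.exp u)) ∧
      ∫ u : ℝ, Real.exp (s * u - Real.exp u) = Real.Gamma s := by
  have him : Real.exp '' Set.univ = Set.Ioi 0 := by rw [Set.image_univ, Real.range_exp]
  have hd : ∀ x ∈ Set.univ, HasDerivWithinAt Real.exp (Real.exp x) Set.univ x :=
    fun x _ => (Real.hasDerivAt_exp x).hasDerivWithinAt
  have hinj : Set.InjOn Real.exp Set.univ := Real.exp_injective.injOn
  have e : ∀ u : ℝ, |Real.exp u| • (Real.exp (-Real.exp u) * Real.exp u ^ (s - 1)) =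
      Real.exp (s * u - Real.exp u) := by
    intro u
    rw [Real.abs_exp, smul_eq_mul, ← Real.exp_mul, ← Real.exp_add, ← Real.exp_add]
    congr 1; ring
  constructor
  · have h := Real.GammaIntegral_convergent hs
    rw [← him, integrableOn_image_iff_integrableOn_abs_deriv_smul MeasurableSet.univ hd hinj] at h
    simpa only [e, integrableOn_univ] using h
  · rw [Real.Gamma_eq_integral hs, ← him,
      integral_image_eq_integral_abs_deriv_smul MeasurableSet.univ hd hinj]
    simp only [e, setIntegral_univ]

/-! ### The integral representation of `K_ν` -/

/-- The integral `∫ e^{su} e^{-e^u - x e^{-u}} du` over the real line, which for `x = z²/4` is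
`2 (z/2)^s K_s(z)`. -/
def macdonald (s x : ℝ) : ℝ := ∫ u : ℝ, Real.exp (s * u - Real.exp u - x * Real.exp (-u))

theorem integrable_macdonald (s : ℝ) {x : ℝ} (hx : 0 < x) :
    Integrable fun u : ℝ => Real.exp (s * u - Real.exp u - x * Real.exp (-u)) := by
  simpa using integrable_exp_sub_exp_sub_exp s one_pos hx

theorem hasDerivAt_macdonald (s : ℝ) {x : ℝ} (hx : 0 < x) :
    HasDerivAt (macdonald s) (-macdonald (s - 1) x) x := by
  have hx2 : 0 < x / 2 := by positivity
  have h := (hasDerivAt_integral_of_dominated_loc_of_deriv_le (μ := volume)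
    (F := fun (y : ℝ) (u : ℝ) => Real.exp (s * u - Real.exp u - y * Real.exp (-u)))
    (F' := fun (y : ℝ) (u : ℝ) => -Real.exp ((s - 1) * u - Real.exp u - y * Real.exp (-u)))
    (bound := fun u : ℝ => Real.exp ((s - 1) * u - Real.exp u - x / 2 * Real.exp (-u)))
    (Ioi_mem_nhds (half_lt_self hx)) (Eventually.of_forall fun y => by fun_prop)
    (integrable_macdonald s hx) (by fun_prop) (Eventually.of_forall fun u y hy => ?_)
    (integrable_macdonald (s - 1) hx2) (Eventually.of_forall fun u y hy => ?_)).2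
  · rw [integral_neg] at h
    exact h
  · rw [norm_neg, Real.norm_eq_abs, Real.abs_exp]
    have hy : x / 2 < y := hy
    gcongr
  · have h1 : HasDerivAt (fun y => s * u - Real.exp u - y * Real.exp (-u)) (-Real.exp (-u)) y := by
      simpa using ((hasDerivAt_id y).mul_const (Real.exp (-u))).const_sub (s * u - Real.exp u)
    refine h1.exp.congr_deriv ?_
    rw [mul_neg, ← Real.exp_add]
    congr 2; ring

theorem tendsto_macdonald {s : ℝ} (hs : 0 < s) :
    Tendsto (macdonald s) (𝓝[>] 0) (𝓝 (Real.Gamma s)) := by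
  rw [← (integrable_exp_sub_exp_and_integral hs).2]
  refine tendsto_integral_filter_of_dominated_convergence
    (fun u => Real.exp (s * u - Real.exp u)) (Eventually.of_forall fun y => by fun_prop) ?_
    (integrable_exp_sub_exp_and_integral hs).1 (Eventually.of_forall fun u => ?_)
  · filter_upwards [self_mem_nhdsWithin] with x hx
    refine Eventually.of_forall fun u => ?_
    have hx : 0 < x := hx
    rw [Real.norm_eq_abs, Real.abs_exp]
    refine Real.exp_le_exp.2 ?_
    have : 0 < x * Real.exp (-u) := by positivity
    linarith
  · have : Continuous fun y : ℝ => Real.exp (s * u - Real.exp u - y * Real.exp (-u)) := by fun_prop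
    simpa using (this.tendsto 0).mono_left nhdsWithin_le_nhds

theorem macdonald_neg (s : ℝ) {x : ℝ} (hx : 0 < x) :
    macdonald (-s) x = x ^ (-s) * macdonald s x := by
  unfold macdonald
  rw [← integral_sub_left_eq_self _ volume (Real.log x), ← integral_const_mul]
  refine integral_congr_ae (Eventually.of_forall fun u => ?_)
  simp only
  have e1 : Real.exp (Real.log x - u) = x * Real.exp (-u) := by
    rw [sub_eq_add_neg, Real.exp_add, Real.exp_log hx]
  have e2 : x * Real.exp (-(Real.log x - u)) = Real.exp u := by
    rw [neg_sub, Real.exp_sub, Real.exp_log hx]; field_simp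
  rw [e1, e2, Real.rpow_def_of_pos hx, ← Real.exp_add]
  congr 1; ring

theorem phi_pos_ne_zero {s x : ℝ} (hs : -1 < s) (hx : 0 < x) : phi s x ≠ 0 := by
  have e : ∀ k : ℕ, (x : ℂ) ^ k / (Nat.factorial k : ℂ) * (Complex.Gamma (s + k + 1))⁻¹ =
      ((x ^ k / (Nat.factorial k : ℝ) * (Real.Gamma (s + k + 1))⁻¹ : ℝ) : ℂ) := by
    intro k
    push_cast
    rw [← Complex.Gamma_ofReal]
    push_cast
    rfl
  have hsum := summable_phi s x
  unfold phi
  rw [tsum_congr e, ← Complex.ofReal_tsum]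
  rw [summable_congr e, Complex.summable_ofReal] at hsum
  have hpos : ∀ k : ℕ, 0 < x ^ k / (Nat.factorial k : ℝ) * (Real.Gamma (s + k + 1))⁻¹ := by
    intro k
    have h0 : (0 : ℝ) ≤ k := by positivity
    have := Real.Gamma_pos_of_pos (s := s + k + 1) (by linarith)
    positivity
  exact_mod_cast (hsum.tsum_pos (fun k => (hpos k).le) 0 (hpos 0)).ne'

theorem hasDerivAt_phi_ofReal (μ : ℂ) (x : ℝ) :
    HasDerivAt (fun x : ℝ => phi μ x) (phi (μ + 1) x) x :=
  (hasDerivAt_phi μ x).comp_ofReal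

theorem tendsto_phi_ofReal (μ : ℂ) :
    Tendsto (fun x : ℝ => phi μ x) (𝓝[>] 0) (𝓝 (Complex.Gamma (μ + 1))⁻¹) := by
  have h : phi μ ((0 : ℝ) : ℂ) = (Complex.Gamma (μ + 1))⁻¹ := by
    unfold phi
    rw [tsum_eq_single 0 (fun k hk => by simp [hk])]
    simp
  rw [← h]
  have hc : Continuous fun x : ℝ => phi μ x :=
    (differentiable_phi μ).continuous.comp Complex.continuous_ofReal
  exact (hc.tendsto 0).mono_left nhdsWithin_le_nhds

theorem tendsto_rpow_ofReal {s : ℝ} (hs : 0 < s) :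
    Tendsto (fun x : ℝ => ((x ^ s : ℝ) : ℂ)) (𝓝[>] 0) (𝓝 0) := by
  have := (Real.continuousAt_rpow_const 0 s (Or.inr hs.le)).tendsto.mono_left
    (nhdsWithin_le_nhds (s := Set.Ioi 0))
  rw [Real.zero_rpow hs.ne'] at this
  exact_mod_cast (Complex.continuous_ofReal.tendsto 0).comp this

theorem hasDerivAt_rpow_mul_phi (s : ℝ) {x : ℝ} (hx : 0 < x) :
    HasDerivAt (fun x : ℝ => ((x ^ s : ℝ) : ℂ) * phi s x)
      (((x ^ (s - 1) : ℝ) : ℂ) * phi (s - 1) x) x := by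
  have h1 := (Real.hasDerivAt_rpow_const (x := x) (p := s) (Or.inl hx.ne')).ofReal_comp
  refine (h1.mul (hasDerivAt_phi_ofReal s x)).congr_deriv ?_
  have h2 : ((x ^ s : ℝ) : ℂ) = (x ^ (s - 1) : ℝ) * x := by
    rw [Real.rpow_sub_one hx.ne']
    have : (x : ℂ) ≠ 0 := by exact_mod_cast hx.ne'
    push_cast
    field_simp
  rw [phi_sub_one, h2]
  push_cast
  ring

/-- For `0 < ν < 1` the integral is the combination of the two power series: the difference `G` of
the two sides and `H = -x^{1-ν} G'` solve a linear system of which `(φ_{-ν}, x^{1-ν} φ_{1-ν})` is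
a second solution up to signs, so that a Wronskian is constant; both vanish at `0`. -/
theorem macdonald_eq_phi {ν x : ℝ} (h0 : 0 < ν) (h1 : ν < 1) (hx : 0 < x) :
    (macdonald ν x : ℂ) = Real.pi / Complex.sin (Real.pi * ν) *
      (phi (-ν) x - ((x ^ ν : ℝ) : ℂ) * phi ν x) := by
  set κ : ℂ := Real.pi / Complex.sin (Real.pi * ν) with hκ
  have hκ1 : Complex.Gamma ν * Complex.Gamma (1 - ν) = κ := Complex.Gamma_mul_Gamma_one_sub ν
  have hg1 : Complex.Gamma ν ≠ 0 := Complex.Gamma_ne_zero_of_re_pos (by simpa using h0)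
  have hg2 : Complex.Gamma (1 - ν) ≠ 0 := Complex.Gamma_ne_zero_of_re_pos (by simpa using h1)
  set G : ℝ → ℂ := fun x => macdonald ν x - κ * (phi (-ν) x - ((x ^ ν : ℝ) : ℂ) * phi ν x) with hG
  set H : ℝ → ℂ := fun x => macdonald (1 - ν) x +
    κ * (((x ^ (1 - ν) : ℝ) : ℂ) * phi (1 - ν : ℝ) x - phi (ν - 1) x) with hH
  set A : ℝ → ℂ := fun x => phi (-ν) x with hA
  set B : ℝ → ℂ := fun x => ((x ^ (1 - ν) : ℝ) : ℂ) * phi (1 - ν : ℝ) x with hB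
  have dG : ∀ x : ℝ, 0 < x → HasDerivAt G (-((x ^ (ν - 1) : ℝ) : ℂ) * H x) x := by
    intro x hx
    refine ((hasDerivAt_macdonald ν hx).ofReal_comp.sub (((hasDerivAt_phi_ofReal (-ν) x).sub
      (hasDerivAt_rpow_mul_phi ν hx)).const_mul κ)).congr_deriv ?_
    have e1 : ((x ^ (ν - 1) : ℝ) : ℂ) * ((x ^ (1 - ν) : ℝ) : ℂ) = 1 := by
      rw [← Complex.ofReal_mul, ← Real.rpow_add hx]; simp
    have e2 : (macdonald (ν - 1) x : ℂ) = ((x ^ (ν - 1) : ℝ) : ℂ) * macdonald (1 - ν) x := by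
      have := macdonald_neg (1 - ν) hx
      rw [neg_sub] at this
      exact_mod_cast this
    have e3 : (-ν + 1 : ℂ) = ((1 - ν : ℝ) : ℂ) := by push_cast; ring
    simp only [hH]
    push_cast at *
    rw [e2, e3]
    linear_combination (κ * phi (1 - ν) x) * e1
  have dH : ∀ x : ℝ, 0 < x → HasDerivAt H (-((x ^ (-ν) : ℝ) : ℂ) * G x) x := by
    intro x hx
    refine ((hasDerivAt_macdonald (1 - ν) hx).ofReal_comp.add
      (((hasDerivAt_rpow_mul_phi (1 - ν) hx).sub
      (hasDerivAt_phi_ofReal (ν - 1) x)).const_mul κ)).congr_deriv ?_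
    have e1 : ((x ^ (-ν) : ℝ) : ℂ) * ((x ^ ν : ℝ) : ℂ) = 1 := by
      rw [← Complex.ofReal_mul, ← Real.rpow_add hx]; simp
    have e2 : (macdonald (-ν) x : ℂ) = ((x ^ (-ν) : ℝ) : ℂ) * macdonald ν x := by
      exact_mod_cast macdonald_neg ν hx
    simp only [hG, show (1 - ν - 1 : ℝ) = -ν by ring]
    push_cast at *
    rw [e2, show (1 - ν - 1 : ℂ) = -ν by ring, sub_add_cancel]
    linear_combination (κ * phi ν x) * e1
  have dA : ∀ x : ℝ, 0 < x → HasDerivAt A (((x ^ (ν - 1) : ℝ) : ℂ) * B x) x := by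
    intro x hx
    refine (hasDerivAt_phi_ofReal (-ν) x).congr_deriv ?_
    have e1 : ((x ^ (ν - 1) : ℝ) : ℂ) * ((x ^ (1 - ν) : ℝ) : ℂ) = 1 := by
      rw [← Complex.ofReal_mul, ← Real.rpow_add hx]; simp
    simp only [hB]
    rw [← mul_assoc, e1, one_mul]
    congr 1; push_cast; ring
  have dB : ∀ x : ℝ, 0 < x → HasDerivAt B (((x ^ (-ν) : ℝ) : ℂ) * A x) x := by
    intro x hx
    refine (hasDerivAt_rpow_mul_phi (1 - ν) hx).congr_deriv ?_
    simp only [show (1 - ν - 1 : ℝ) = -ν by ring, hA]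
    push_cast
    rw [show (1 - ν - 1 : ℂ) = -ν by ring]
  have lA : Tendsto A (𝓝[>] 0) (𝓝 (Complex.Gamma (-ν + 1))⁻¹) := tendsto_phi_ofReal _
  have lB : Tendsto B (𝓝[>] 0) (𝓝 (0 * (Complex.Gamma ((1 - ν : ℝ) + 1))⁻¹)) :=
    (tendsto_rpow_ofReal (by linarith)).mul (tendsto_phi_ofReal _)
  have lF : ∀ s : ℝ, 0 < s → Tendsto (fun x => (macdonald s x : ℂ)) (𝓝[>] 0)
      (𝓝 (Complex.Gamma s)) := by
    intro s hs
    rw [Complex.Gamma_ofReal]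
    exact (Complex.continuous_ofReal.tendsto _).comp (tendsto_macdonald hs)
  have lG : Tendsto G (𝓝[>] 0) (𝓝 0) := by
    have := (lF ν h0).sub ((lA.sub ((tendsto_rpow_ofReal h0).mul
      (tendsto_phi_ofReal ν))).const_mul κ)
    convert this using 2
    rw [← hκ1, neg_add_eq_sub]
    field_simp
    ring
  have lH : Tendsto H (𝓝[>] 0) (𝓝 0) := by
    have := (lF (1 - ν) (by linarith)).add ((lB.sub (tendsto_phi_ofReal (ν - 1))).const_mul κ)
    convert this using 2
    rw [← hκ1]
    push_cast
    rw [sub_add_cancel]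
    field_simp
    ring
  have const : ∀ (f : ℝ → ℂ), (∀ x : ℝ, 0 < x → HasDerivAt f 0 x) →
      Tendsto f (𝓝[>] 0) (𝓝 0) → ∀ x : ℝ, 0 < x → f x = 0 := by
    intro f hf hl x hx
    have h2 : ∀ y ∈ Set.Ioi (0 : ℝ), f y = f x := by
      intro y hy
      exact isOpen_Ioi.is_const_of_deriv_eq_zero isPreconnected_Ioi
        (fun z hz => (hf z hz).differentiableAt.differentiableWithinAt)
        (fun z hz => (hf z hz).deriv) hy hx
    have h3 : Tendsto f (𝓝[>] 0) (𝓝 (f x)) :=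
      tendsto_const_nhds.congr' (by
        filter_upwards [self_mem_nhdsWithin] with y hy using (h2 y hy).symm)
    exact tendsto_nhds_unique h3 hl
  have W : ∀ x : ℝ, 0 < x → G x * B x + H x * A x = 0 := by
    refine const _ (fun x hx => ?_) ?_
    · refine (((dG x hx).mul (dB x hx)).add ((dH x hx).mul (dA x hx))).congr_deriv ?_
      ring
    · simpa using (lG.mul lB).add (lH.mul lA)
  have hA0 : ∀ x : ℝ, 0 < x → A x ≠ 0 := by
    intro x hx
    have := phi_pos_ne_zero (s := -ν) (by linarith) hx
    push_cast at this
    exact this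
  have Q : ∀ x : ℝ, 0 < x → G x / A x = 0 := by
    refine const (fun x => G x / A x) (fun x hx => ?_) ?_
    · refine ((dG x hx).div (dA x hx) (hA0 x hx)).congr_deriv ?_
      rw [div_eq_zero_iff]
      left
      linear_combination (-((x ^ (ν - 1) : ℝ) : ℂ)) * W x hx
    · have h4 : (Complex.Gamma (-ν + 1))⁻¹ ≠ 0 := by
        rw [neg_add_eq_sub]; exact inv_ne_zero hg2
      have h5 := lG.div lA h4
      rwa [zero_div] at h5
  have := Q x hx
  rw [div_eq_zero_iff] at this
  exact sub_eq_zero.1 (this.resolve_right (hA0 x hx))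

theorem differentiable_integral_cexp_mul {c d : ℝ} (hc : 0 < c) (hd : 0 < d) :
    Differentiable ℂ fun ν : ℂ => ∫ u : ℝ, Complex.exp (ν * u) *
      (Real.exp (-(c * Real.exp u) - d * Real.exp (-u)) : ℝ) := by
  have h := analyticOnNhd_integral_cexp_mul
    (g := fun u => Real.exp (-(c * Real.exp u) - d * Real.exp (-u))) (S := Set.univ)
    (fun u => (Real.exp_pos _).le) (by fun_prop) isOpen_univ fun s _ => by
      refine (integrable_exp_sub_exp_sub_exp s hc hd).congr (Eventually.of_forall fun u => ?_)
      simp only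
      rw [← Real.exp_add]; congr 1; ring
  exact fun ν => (h ν (by simp)).differentiableAt

/-- The continuation of `macdonald_eq_phi` to all complex orders. -/
theorem sin_mul_integral_eq_phi (ν : ℂ) {x : ℝ} (hx : 0 < x) :
    Complex.sin (Real.pi * ν) * ∫ u : ℝ, Complex.exp (ν * u) *
      (Real.exp (-(1 * Real.exp u) - x * Real.exp (-u)) : ℝ) =
    Real.pi * (phi (-ν) x - Complex.exp (ν * Real.log x) * phi ν x) := by
  have hd1 := differentiable_integral_cexp_mul one_pos hx
  have hd2 := differentiable_phi_left x
  have hd3 : Differentiable ℂ fun ν : ℂ => phi (-ν) x := hd2.comp (by fun_prop)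
  have hl : Differentiable ℂ fun ν : ℂ => Complex.sin (Real.pi * ν) * ∫ u : ℝ,
      Complex.exp (ν * u) * (Real.exp (-(1 * Real.exp u) - x * Real.exp (-u)) : ℝ) := by fun_prop
  have hr : Differentiable ℂ fun ν : ℂ => Real.pi *
      (phi (-ν) x - Complex.exp (ν * Real.log x) * phi ν x) := by fun_prop
  have real : ∀ s : ℝ, 0 < s → s < 1 → Complex.sin (Real.pi * s) * ∫ u : ℝ,
      Complex.exp (s * u) * (Real.exp (-(1 * Real.exp u) - x * Real.exp (-u)) : ℝ) =
      Real.pi * (phi (-s) x - Complex.exp (s * Real.log x) * phi s x) := by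
    intro s h0 h1
    have e1 : ∫ u : ℝ, Complex.exp (s * u) *
        (Real.exp (-(1 * Real.exp u) - x * Real.exp (-u)) : ℝ) = macdonald s x := by
      rw [macdonald, ← integral_complex_ofReal]
      refine integral_congr_ae (Eventually.of_forall fun u => ?_)
      simp only
      push_cast
      rw [← Complex.exp_add]
      congr 1; ring
    have hs : Complex.sin (Real.pi * s) ≠ 0 := by
      have : 0 < Real.sin (Real.pi * s) :=
        Real.sin_pos_of_pos_of_lt_pi (by positivity) (by nlinarith [Real.pi_pos])
      exact_mod_cast this.ne'
    have e2 : ((x ^ s : ℝ) : ℂ) = Complex.exp (s * Real.log x) := by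
      rw [Real.rpow_def_of_pos hx]; push_cast; rw [mul_comm]
    rw [e1, macdonald_eq_phi h0 h1 hx, e2]
    field_simp
  have key := AnalyticOnNhd.eqOn_of_preconnected_of_frequently_eq (z₀ := ((1 / 2 : ℝ) : ℂ))
    (fun z _ => hl.analyticAt z) (fun z _ => hr.analyticAt z) isPreconnected_univ (Set.mem_univ _)
    (frequently_ofReal_of_eventually (by
      filter_upwards [Ioo_mem_nhds (show (0 : ℝ) < 1 / 2 by norm_num)
        (show (1 / 2 : ℝ) < 1 by norm_num)] with s hs using real s hs.1 hs.2))
  exact key (Set.mem_univ ν)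

/-- The integral representation of `K_ν` on the positive axis. -/
theorem besselK_ofReal (ν : ℂ) (r : ℝ) :
    besselK ν r = 1 / 2 * ∫ u : ℝ, Complex.exp (ν * u) *
      (Real.exp (-(Real.exp r / 2 * Real.exp u) - Real.exp r / 2 * Real.exp (-u)) : ℝ) := by
  have hx : 0 < Real.exp r / 2 := by positivity
  have hX : 0 < Real.exp r ^ 2 / 4 := by positivity
  have hlim : Tendsto (fun μ : ℂ => 1 / 2 * ∫ u : ℝ, Complex.exp (μ * u) *
      (Real.exp (-(Real.exp r / 2 * Real.exp u) - Real.exp r / 2 * Real.exp (-u)) : ℝ)) (𝓝[≠] ν)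
      (𝓝 (1 / 2 * ∫ u : ℝ, Complex.exp (ν * u) *
      (Real.exp (-(Real.exp r / 2 * Real.exp u) - Real.exp r / 2 * Real.exp (-u)) : ℝ))) :=
    (((differentiable_integral_cexp_mul hx hx).continuous.tendsto ν).const_mul
      (1 / 2)).mono_left nhdsWithin_le_nhds
  refine tendsto_nhds_unique (tendsto_quotK ν r) (hlim.congr' ?_)
  filter_upwards [eventually_not_int ν] with μ hμ
  have hs := sin_pi_mul_ne_zero hμ
  have h1 := sin_mul_integral_eq_phi μ hX
  have hlog : Real.log (Real.exp r ^ 2 / 4) = 2 * (r - Real.log 2) := by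
    rw [Real.log_div (by positivity) (by norm_num), Real.log_pow, Real.log_exp,
      show (4 : ℝ) = 2 ^ 2 by norm_num, Real.log_pow]
    push_cast; ring
  have hexp : Real.exp (r - Real.log 2) = Real.exp r / 2 := by
    rw [Real.exp_sub, Real.exp_log two_pos]
  have h2 : ∫ u : ℝ, Complex.exp (μ * u) * (Real.exp (-(1 * Real.exp u) -
      Real.exp r ^ 2 / 4 * Real.exp (-u)) : ℝ) =
      Complex.exp (μ * (r - Real.log 2)) * ∫ u : ℝ, Complex.exp (μ * u) *
      (Real.exp (-(Real.exp r / 2 * Real.exp u) - Real.exp r / 2 * Real.exp (-u)) : ℝ) := by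
    rw [← integral_add_right_eq_self _ (r - Real.log 2), ← integral_const_mul]
    refine integral_congr_ae (Eventually.of_forall fun u => ?_)
    simp only
    have e1 : Real.exp (u + (r - Real.log 2)) = Real.exp r / 2 * Real.exp u := by
      rw [Real.exp_add, hexp, mul_comm]
    have e2 : Real.exp r ^ 2 / 4 * Real.exp (-(u + (r - Real.log 2))) =
        Real.exp r / 2 * Real.exp (-u) := by
      rw [neg_add, Real.exp_add, Real.exp_neg (r - Real.log 2), hexp]
      field_simp; ring
    rw [e1, e2, one_mul, ← mul_assoc, ← Complex.exp_add]
    congr 2; push_cast; ring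
  rw [h2, hlog] at h1
  have e3 : Complex.exp (-μ * (r - Real.log 2)) * Complex.exp (μ * (r - Real.log 2)) = 1 := by
    rw [← Complex.exp_add]; simp
  have e4 : Complex.exp (μ * (2 * (r - Real.log 2) : ℝ)) =
      Complex.exp (μ * (r - Real.log 2)) ^ 2 := by
    rw [← Complex.exp_nat_mul]; congr 1; push_cast; ring
  rw [e4] at h1
  simp only [quotK, besselI_eq]
  clear hlim h2
  push_cast at *
  generalize Complex.exp (-μ * (r - (Real.log 2 : ℝ))) = E' at *
  generalize Complex.exp (μ * (r - (Real.log 2 : ℝ))) = E at *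
  generalize (∫ u : ℝ, _ : ℂ) = J at *
  generalize Complex.sin (Real.pi * μ) = S at *
  field_simp
  linear_combination E' * h1 - (S * J + Real.pi * E * phi μ (Complex.exp r ^ 2 / 4)) * e3

theorem integrable_exp_mul_cosh_mul_exp_neg (s : ℝ) {x : ℝ} (hx : 0 < x) :
    Integrable fun u : ℝ => Real.exp (s * u) * Real.cosh u * Real.exp (-(x * Real.cosh u)) := by
  have h := ((integrable_exp_sub_exp_sub_exp (s + 1) (half_pos hx) (half_pos hx)).add
    (integrable_exp_sub_exp_sub_exp (s - 1) (half_pos hx) (half_pos hx))).div_const 2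
  refine h.congr (Eventually.of_forall fun u => ?_)
  have e1 : (s + 1) * u - x / 2 * Real.exp u - x / 2 * Real.exp (-u) =
      s * u + u + -(x * Real.cosh u) := by rw [Real.cosh_eq]; ring
  have e2 : (s - 1) * u - x / 2 * Real.exp u - x / 2 * Real.exp (-u) =
      s * u + -u + -(x * Real.cosh u) := by rw [Real.cosh_eq]; ring
  simp only [Pi.add_apply, e1, e2, Real.exp_add]
  rw [Real.cosh_eq u]
  ring

theorem hasDerivAt_integral_exp_neg_mul_cosh (s : ℝ) {x : ℝ} (hx : 0 < x) :
    HasDerivAt (fun x : ℝ => ∫ u : ℝ, Real.exp (s * u) * Real.exp (-(x * Real.cosh u)))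
      (-∫ u : ℝ, Real.exp (s * u) * Real.cosh u * Real.exp (-(x * Real.cosh u))) x := by
  have hx2 : 0 < x / 2 := by positivity
  have hint : Integrable fun u : ℝ => Real.exp (s * u) * Real.exp (-(x * Real.cosh u)) := by
    refine (integrable_exp_mul_cosh_mul_exp_neg s hx).mono' (by fun_prop)
      (Eventually.of_forall fun u => ?_)
    rw [Real.norm_eq_abs, abs_of_pos (by positivity)]
    have := Real.one_le_cosh u
    have h1 := Real.exp_pos (s * u)
    gcongr
    nlinarith
  have h := (hasDerivAt_integral_of_dominated_loc_of_deriv_le (μ := volume)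
    (F := fun (y : ℝ) (u : ℝ) => Real.exp (s * u) * Real.exp (-(y * Real.cosh u)))
    (F' := fun (y : ℝ) (u : ℝ) =>
      -(Real.exp (s * u) * Real.cosh u * Real.exp (-(y * Real.cosh u))))
    (bound := fun u : ℝ => Real.exp (s * u) * Real.cosh u * Real.exp (-(x / 2 * Real.cosh u)))
    (Ioi_mem_nhds (half_lt_self hx)) (Eventually.of_forall fun y => by fun_prop)
    hint (by fun_prop) (Eventually.of_forall fun u y hy => ?_)
    (integrable_exp_mul_cosh_mul_exp_neg s hx2) (Eventually.of_forall fun u y hy => ?_)).2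
  · rwa [integral_neg] at h
  · have hy : x / 2 < y := hy
    have := Real.cosh_pos u
    rw [norm_neg, Real.norm_eq_abs, abs_of_pos (by positivity)]
    gcongr
  · have h1 : HasDerivAt (fun y => -(y * Real.cosh u)) (-Real.cosh u) y := by
      simpa using! ((hasDerivAt_id y).mul_const (Real.cosh u)).neg
    refine (h1.exp.const_mul (Real.exp (s * u))).congr_deriv ?_
    ring

theorem zderiv_besselK_ofReal (ν r : ℝ) :
    zderiv (besselK ν) r = ((-(1 / 2 * ∫ u : ℝ, Real.exp (ν * u) * Real.cosh u *
      Real.exp (-(Real.exp r * Real.cosh u))) : ℝ) : ℂ) := by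
  have e : ∀ r : ℝ, besselK ν r =
      ((1 / 2 * ∫ u : ℝ, Real.exp (ν * u) * Real.exp (-(Real.exp r * Real.cosh u)) : ℝ) : ℂ) := by
    intro r
    rw [besselK_ofReal, Complex.ofReal_mul, ← integral_complex_ofReal]
    push_cast
    congr 2
    funext u
    congr 2
    rw [Complex.cosh]; ring
  have h1 : HasDerivAt (fun r : ℝ => besselK ν r) (deriv (besselK ν) r) r :=
    ((differentiable_besselK ν) (r : ℂ)).hasDerivAt.comp_ofReal
  have h2 := ((((hasDerivAt_integral_exp_neg_mul_cosh ν (Real.exp_pos r)).comp r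
    (Real.hasDerivAt_exp r)).const_mul (1 / 2)).ofReal_comp).congr_of_eventuallyEq
      (Eventually.of_forall e)
  rw [zderiv, h1.unique h2]
  push_cast
  have e3 : Complex.exp (-r) * Complex.exp r = 1 := by rw [← Complex.exp_add]; simp
  linear_combination (-(1 / 2) * ((∫ u : ℝ, Real.exp (ν * u) * Real.cosh u *
      Real.exp (-(Real.exp r * Real.cosh u)) : ℝ) : ℂ)) * e3

/-! ### Even functions -/

theorem integral_exp_mul_even {f : ℝ → ℝ} (hf : ∀ u, f (-u) = f u) {s : ℝ}
    (hint : Integrable fun u => Real.exp (s * u) * f u) :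
    (Integrable fun u => Real.cosh (s * u) * f u) ∧
      ∫ u, Real.cosh (s * u) * f u = ∫ u, Real.exp (s * u) * f u := by
  have h1 : Integrable fun u => Real.exp (-(s * u)) * f u := by
    simpa [hf] using hint.comp_neg
  have h2 : ∫ u, Real.exp (-(s * u)) * f u = ∫ u, Real.exp (s * u) * f u := by
    rw [← integral_neg_eq_self]; simp [hf]
  have e : (fun u => Real.cosh (s * u) * f u) =
      fun u => (Real.exp (s * u) * f u + Real.exp (-(s * u)) * f u) / 2 := by
    funext u; rw [Real.cosh_eq]; ring
  rw [e]
  refine ⟨(hint.add h1).div_const 2, ?_⟩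
  rw [integral_div, integral_add hint h1, h2]
  ring

/-- The normalized derivative `-(2x/π)^{1/2} e^x K_ν'(x)` for `x > 0`, given by its integral
representation; see `neg_zderiv_besselK_div_prefactorK`. -/
def scaledK (ν x : ℝ) : ℝ :=
  √(2 * x / Real.pi) *
    ∫ b : ℝ, Real.cosh (2 * ν * b) * Real.cosh (2 * b) * Real.exp (-(2 * x * Real.sinh b ^ 2))

theorem integrable_scaledK (ν : ℝ) {x : ℝ} (hx : 0 < x) :
    Integrable fun b : ℝ =>
      Real.cosh (2 * ν * b) * Real.cosh (2 * b) * Real.exp (-(2 * x * Real.sinh b ^ 2)) := by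
  have h1 := (integral_exp_mul_even (f := fun u => Real.cosh u * Real.exp (-(x * Real.cosh u)))
    (by simp) (s := ν)
    (by simpa only [mul_assoc] using integrable_exp_mul_cosh_mul_exp_neg ν hx)).1
  have h2 := (h1.comp_mul_left' (two_ne_zero' ℝ)).const_mul (Real.exp x)
  refine h2.congr (Eventually.of_forall fun b => ?_)
  have e : -(2 * x * Real.sinh b ^ 2) = x + -(x * Real.cosh (2 * b)) := by
    rw [Real.cosh_two_mul, Real.cosh_sq]; ring
  simp only
  rw [e, Real.exp_add, show ν * (2 * b) = 2 * ν * b by ring]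
  ring

theorem neg_zderiv_besselK_div_prefactorK (ν r : ℝ) :
    -zderiv (besselK ν) r / prefactorK r = (scaledK ν (Real.exp r) : ℂ) := by
  set x := Real.exp r with hx
  have hx0 : 0 < x := Real.exp_pos r
  have h1 := (integral_exp_mul_even (f := fun u => Real.cosh u * Real.exp (-(x * Real.cosh u)))
    (by simp) (s := ν)
    (by simpa only [mul_assoc] using integrable_exp_mul_cosh_mul_exp_neg ν hx0)).2
  have h2 : ∫ u : ℝ, Real.exp (ν * u) * Real.cosh u * Real.exp (-(x * Real.cosh u)) =
      2 * Real.exp (-x) * ∫ b : ℝ, Real.cosh (2 * ν * b) * Real.cosh (2 * b) *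
        Real.exp (-(2 * x * Real.sinh b ^ 2)) := by
    have h3 := Measure.integral_comp_mul_left
      (fun u => Real.cosh (ν * u) * (Real.cosh u * Real.exp (-(x * Real.cosh u)))) 2
    simp only [mul_assoc] at h1 ⊢
    rw [← h1]
    have h4 : ∫ u, Real.cosh (ν * u) * (Real.cosh u * Real.exp (-(x * Real.cosh u))) =
      2 * ∫ b : ℝ, Real.cosh (ν * (2 * b)) * (Real.cosh (2 * b) *
        Real.exp (-(x * Real.cosh (2 * b)))) := by
      rw [h3, abs_of_pos (by norm_num), smul_eq_mul]; ring
    rw [h4, ← integral_const_mul (Real.exp (-x))]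
    congr 2
    funext b
    have e : -(x * Real.cosh (2 * b)) = -x + -(2 * (x * Real.sinh b ^ 2)) := by
      rw [Real.cosh_two_mul, Real.cosh_sq]; ring
    rw [e, Real.exp_add, show ν * (2 * b) = 2 * (ν * b) by ring]
    ring
  have hp : prefactorK r =
      ((√(Real.pi / 2) * Real.exp (-r / 2) * Real.exp (-x) : ℝ) : ℂ) := by
    unfold prefactorK; rw [hx]; push_cast; rfl
  have hs : √(2 * x / Real.pi) * (√(Real.pi / 2) * Real.exp (-r / 2)) = 1 := by
    have : Real.exp (-r / 2) = √(x⁻¹) := by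
      rw [hx, ← Real.exp_neg, ← Real.exp_half]
    rw [this, ← Real.sqrt_mul (by positivity), ← Real.sqrt_mul (by positivity)]
    rw [Real.sqrt_eq_one]
    field_simp
  rw [zderiv_besselK_ofReal, ← hx, h2, hp, ← Complex.ofReal_neg, ← Complex.ofReal_div, scaledK]
  congr 1
  clear h1 h2
  generalize (∫ b : ℝ, _ : ℝ) = J
  rw [div_eq_iff (by positivity)]
  linear_combination (-J * Real.exp (-x)) * hs

/-! ### A subtracted dispersion relation for `cosh (s b) / cosh b` -/

theorem exp_abs_le_two_mul_cosh (a : ℝ) : Real.exp |a| ≤ 2 * Real.cosh a := by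
  rw [Real.cosh_eq]; linarith [Real.exp_abs_le a]

theorem integrable_exp_neg_mul_abs {k : ℝ} (hk : 0 < k) :
    Integrable fun a : ℝ => Real.exp (-(k * |a|)) := by
  set m := min 1 (k ^ 2 / 2) with hm
  have hm0 : 0 < m := lt_min one_pos (by positivity)
  refine (integrable_inv_one_add_sq.const_mul m⁻¹).mono' (by fun_prop)
    (Eventually.of_forall fun a => ?_)
  rw [Real.norm_eq_abs, Real.abs_exp, Real.exp_neg, ← mul_inv]
  refine inv_anti₀ (by positivity) ?_
  have h1 := Real.quadratic_le_exp_of_nonneg (show 0 ≤ k * |a| by positivity)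
  have h2 : m ≤ 1 := min_le_left _ _
  have h3 : m ≤ k ^ 2 / 2 := min_le_right _ _
  have h4 : 0 ≤ k * |a| := by positivity
  rw [mul_pow, sq_abs] at h1
  nlinarith [sq_nonneg a]

theorem integrable_exp_mul_div_cosh_pow {s : ℝ} {n : ℕ} (h : |s| < n) :
    Integrable fun a : ℝ => Real.exp (s * a) / Real.cosh a ^ n := by
  refine ((integrable_exp_neg_mul_abs (sub_pos.2 h)).const_mul (2 ^ n)).mono'
    (Continuous.aestronglyMeasurable ?_) (Eventually.of_forall fun a => ?_)
  · exact Continuous.div (by fun_prop) (by fun_prop) fun a => (pow_pos (Real.cosh_pos a) n).ne'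
  · have hc := Real.cosh_pos a
    rw [Real.norm_eq_abs, abs_of_pos (by positivity), div_le_iff₀ (by positivity)]
    have h1 : Real.exp |a| ^ n ≤ (2 * Real.cosh a) ^ n := by
      gcongr; exact exp_abs_le_two_mul_cosh a
    rw [mul_pow, ← Real.exp_nat_mul] at h1
    calc Real.exp (s * a) ≤ Real.exp (-((n - |s|) * |a|)) * Real.exp (n * |a|) := by
          rw [← Real.exp_add]
          refine Real.exp_le_exp.2 ?_
          have : s * a ≤ |s| * |a| := by rw [← abs_mul]; exact le_abs_self _
          linarith
      _ ≤ Real.exp (-((n - |s|) * |a|)) * (2 ^ n * Real.cosh a ^ n) := by gcongr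
      _ = _ := by ring

/-- The Fourier transform of `1 / cosh`, in the strip where it converges. -/
theorem integral_exp_mul_div_cosh {s : ℝ} (hs : |s| < 1) :
    ∫ a : ℝ, Real.exp (s * a) / Real.cosh a = Real.pi / Real.cos (Real.pi * s / 2) := by
  obtain ⟨h1, h2⟩ := abs_lt.1 hs
  have hΓ := Complex.betaIntegral_eq_Gamma_mul_div ((1 + s) / 2 : ℝ) ((1 - s) / 2 : ℝ)
    (by rw [Complex.ofReal_re]; linarith) (by rw [Complex.ofReal_re]; linarith)
  have e1 : (((1 + s) / 2 : ℝ) : ℂ) + ((1 - s) / 2 : ℝ) = 1 := by push_cast; ring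
  rw [e1, Complex.Gamma_one, div_one, show (((1 - s) / 2 : ℝ) : ℂ) = 1 - ((1 + s) / 2 : ℝ) by
    push_cast; ring, Complex.Gamma_mul_Gamma_one_sub] at hΓ
  have e2 : Complex.sin (Real.pi * ((1 + s) / 2 : ℝ)) = (Real.cos (Real.pi * s / 2) : ℂ) := by
    rw [← Real.sin_add_pi_div_two]; push_cast; congr 1; ring
  rw [e2] at hΓ
  have him : Real.sigmoid '' Set.univ = Set.Ioo 0 1 := by rw [Set.image_univ, Real.range_sigmoid]
  have hbeta : Complex.betaIntegral ((1 + s) / 2 : ℝ) (1 - ((1 + s) / 2 : ℝ)) =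
      ∫ y : ℝ, ((Real.exp (s * (y / 2)) / Real.cosh (y / 2) / 2 : ℝ) : ℂ) := by
    rw [Complex.betaIntegral, intervalIntegral.integral_of_le zero_le_one,
      integral_Ioc_eq_integral_Ioo, ← him,
      integral_image_eq_integral_abs_deriv_smul MeasurableSet.univ
        (fun x _ => (Real.hasDerivAt_sigmoid x).hasDerivWithinAt)
        Real.sigmoid_injective.injOn, setIntegral_univ]
    refine integral_congr_ae (Eventually.of_forall fun y => ?_)
    simp only
    have p1 := Real.sigmoid_pos y
    have p2 : 0 < 1 - Real.sigmoid y := by linarith [Real.sigmoid_lt_one y]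
    have hc := Real.cosh_pos (y / 2)
    have d1 : Real.sigmoid y = Real.exp (y / 2) / (2 * Real.cosh (y / 2)) := by
      rw [Real.sigmoid_def, Real.cosh_eq, show -y = -(y / 2) + -(y / 2) by ring, Real.exp_add,
        Real.exp_neg]
      field_simp
    have d2 : 1 - Real.sigmoid y = Real.exp (-(y / 2)) / (2 * Real.cosh (y / 2)) := by
      rw [d1, Real.cosh_eq]; field_simp; ring
    rw [abs_of_pos (by positivity)]
    have c1 : ((Real.sigmoid y : ℝ) : ℂ) ^ ((((1 + s) / 2 : ℝ) : ℂ) - 1) =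
        ((Real.sigmoid y ^ ((1 + s) / 2 - 1) : ℝ) : ℂ) := by
      rw [Complex.ofReal_cpow p1.le]; push_cast; rfl
    have c2 : (1 - (Real.sigmoid y : ℂ)) ^ ((1 - ((1 + s) / 2 : ℝ) : ℂ) - 1) =
        (((1 - Real.sigmoid y) ^ (-((1 + s) / 2)) : ℝ) : ℂ) := by
      rw [Complex.ofReal_cpow p2.le]; push_cast; congr 1; ring
    rw [c1, c2, ← Complex.ofReal_mul, Complex.real_smul, ← Complex.ofReal_mul]
    congr 1
    rw [Real.rpow_sub_one p1.ne', Real.rpow_neg p2.le]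
    have r1 : Real.sigmoid y ^ ((1 + s) / 2) =
        Real.exp (y / 2 * ((1 + s) / 2)) / (2 * Real.cosh (y / 2)) ^ ((1 + s) / 2) := by
      rw [d1, Real.div_rpow (by positivity) (by positivity), ← Real.exp_mul]
    have r2 : (1 - Real.sigmoid y) ^ ((1 + s) / 2) =
        Real.exp (-(y / 2) * ((1 + s) / 2)) / (2 * Real.cosh (y / 2)) ^ ((1 + s) / 2) := by
      rw [d2, Real.div_rpow (by positivity) (by positivity), ← Real.exp_mul]
    rw [r1, r2]
    have hq : 0 < (2 * Real.cosh (y / 2)) ^ ((1 + s) / 2) := by positivity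
    have : Real.exp (s * (y / 2)) = Real.exp (y / 2 * ((1 + s) / 2)) *
        (Real.exp (-(y / 2) * ((1 + s) / 2)))⁻¹ * Real.exp (-(y / 2)) := by
      rw [← Real.exp_neg, ← Real.exp_add, ← Real.exp_add]; congr 1; ring
    rw [this]
    field_simp
    rw [d2]
    field_simp
  rw [hbeta, integral_complex_ofReal] at hΓ
  have h3 : ∫ y : ℝ, Real.exp (s * (y / 2)) / Real.cosh (y / 2) / 2 =
      ∫ a : ℝ, Real.exp (s * a) / Real.cosh a := by
    rw [integral_div, Measure.integral_comp_div (fun a => Real.exp (s * a) / Real.cosh a) 2]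
    simp
  rw [h3] at hΓ
  exact_mod_cast hΓ

theorem tendsto_exp_mul_div_cosh_pow_atTop {s : ℝ} {n : ℕ} (h : |s| < n) :
    Tendsto (fun a : ℝ => Real.exp (s * a) / Real.cosh a ^ n) atTop (𝓝 0) := by
  have h1 : Tendsto (fun a : ℝ => 2 ^ n * Real.exp (-((n - s) * a))) atTop (𝓝 0) := by
    have h2 : 0 < n - s := by linarith [le_abs_self s]
    simpa using (Real.tendsto_exp_neg_atTop_nhds_zero.comp
      (tendsto_id.const_mul_atTop h2)).const_mul (2 ^ n)
  refine squeeze_zero (fun a => by have := Real.cosh_pos a; positivity) (fun a => ?_) h1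
  have hc := Real.cosh_pos a
  rw [div_le_iff₀ (by positivity)]
  have h3 : Real.exp a ^ n ≤ (2 * Real.cosh a) ^ n := by
    gcongr; rw [Real.cosh_eq]; linarith [Real.exp_pos (-a)]
  rw [mul_pow, ← Real.exp_nat_mul] at h3
  calc Real.exp (s * a) = Real.exp (-((n - s) * a)) * Real.exp (n * a) := by
        rw [← Real.exp_add]; congr 1; ring
    _ ≤ Real.exp (-((n - s) * a)) * (2 ^ n * Real.cosh a ^ n) := by gcongr
    _ = _ := by ring

theorem tendsto_exp_mul_div_cosh_pow_atBot {s : ℝ} {n : ℕ} (h : |s| < n) :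
    Tendsto (fun a : ℝ => Real.exp (s * a) / Real.cosh a ^ n) atBot (𝓝 0) := by
  have := (tendsto_exp_mul_div_cosh_pow_atTop (s := -s) (by rwa [abs_neg])).comp
    tendsto_neg_atBot_atTop
  refine this.congr fun a => ?_
  simp

/-- The moments of `e^{sa}` against powers of `1 / cosh a` satisfy a first-order recurrence. -/
theorem integral_exp_mul_div_cosh_pow_add_two {s : ℝ} {m : ℕ} (h : |s| < m) :
    (m : ℝ) * (m + 1) * ∫ a : ℝ, Real.exp (s * a) / Real.cosh a ^ (m + 2) =
      ((m : ℝ) ^ 2 - s ^ 2) * ∫ a : ℝ, Real.exp (s * a) / Real.cosh a ^ m := by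
  have h' : |s| < (m + 2 : ℕ) := by push_cast; linarith
  have i1 := integrable_exp_mul_div_cosh_pow h
  have i2 := integrable_exp_mul_div_cosh_pow h'
  have hd : ∀ a : ℝ, HasDerivAt
      (fun a => (s + m * (Real.sinh a / Real.cosh a)) * (Real.exp (s * a) / Real.cosh a ^ m))
      ((s ^ 2 - (m : ℝ) ^ 2) * (Real.exp (s * a) / Real.cosh a ^ m) +
        (m : ℝ) * (m + 1) * (Real.exp (s * a) / Real.cosh a ^ (m + 2))) a := by
    intro a
    have hc := (Real.cosh_pos a).ne'
    have d1 : HasDerivAt (fun a => Real.exp (s * a)) (Real.exp (s * a) * s) a := by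
      simpa using ((hasDerivAt_id a).const_mul s).exp
    have d2 := d1.div ((Real.hasDerivAt_cosh a).pow m) (pow_ne_zero m hc)
    have d3 := (((Real.hasDerivAt_sinh a).div (Real.hasDerivAt_cosh a) hc).const_mul
      (m : ℝ)).const_add s
    refine (d3.mul d2).congr_deriv ?_
    have hsq := Real.cosh_sq a
    have hm : (m : ℝ) * Real.cosh a ^ (m - 1) = m * Real.cosh a ^ m / Real.cosh a := by
      rcases Nat.eq_zero_or_pos m with rfl | hm
      · simp
      · obtain ⟨k, rfl⟩ := Nat.exists_eq_add_of_lt hm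
        rw [show 0 + k + 1 - 1 = k by omega, zero_add, pow_succ]
        field_simp
    simp only [Pi.pow_apply, Pi.div_apply, hm]
    field_simp
    rw [pow_add]
    have hsinh : Real.sinh a ^ 2 = Real.cosh a ^ 2 - 1 := by rw [hsq]; ring
    ring_nf
    rw [hsinh]
    ring
  have hbd : ∀ a : ℝ, |s + m * (Real.sinh a / Real.cosh a)| ≤ |s| + m := by
    intro a
    refine (abs_add_le _ _).trans ?_
    have h1 : |Real.sinh a / Real.cosh a| ≤ 1 := by
      rw [← Real.tanh_eq_sinh_div_cosh]
      exact (Real.abs_tanh_lt_one a).le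
    rw [abs_mul, Nat.abs_cast]
    have : (0 : ℝ) ≤ m := by positivity
    nlinarith
  have lim : ∀ l : Filter ℝ,
      Tendsto (fun a : ℝ => Real.exp (s * a) / Real.cosh a ^ m) l (𝓝 0) →
      Tendsto (fun a => (s + m * (Real.sinh a / Real.cosh a)) *
        (Real.exp (s * a) / Real.cosh a ^ m)) l (𝓝 0) := by
    intro l hl
    refine squeeze_zero_norm (fun a => ?_) (by simpa using hl.const_mul (|s| + m))
    have hc := Real.cosh_pos a
    rw [norm_mul, Real.norm_eq_abs, Real.norm_eq_abs,
      abs_of_pos (show 0 < Real.exp (s * a) / Real.cosh a ^ m by positivity)]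
    gcongr
    exact hbd a
  have key := integral_of_hasDerivAt_of_tendsto hd ((i1.const_mul _).add (i2.const_mul _))
    (lim _ (tendsto_exp_mul_div_cosh_pow_atBot h)) (lim _ (tendsto_exp_mul_div_cosh_pow_atTop h))
  rw [integral_add (i1.const_mul _) (i2.const_mul _), integral_const_mul, integral_const_mul] at key
  linarith

/-- The coefficient of `(sinh b)^{2n}` in the expansion of `cosh (s b) / cosh b`, over any field so
that it can be continued analytically in `s`. -/
def coshCoeff {K : Type*} [Field K] (n : ℕ) (s : K) : K :=
  (∏ k ∈ Finset.range n, (s ^ 2 - (2 * (k : K) + 1) ^ 2)) / (Nat.factorial (2 * n) : K)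

/-- The moments which the subtractions of the dispersion relation produce. -/
theorem integral_exp_mul_div_cosh_pow_odd {s : ℝ} (hs : |s| < 1) (n : ℕ) :
    (-1) ^ n * (Real.cos (Real.pi * s / 2) / Real.pi) *
      ∫ a : ℝ, Real.exp (s * a) / Real.cosh a ^ (2 * n + 1) = coshCoeff n s := by
  obtain ⟨h1, h2⟩ := abs_lt.1 hs
  have hcos : 0 < Real.cos (Real.pi * s / 2) :=
    Real.cos_pos_of_mem_Ioo ⟨by nlinarith [Real.pi_pos], by nlinarith [Real.pi_pos]⟩
  induction n with
  | zero =>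
    simp only [mul_zero, zero_add, pow_zero, pow_one, one_mul]
    rw [integral_exp_mul_div_cosh hs]
    have := Real.pi_pos
    simp only [coshCoeff, Finset.range_zero, Finset.prod_empty, mul_zero, Nat.factorial_zero]
    field_simp
    simp
  | succ n ih =>
    have h3 : |s| < (2 * n + 1 : ℕ) := by
      push_cast; have : (0 : ℝ) ≤ n := by positivity
      linarith
    have h4 := integral_exp_mul_div_cosh_pow_add_two h3
    rw [show 2 * (n + 1) + 1 = 2 * n + 1 + 2 by ring]
    generalize (∫ a : ℝ, Real.exp (s * a) / Real.cosh a ^ (2 * n + 1 + 2)) = J at *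
    have h5 : coshCoeff (n + 1) s =
        coshCoeff n s * (s ^ 2 - (2 * n + 1) ^ 2) / ((2 * n + 1) * (2 * n + 2)) := by
      unfold coshCoeff
      rw [Finset.prod_range_succ, show 2 * (n + 1) = 2 * n + 1 + 1 by ring, Nat.factorial_succ,
        Nat.factorial_succ]
      push_cast
      field_simp
      ring
    rw [h5, ← ih]
    push_cast at h4
    field_simp
    rw [pow_succ]
    linear_combination (-(-1) ^ n) * h4

/-- The kernel `cosh a / (cosh^{2N} a (cosh² a + X))` of the dispersion relation. -/
def dispKernel (N : ℕ) (X a : ℝ) : ℝ :=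
  Real.cosh a / (Real.cosh a ^ (2 * N) * (Real.cosh a ^ 2 + X))

theorem dispKernel_nonneg (N : ℕ) {X : ℝ} (hX : 0 ≤ X) (a : ℝ) : 0 ≤ dispKernel N X a := by
  have := Real.cosh_pos a
  unfold dispKernel
  positivity

theorem continuous_dispKernel (N : ℕ) {X : ℝ} (hX : 0 ≤ X) : Continuous (dispKernel N X) := by
  unfold dispKernel
  refine Continuous.div (by fun_prop) (by fun_prop) fun a => ?_
  have := Real.cosh_pos a
  positivity

theorem dispKernel_le (N : ℕ) {X : ℝ} (hX : 0 ≤ X) (a : ℝ) :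
    dispKernel N X a ≤ 1 / Real.cosh a ^ (2 * N + 1) := by
  have := Real.cosh_pos a
  unfold dispKernel
  rw [div_le_div_iff₀ (by positivity) (by positivity)]
  have h2 : Real.cosh a * Real.cosh a ^ (2 * N + 1) = Real.cosh a ^ (2 * N) * Real.cosh a ^ 2 := by
    ring
  rw [h2, one_mul]
  gcongr
  linarith

theorem integrable_exp_mul_dispKernel {s : ℝ} {N : ℕ} (h : |s| < 2 * N + 1) {X : ℝ}
    (hX : 0 ≤ X) : Integrable fun a => Real.exp (s * a) * dispKernel N X a := by
  refine (integrable_exp_mul_div_cosh_pow (s := s) (n := 2 * N + 1) (by push_cast; exact h)).mono'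
    (Continuous.aestronglyMeasurable ?_) (Eventually.of_forall fun a => ?_)
  · have := continuous_dispKernel N hX; fun_prop
  · rw [norm_mul, Real.norm_eq_abs, Real.norm_eq_abs, Real.abs_exp,
      abs_of_nonneg (dispKernel_nonneg N hX a), div_eq_mul_one_div]
    gcongr
    exact dispKernel_le N hX a

/-- Partial fractions for the unsubtracted kernel, from
`cosh² a + sinh² b = cosh (a + b) cosh (a - b)`. -/
theorem dispKernel_zero_sinh_sq (a b : ℝ) :
    Real.cosh b * dispKernel 0 (Real.sinh b ^ 2) a =
      1 / 2 * (1 / Real.cosh (a + b) + 1 / Real.cosh (a - b)) := by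
  have h1 := Real.cosh_pos (a + b)
  have h2 := Real.cosh_pos (a - b)
  have h3 : Real.cosh a ^ 2 + Real.sinh b ^ 2 = Real.cosh (a + b) * Real.cosh (a - b) := by
    rw [Real.cosh_add, Real.cosh_sub]
    linear_combination (-Real.sinh b ^ 2) * Real.cosh_sq a + Real.cosh_sq b * (-Real.cosh a ^ 2)
  have h4 : Real.cosh (a + b) + Real.cosh (a - b) = 2 * Real.cosh a * Real.cosh b := by
    rw [Real.cosh_add, Real.cosh_sub]; ring
  unfold dispKernel
  rw [mul_zero, pow_zero, one_mul, h3]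
  field_simp
  linarith

theorem cosh_eq_dispKernel_zero {s : ℝ} (hs : |s| < 1) (b : ℝ) :
    Real.cosh (s * b) = Real.cosh b * (Real.cos (Real.pi * s / 2) / Real.pi *
      ∫ a : ℝ, Real.exp (s * a) * dispKernel 0 (Real.sinh b ^ 2) a) := by
  obtain ⟨h1, h2⟩ := abs_lt.1 hs
  have hcos : 0 < Real.cos (Real.pi * s / 2) :=
    Real.cos_pos_of_mem_Ioo ⟨by nlinarith [Real.pi_pos], by nlinarith [Real.pi_pos]⟩
  have hi : Integrable fun a : ℝ => Real.exp (s * a) / Real.cosh a := by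
    simpa using integrable_exp_mul_div_cosh_pow (s := s) (n := 1) (by simpa using hs)
  have shift : ∀ c : ℝ, (Integrable fun a => Real.exp (s * a) * (1 / Real.cosh (a + c))) ∧
      ∫ a : ℝ, Real.exp (s * a) * (1 / Real.cosh (a + c)) =
        Real.exp (-(s * c)) * (Real.pi / Real.cos (Real.pi * s / 2)) := by
    intro c
    have e : (fun a => Real.exp (s * a) * (1 / Real.cosh (a + c))) =
        fun a => Real.exp (-(s * c)) * (Real.exp (s * (a + c)) / Real.cosh (a + c)) := by
      funext a
      have : Real.exp (s * a) = Real.exp (-(s * c)) * Real.exp (s * (a + c)) := by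
        rw [← Real.exp_add]; congr 1; ring
      rw [this]; ring
    rw [e, integral_const_mul, integral_add_right_eq_self fun a => Real.exp (s * a) / Real.cosh a,
      integral_exp_mul_div_cosh hs]
    exact ⟨(hi.comp_add_right c).const_mul _, rfl⟩
  have e1 : ∫ a : ℝ, Real.cosh b * (Real.exp (s * a) * dispKernel 0 (Real.sinh b ^ 2) a) =
      1 / 2 * (∫ a : ℝ, Real.exp (s * a) * (1 / Real.cosh (a + b)) +
        Real.exp (s * a) * (1 / Real.cosh (a + -b))) := by
    rw [← integral_const_mul]
    refine integral_congr_ae (Eventually.of_forall fun a => ?_)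
    have := dispKernel_zero_sinh_sq a b
    simp only
    rw [← sub_eq_add_neg]
    linear_combination Real.exp (s * a) * this
  rw [integral_const_mul, integral_add (shift b).1 (shift (-b)).1, (shift b).2,
    (shift (-b)).2] at e1
  have hpi := Real.pi_pos
  have : Real.cosh b * (Real.cos (Real.pi * s / 2) / Real.pi *
      ∫ a : ℝ, Real.exp (s * a) * dispKernel 0 (Real.sinh b ^ 2) a) =
      Real.cos (Real.pi * s / 2) / Real.pi * (Real.cosh b * ∫ a : ℝ, Real.exp (s * a) *
        dispKernel 0 (Real.sinh b ^ 2) a) := by ring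
  rw [this, e1, Real.cosh_eq, mul_neg, neg_neg]
  generalize Real.cos (Real.pi * s / 2) = c at hcos ⊢
  field_simp
  ring

/-- The subtracted dispersion relation in the strip `|s| < 1`, where no analytic continuation is
needed: the moments supply the polynomial part. -/
theorem cosh_eq_sum_add_dispKernel_of_abs_lt_one {s : ℝ} (hs : |s| < 1) (N : ℕ) (b : ℝ) :
    Real.cosh (s * b) = Real.cosh b *
      (∑ n ∈ Finset.range N, coshCoeff n s * Real.sinh b ^ (2 * n) +
        (-1) ^ N * Real.sinh b ^ (2 * N) * (Real.cos (Real.pi * s / 2) / Real.pi) *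
          ∫ a : ℝ, Real.exp (s * a) * dispKernel N (Real.sinh b ^ 2) a) := by
  induction N with
  | zero => simpa using cosh_eq_dispKernel_zero hs b
  | succ N ih =>
    have hN : (0 : ℝ) ≤ N := by positivity
    have hX := sq_nonneg (Real.sinh b)
    have i1 := integrable_exp_mul_div_cosh_pow (s := s) (n := 2 * N + 1) (by push_cast; linarith)
    have i2 := integrable_exp_mul_dispKernel (s := s) (N := N + 1) (by push_cast; linarith) hX
    have e : ∫ a : ℝ, Real.exp (s * a) * dispKernel N (Real.sinh b ^ 2) a =
        (∫ a : ℝ, Real.exp (s * a) / Real.cosh a ^ (2 * N + 1)) - Real.sinh b ^ 2 *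
          ∫ a : ℝ, Real.exp (s * a) * dispKernel (N + 1) (Real.sinh b ^ 2) a := by
      rw [← integral_const_mul, ← integral_sub i1 (i2.const_mul _)]
      refine integral_congr_ae (Eventually.of_forall fun a => ?_)
      have := Real.cosh_pos a
      have h3 : 0 < Real.cosh a ^ 2 + Real.sinh b ^ 2 := by positivity
      simp only [dispKernel]
      rw [show 2 * (N + 1) = 2 * N + 2 by ring, pow_add, pow_succ]
      field_simp
      ring
    rw [ih, Finset.sum_range_succ, e, ← integral_exp_mul_div_cosh_pow_odd hs N]
    ring

/-- The subtracted dispersion relation, continued analytically in `s` to the strip `|s| < 2N+1`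
in which the integral converges. -/
theorem cosh_eq_sum_add_dispKernel {s : ℝ} {N : ℕ} (hs : |s| < 2 * N + 1) (b : ℝ) :
    Real.cosh (s * b) = Real.cosh b *
      (∑ n ∈ Finset.range N, coshCoeff n s * Real.sinh b ^ (2 * n) +
        (-1) ^ N * Real.sinh b ^ (2 * N) * (Real.cos (Real.pi * s / 2) / Real.pi) *
          ∫ a : ℝ, Real.exp (s * a) * dispKernel N (Real.sinh b ^ 2) a) := by
  have hX := sq_nonneg (Real.sinh b)
  set U : Set ℂ := {μ | μ.re ∈ Set.Ioo (-(2 * N + 1 : ℝ)) (2 * N + 1)} with hU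
  have hUc : IsPreconnected U :=
    ((convex_Ioo (-(2 * N + 1 : ℝ)) (2 * N + 1)).linear_preimage Complex.reLm).isPreconnected
  have hI := analyticOnNhd_integral_cexp_mul (dispKernel_nonneg N hX)
    (continuous_dispKernel N hX).measurable isOpen_Ioo
    (fun s (hs : s ∈ Set.Ioo (-(2 * N + 1 : ℝ)) (2 * N + 1)) =>
      integrable_exp_mul_dispKernel (abs_lt.2 hs) hX)
  have hl : AnalyticOnNhd ℂ (fun μ : ℂ => Complex.cosh (μ * b)) U := fun μ _ =>
    (by fun_prop : Differentiable ℂ fun μ : ℂ => Complex.cosh (μ * b)).analyticAt μ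
  have hcoeff : ∀ n : ℕ, Differentiable ℂ fun μ : ℂ => coshCoeff n μ := by
    intro n; unfold coshCoeff; fun_prop
  have hr : AnalyticOnNhd ℂ (fun μ : ℂ => Complex.cosh b *
      (∑ n ∈ Finset.range N, coshCoeff n μ * Complex.sinh b ^ (2 * n) +
        (-1) ^ N * Complex.sinh b ^ (2 * N) * (Complex.cos (Real.pi * μ / 2) / Real.pi) *
          ∫ a : ℝ, Complex.exp (μ * a) * dispKernel N (Real.sinh b ^ 2) a)) U := by
    intro μ hμ
    have h1 : AnalyticAt ℂ (fun μ : ℂ => ∑ n ∈ Finset.range N,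
        coshCoeff n μ * Complex.sinh b ^ (2 * n)) μ :=
      (by fun_prop : Differentiable ℂ fun μ : ℂ => ∑ n ∈ Finset.range N,
        coshCoeff n μ * Complex.sinh b ^ (2 * n)).analyticAt μ
    have h2 : AnalyticAt ℂ (fun μ : ℂ => (-1) ^ N * Complex.sinh b ^ (2 * N) *
        (Complex.cos (Real.pi * μ / 2) / Real.pi)) μ :=
      (by fun_prop : Differentiable ℂ fun μ : ℂ => (-1) ^ N * Complex.sinh b ^ (2 * N) *
        (Complex.cos (Real.pi * μ / 2) / Real.pi)).analyticAt μ
    exact analyticAt_const.mul (h1.add (h2.mul (hI μ hμ)))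
  have castsum : ∀ t : ℝ, Complex.cosh b *
      (∑ n ∈ Finset.range N, coshCoeff n (t : ℂ) * Complex.sinh b ^ (2 * n) +
        (-1) ^ N * Complex.sinh b ^ (2 * N) * (Complex.cos (Real.pi * t / 2) / Real.pi) *
          ∫ a : ℝ, Complex.exp (t * a) * dispKernel N (Real.sinh b ^ 2) a) =
      ((Real.cosh b *
      (∑ n ∈ Finset.range N, coshCoeff n t * Real.sinh b ^ (2 * n) +
        (-1) ^ N * Real.sinh b ^ (2 * N) * (Real.cos (Real.pi * t / 2) / Real.pi) *
          ∫ a : ℝ, Real.exp (t * a) * dispKernel N (Real.sinh b ^ 2) a) : ℝ) : ℂ) := by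
    intro t
    have e : ∀ n, coshCoeff n (t : ℂ) = ((coshCoeff n t : ℝ) : ℂ) := by
      intro n; unfold coshCoeff; push_cast; rfl
    have e2 : ∫ a : ℝ, Complex.exp (t * a) * dispKernel N (Real.sinh b ^ 2) a =
        ((∫ a : ℝ, Real.exp (t * a) * dispKernel N (Real.sinh b ^ 2) a : ℝ) : ℂ) := by
      rw [← integral_complex_ofReal]
      push_cast
      rfl
    rw [e2]
    push_cast [e]
    rfl
  have key := AnalyticOnNhd.eqOn_of_preconnected_of_frequently_eq (z₀ := ((0 : ℝ) : ℂ)) hl hr hUc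
    (by
      have hN : (0 : ℝ) ≤ N := by positivity
      show ((0 : ℝ) : ℂ).re ∈ Set.Ioo _ _
      rw [Complex.ofReal_re]
      constructor <;> linarith)
    (frequently_ofReal_of_eventually (by
      filter_upwards [Ioo_mem_nhds (show (-1 : ℝ) < 0 by norm_num)
        (show (0 : ℝ) < 1 by norm_num)] with t ht
      rw [castsum, ← cosh_eq_sum_add_dispKernel_of_abs_lt_one (abs_lt.2 ht) N b]
      push_cast; rfl))
  have h3 := key (show (s : ℂ).re ∈ Set.Ioo _ _ from abs_lt.1 hs)
  simp only at h3
  rw [castsum] at h3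
  exact_mod_cast h3

/-! ### Gaussian moments -/

theorem integrable_abs_pow_mul_exp (p : ℕ) {X : ℝ} (hX : 0 < X) :
    Integrable fun v : ℝ => |v| ^ p * Real.exp (-(X * v ^ 2)) := by
  have h := (integrable_rpow_mul_exp_neg_mul_sq hX (s := p) (by
    have : (0 : ℝ) ≤ p := by positivity
    linarith)).norm
  refine h.congr (Eventually.of_forall fun v => ?_)
  simp

theorem integral_abs_pow_mul_exp (p : ℕ) {X : ℝ} (hX : 0 < X) :
    ∫ v : ℝ, |v| ^ p * Real.exp (-(X * v ^ 2)) =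
      X ^ (-((p : ℝ) + 1) / 2) * Real.Gamma (((p : ℝ) + 1) / 2) := by
  have h1 := integral_comp_abs (f := fun v : ℝ => v ^ p * Real.exp (-(X * v ^ 2)))
  simp only [sq_abs] at h1
  have h2 := integral_rpow_mul_exp_neg_mul_rpow (p := 2) (q := p) two_pos (by
    have : (0 : ℝ) ≤ p := by positivity
    linarith) hX
  have h3 : ∫ v in Set.Ioi (0 : ℝ), v ^ p * Real.exp (-(X * v ^ 2)) =
      ∫ v in Set.Ioi (0 : ℝ), v ^ (p : ℝ) * Real.exp (-X * v ^ (2 : ℝ)) := by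
    refine integral_congr_ae (Eventually.of_forall fun v => ?_)
    simp only [Real.rpow_natCast, Real.rpow_two, neg_mul]
  rw [h1, h3, h2]
  ring

/-! ### Substitution of the hyperbolic sine -/

theorem integral_cosh_mul_comp_sinh (g : ℝ → ℝ) :
    ∫ b : ℝ, Real.cosh b * g (Real.sinh b) = ∫ w : ℝ, g w := by
  have h := integral_image_eq_integral_abs_deriv_smul MeasurableSet.univ
    (fun x _ => (Real.hasDerivAt_sinh x).hasDerivWithinAt) Real.sinh_injective.injOn g
  rw [Set.image_univ, Real.sinh_surjective.range_eq, setIntegral_univ, setIntegral_univ] at h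
  rw [h]
  refine integral_congr_ae (Eventually.of_forall fun b => ?_)
  simp [abs_of_pos (Real.cosh_pos b)]

theorem integrable_cosh_mul_comp_sinh {g : ℝ → ℝ} (hg : Integrable g) :
    Integrable fun b : ℝ => Real.cosh b * g (Real.sinh b) := by
  have h := (integrableOn_image_iff_integrableOn_abs_deriv_smul MeasurableSet.univ
    (fun x _ => (Real.hasDerivAt_sinh x).hasDerivWithinAt) Real.sinh_injective.injOn g).1
    hg.integrableOn
  rw [integrableOn_univ] at h
  refine h.congr (Eventually.of_forall fun b => ?_)
  simp [abs_of_pos (Real.cosh_pos b)]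

/-! ### The dispersion relation for the derivative -/

/-- The coefficient of `(sinh b)^{2n}` in the expansion of `cosh (s b) cosh (2 b) / cosh b`. -/
def derivCoeff (n : ℕ) (s : ℝ) : ℝ :=
  coshCoeff n s + if n = 0 then 0 else 2 * coshCoeff (n - 1) s

theorem integrable_exp_mul_cosh_two_mul_dispKernel {s : ℝ} {N : ℕ} (h : |s| + 2 < 2 * N + 1)
    {X : ℝ} (hX : 0 ≤ X) :
    Integrable fun a => Real.exp (s * a) * (Real.cosh (2 * a) * dispKernel N X a) := by
  have h1 : |s + 2| < 2 * N + 1 := (abs_add_le s 2).trans_lt (by simpa using h)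
  have h2 : |s - 2| < 2 * N + 1 := (abs_sub s 2).trans_lt (by simpa using h)
  refine (((integrable_exp_mul_dispKernel h1 hX).add
    (integrable_exp_mul_dispKernel h2 hX)).div_const 2).congr (Eventually.of_forall fun a => ?_)
  simp only [Pi.add_apply]
  rw [Real.cosh_eq, add_mul, sub_eq_add_neg, add_mul, Real.exp_add, Real.exp_add, neg_mul]
  ring

/-- The relations with `N` and with `N - 1` subtractions combine, because `cosh 2b = 1 + 2 sinh² b`
whereas `cosh 2a = 2 cosh² a - 1` under the integral. -/
theorem cosh_mul_cosh_two_mul_eq {s : ℝ} {N : ℕ} (hN : 1 ≤ N) (hs : |s| < 2 * N - 1) (b : ℝ) :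
    Real.cosh (s * b) * Real.cosh (2 * b) = Real.cosh b *
      (∑ n ∈ Finset.range N, derivCoeff n s * Real.sinh b ^ (2 * n) +
        (-1) ^ (N + 1) * (Real.cos (Real.pi * s / 2) / Real.pi) * Real.sinh b ^ (2 * N) *
          ∫ a : ℝ, Real.exp (s * a) * (Real.cosh (2 * a) * dispKernel N (Real.sinh b ^ 2) a)) := by
  obtain ⟨M, rfl⟩ : ∃ M, N = M + 1 := ⟨N - 1, by omega⟩
  have hX := sq_nonneg (Real.sinh b)
  push_cast at hs
  have h1 := cosh_eq_sum_add_dispKernel (s := s) (N := M) (by linarith) b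
  have h2 := cosh_eq_sum_add_dispKernel (s := s) (N := M + 1) (by push_cast; linarith) b
  have i1 := integrable_exp_mul_dispKernel (s := s) (N := M) (by linarith) hX
  have i2 := integrable_exp_mul_dispKernel (s := s) (N := M + 1) (by push_cast; linarith) hX
  have e1 : ∫ a : ℝ, Real.exp (s * a) *
        (Real.cosh (2 * a) * dispKernel (M + 1) (Real.sinh b ^ 2) a) =
      2 * (∫ a : ℝ, Real.exp (s * a) * dispKernel M (Real.sinh b ^ 2) a) -
        ∫ a : ℝ, Real.exp (s * a) * dispKernel (M + 1) (Real.sinh b ^ 2) a := by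
    rw [← integral_const_mul, ← integral_sub (i1.const_mul 2) i2]
    refine integral_congr_ae (Eventually.of_forall fun a => ?_)
    have hc := Real.cosh_pos a
    have h3 : 0 < Real.cosh a ^ 2 + Real.sinh b ^ 2 := by positivity
    have h4 : Real.cosh (2 * a) = 2 * Real.cosh a ^ 2 - 1 := by
      rw [Real.cosh_two_mul, Real.cosh_sq]; ring
    simp only [dispKernel, h4]
    rw [show 2 * (M + 1) = 2 * M + 2 by ring, pow_add]
    field_simp
  have e2 : ∑ n ∈ Finset.range (M + 1), derivCoeff n s * Real.sinh b ^ (2 * n) =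
      ∑ n ∈ Finset.range (M + 1), coshCoeff n s * Real.sinh b ^ (2 * n) +
      2 * Real.sinh b ^ 2 * ∑ n ∈ Finset.range M, coshCoeff n s * Real.sinh b ^ (2 * n) := by
    rw [Finset.sum_range_succ', Finset.sum_range_succ' (fun n =>
      coshCoeff n s * Real.sinh b ^ (2 * n)), add_right_comm, Finset.mul_sum,
      ← Finset.sum_add_distrib]
    congr 1
    · refine Finset.sum_congr rfl fun n _ => ?_
      simp only [derivCoeff, Nat.succ_ne_zero, if_false, Nat.add_sub_cancel]
      ring
    · simp [derivCoeff]
  have h5 : Real.cosh (2 * b) = 1 + 2 * Real.sinh b ^ 2 := by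
    rw [Real.cosh_two_mul, Real.cosh_sq]; ring
  have h6 : Real.cosh (s * b) * Real.cosh (2 * b) =
    Real.cosh (s * b) + 2 * Real.sinh b ^ 2 * Real.cosh (s * b) := by rw [h5]; ring
  rw [h6, e1, e2]
  nth_rw 2 [h1]
  rw [h2]
  ring

/-- A Gaussian integral turns the coefficients of the powers of `sinh b` into `b_n(ν)`. -/
theorem derivCoeff_mul_Gamma (n : ℕ) (ν : ℝ) :
    derivCoeff n (2 * ν) * Real.Gamma (n + 1 / 2) / (√Real.pi * 2 ^ n) = coeffB n ν := by
  have hpi : 0 < √Real.pi := Real.sqrt_pos.2 Real.pi_pos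
  have hhalf : Real.Gamma 2⁻¹ = √Real.pi := by rw [← one_div]; exact Real.Gamma_one_half_eq
  have hG : ∀ n : ℕ, Real.Gamma (n + 1 / 2) * (4 ^ n * (Nat.factorial n : ℝ)) =
      (Nat.factorial (2 * n) : ℝ) * √Real.pi := by
    intro n
    induction n with
    | zero => simp [hhalf]
    | succ n ih =>
      have h1 : Real.Gamma ((n + 1 : ℕ) + 1 / 2) = (n + 1 / 2) * Real.Gamma (n + 1 / 2) := by
        rw [← Real.Gamma_add_one (by positivity)]; congr 1; push_cast; ring
      rw [h1, show 2 * (n + 1) = 2 * n + 1 + 1 by ring, Nat.factorial_succ, Nat.factorial_succ,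
        Nat.factorial_succ]
      push_cast
      rw [pow_succ]
      linear_combination (2 * (n : ℝ) + 1) * (2 * n + 2) * ih
  rcases n with _ | n
  · simp [derivCoeff, coshCoeff, coeffB, hhalf, hpi.ne']
  · have hG' := hG (n + 1)
    have hP : ∏ k ∈ Finset.Icc 1 n, (4 * ν ^ 2 - (2 * (k : ℝ) - 1) ^ 2) =
        ∏ k ∈ Finset.range n, ((2 * ν) ^ 2 - (2 * (k : ℝ) + 1) ^ 2) := by
      rw [← Finset.Ico_add_one_right_eq_Icc, Finset.prod_Ico_eq_prod_range]
      refine Finset.prod_congr rfl fun k _ => ?_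
      push_cast; ring
    have hf : (0 : ℝ) < Nat.factorial n := by exact_mod_cast Nat.factorial_pos n
    have hf2 : (0 : ℝ) < Nat.factorial (2 * n) := by exact_mod_cast Nat.factorial_pos _
    simp only [derivCoeff, coeffB, Nat.succ_ne_zero, if_false, Nat.add_sub_cancel, coshCoeff, hP]
    rw [Finset.prod_range_succ]
    set P := ∏ k ∈ Finset.range n, ((2 * ν) ^ 2 - (2 * (k : ℝ) + 1) ^ 2)
    set g := Real.Gamma ((n + 1 : ℕ) + 1 / 2)
    rw [show 2 * (n + 1) = 2 * n + 1 + 1 by ring, Nat.factorial_succ (2 * n + 1),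
      Nat.factorial_succ (2 * n), Nat.factorial_succ n] at *
    push_cast at *
    have h8 : (8 : ℝ) ^ (n + 1) = 2 ^ (n + 1) * 4 ^ (n + 1) := by rw [← mul_pow]; norm_num
    have hg : g = (2 * n + 1 + 1) * ((2 * n + 1) * (Nat.factorial (2 * n) : ℝ)) * √Real.pi /
        (4 ^ (n + 1) * ((n + 1) * (Nat.factorial n : ℝ))) := by
      rw [eq_div_iff (by positivity)]; exact hG'
    rw [hg, h8]
    field_simp
    ring

/-! ### The expansion of `K_ν'` with an integral remainder -/

theorem integral_cosh_mul_sinh_pow_mul_exp (n : ℕ) {x : ℝ} (hx : 0 < x) :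
    (Integrable fun b : ℝ =>
      Real.cosh b * (Real.sinh b ^ (2 * n) * Real.exp (-(2 * x * Real.sinh b ^ 2)))) ∧
    √(2 * x / Real.pi) * ∫ b : ℝ,
      Real.cosh b * (Real.sinh b ^ (2 * n) * Real.exp (-(2 * x * Real.sinh b ^ 2))) =
        Real.Gamma (n + 1 / 2) / (√Real.pi * 2 ^ n) / x ^ n := by
  have hX : 0 < 2 * x := by positivity
  have e : (fun w : ℝ => w ^ (2 * n) * Real.exp (-(2 * x * w ^ 2))) =
      fun w => |w| ^ (2 * n) * Real.exp (-(2 * x * w ^ 2)) := by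
    funext w; rw [pow_mul, pow_mul, sq_abs]
  have h1 := integrable_abs_pow_mul_exp (2 * n) hX
  have h2 := integral_abs_pow_mul_exp (2 * n) hX
  rw [← e] at h1
  refine ⟨integrable_cosh_mul_comp_sinh h1, ?_⟩
  rw [integral_cosh_mul_comp_sinh fun w => w ^ (2 * n) * Real.exp (-(2 * x * w ^ 2)), e, h2]
  have e2 : (((2 * n : ℕ) : ℝ) + 1) / 2 = n + 1 / 2 := by push_cast; ring
  have e3 : -(((2 * n : ℕ) : ℝ) + 1) / 2 = -(n : ℝ) - 1 / 2 := by push_cast; ring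
  have e4 : (2 * x) ^ (-(n : ℝ) - 1 / 2) = ((2 * x) ^ n)⁻¹ * (√(2 * x))⁻¹ := by
    rw [Real.rpow_sub hX, Real.rpow_neg hX.le, Real.rpow_natCast, Real.sqrt_eq_rpow, div_eq_mul_inv]
  have hpi : 0 < √Real.pi := Real.sqrt_pos.2 Real.pi_pos
  have hs : 0 < √(2 * x) := Real.sqrt_pos.2 hX
  rw [e2, e3, e4, Real.sqrt_div hX.le, mul_pow]
  field_simp

/-- The Stieltjes-type integral `∫ |v|^{2N-1} / (1+v²) e^{-X v²} dv`, equal to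
`∫₀^∞ t^{N-1} e^{-Xt} / (1+t) dt`, for `N ≥ 1`. -/
def stieltjes (N : ℕ) (X : ℝ) : ℝ :=
  ∫ v : ℝ, |v| ^ (2 * N - 1) / (1 + v ^ 2) * Real.exp (-(X * v ^ 2))

/-- The integrand of the double integral which is left after the polynomial part of the dispersion
relation has been integrated. -/
def doubleKernel (N : ℕ) (s x : ℝ) (a v : ℝ) : ℝ :=
  Real.exp (s * a) * Real.cosh (2 * a) *
    (v ^ (2 * N) / (1 + v ^ 2) * Real.exp (-(2 * x * (Real.cosh a * v) ^ 2)))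

/-- The scaling `w = v cosh a` interchanges the two variables of the double integral. -/
theorem integral_dispKernel_scale (N : ℕ) (s x a : ℝ) :
    ∫ w : ℝ, w ^ (2 * N) * Real.exp (-(2 * x * w ^ 2)) *
      (Real.exp (s * a) * (Real.cosh (2 * a) * dispKernel N (w ^ 2) a)) =
    ∫ v : ℝ, doubleKernel N s x a v := by
  have hc := Real.cosh_pos a
  have h := Measure.integral_comp_mul_left (fun w : ℝ => w ^ (2 * N) * Real.exp (-(2 * x * w ^ 2)) *
      (Real.exp (s * a) * (Real.cosh (2 * a) * dispKernel N (w ^ 2) a))) (Real.cosh a)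
  rw [abs_of_pos (by positivity), smul_eq_mul, inv_mul_eq_div, eq_div_iff hc.ne'] at h
  rw [← h, ← integral_mul_const]
  refine integral_congr_ae (Eventually.of_forall fun v => ?_)
  have h1 : 0 < 1 + v ^ 2 := by positivity
  have h2 : Real.cosh a ^ 2 + (Real.cosh a * v) ^ 2 = Real.cosh a ^ 2 * (1 + v ^ 2) := by ring
  simp only [dispKernel, doubleKernel, h2]
  rw [mul_pow (Real.cosh a) v (2 * N)]
  field_simp

theorem integrable_dispKernel_prod {s : ℝ} {N : ℕ} (h : |s| + 2 < 2 * N + 1) {x : ℝ}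
    (hx : 0 < x) :
    Integrable (Function.uncurry fun w a : ℝ => w ^ (2 * N) * Real.exp (-(2 * x * w ^ 2)) *
      (Real.exp (s * a) * (Real.cosh (2 * a) * dispKernel N (w ^ 2) a)))
      (volume.prod volume) := by
  have hX : 0 < 2 * x := by positivity
  have h1 := integrable_abs_pow_mul_exp (2 * N) hX
  have h2 := integrable_exp_mul_cosh_two_mul_dispKernel h le_rfl
  refine (h1.mul_prod h2).mono' (Continuous.aestronglyMeasurable ?_)
    (Eventually.of_forall fun z => ?_)
  · unfold Function.uncurry dispKernel
    refine Continuous.mul (by fun_prop) (Continuous.mul (by fun_prop) (Continuous.mul (by fun_prop)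
      (Continuous.div (by fun_prop) (by fun_prop) fun z => ?_)))
    have := Real.cosh_pos z.2
    positivity
  · obtain ⟨w, a⟩ := z
    have hc := Real.cosh_pos a
    have hc2 := Real.cosh_pos (2 * a)
    have h3 := dispKernel_nonneg N (sq_nonneg w) a
    have h4 : dispKernel N (w ^ 2) a ≤ dispKernel N 0 a := by
      unfold dispKernel
      gcongr
      positivity
    simp only [Function.uncurry]
    have h5 : w ^ (2 * N) = |w| ^ (2 * N) := by rw [pow_mul, pow_mul, sq_abs]
    rw [h5, Real.norm_eq_abs, abs_of_nonneg (by positivity)]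
    gcongr

theorem integrable_doubleKernel {s : ℝ} {N : ℕ} (h : |s| + 2 < 2 * N + 1) {x : ℝ} (hx : 0 < x) :
    Integrable (Function.uncurry (doubleKernel N s x)) (volume.prod volume) := by
  have hc : Continuous (Function.uncurry (doubleKernel N s x)) := by
    unfold Function.uncurry doubleKernel
    refine Continuous.mul (by fun_prop) (Continuous.mul (Continuous.div (by fun_prop)
      (by fun_prop) fun z => ?_) (by fun_prop))
    positivity
  have h0 : ∀ a v, 0 ≤ doubleKernel N s x a v := by
    intro a v
    have := Real.cosh_pos (2 * a)
    unfold doubleKernel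
    have : 0 ≤ v ^ (2 * N) := by rw [pow_mul]; positivity
    positivity
  rw [integrable_prod_iff hc.aestronglyMeasurable]
  constructor
  · refine Eventually.of_forall fun a => ?_
    have hca := Real.cosh_pos a
    have h1 := integrable_abs_pow_mul_exp (2 * N) (X := 2 * x * Real.cosh a ^ 2) (by positivity)
    refine (h1.const_mul (Real.exp (s * a) * Real.cosh (2 * a))).mono'
      (hc.comp (by fun_prop : Continuous fun v : ℝ => (a, v))).aestronglyMeasurable
      (Eventually.of_forall fun v => ?_)
    have h2 : v ^ (2 * N) = |v| ^ (2 * N) := by rw [pow_mul, pow_mul, sq_abs]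
    have := Real.cosh_pos (2 * a)
    show ‖doubleKernel N s x a v‖ ≤ _
    rw [Real.norm_eq_abs, abs_of_nonneg (h0 a v), doubleKernel, h2,
      show 2 * x * (Real.cosh a * v) ^ 2 = 2 * x * Real.cosh a ^ 2 * v ^ 2 by ring]
    gcongr
    exact div_le_self (by positivity) (by nlinarith [sq_nonneg v])
  · have h1 := (integrable_dispKernel_prod h hx).integral_prod_right
    refine h1.congr (Eventually.of_forall fun a => ?_)
    simp only [Function.uncurry]
    rw [integral_dispKernel_scale]
    refine integral_congr_ae (Eventually.of_forall fun v => ?_)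
    simp only
    rw [Real.norm_eq_abs, abs_of_nonneg (h0 a v)]

/-- For fixed `v`, the integral over `a` is again the one that defines `scaledK`, now at `x v²`. -/
theorem integral_doubleKernel_left {ν x v : ℝ} (N : ℕ) (hN : 1 ≤ N) (hx : 0 < x) (hv : v ≠ 0) :
    √(2 * x / Real.pi) * ∫ a : ℝ, doubleKernel N (2 * ν) x a v =
      |v| ^ (2 * N - 1) / (1 + v ^ 2) * Real.exp (-(2 * x * v ^ 2)) * scaledK ν (x * v ^ 2) := by
  have hv2 : 0 < v ^ 2 := by positivity
  have ht : 0 < x * v ^ 2 := by positivity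
  have hva : 0 < |v| := abs_pos.2 hv
  -- passage from `cosh (2 ν a)` to the exponential
  have h1 := integral_exp_mul_even (s := 2 * ν) (f := fun a =>
    Real.cosh (2 * a) * Real.exp (-(2 * (x * v ^ 2) * Real.sinh a ^ 2))) (by simp) (by
      have h3 := ((integrable_exp_mul_cosh_mul_exp_neg ν ht).comp_mul_left' (two_ne_zero' ℝ)
        ).const_mul (Real.exp (x * v ^ 2))
      refine h3.congr (Eventually.of_forall fun b => ?_)
      have e : -(2 * (x * v ^ 2) * Real.sinh b ^ 2) =
          x * v ^ 2 + -(x * v ^ 2 * Real.cosh (2 * b)) := by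
        rw [Real.cosh_two_mul, Real.cosh_sq]; ring
      simp only
      rw [e, Real.exp_add, show ν * (2 * b) = 2 * ν * b by ring]
      ring)
  have h2 : ∫ a : ℝ, doubleKernel N (2 * ν) x a v =
      v ^ (2 * N) / (1 + v ^ 2) * Real.exp (-(2 * x * v ^ 2)) *
      ∫ a : ℝ, Real.exp (2 * ν * a) * (Real.cosh (2 * a) *
        Real.exp (-(2 * (x * v ^ 2) * Real.sinh a ^ 2))) := by
    rw [← integral_const_mul]
    refine integral_congr_ae (Eventually.of_forall fun a => ?_)
    have e : -(2 * x * (Real.cosh a * v) ^ 2) =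
        -(2 * x * v ^ 2) + -(2 * (x * v ^ 2) * Real.sinh a ^ 2) := by
      rw [mul_pow, Real.cosh_sq]; ring
    simp only [doubleKernel]
    rw [e, Real.exp_add]
    ring
  rw [h2, ← h1.2, scaledK]
  simp only [mul_assoc]
  generalize (∫ b : ℝ, _ : ℝ) = J
  have h4 : √(2 * (x * v ^ 2) / Real.pi) = √(2 * x / Real.pi) * |v| := by
    rw [show 2 * (x * v ^ 2) / Real.pi = 2 * x / Real.pi * v ^ 2 by ring,
      Real.sqrt_mul (by positivity), Real.sqrt_sq_eq_abs]
  have h5 : v ^ (2 * N) = |v| ^ (2 * N - 1) * |v| := by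
    rw [← pow_succ, show 2 * N - 1 + 1 = 2 * N by omega, pow_mul, pow_mul, sq_abs]
  rw [h4, h5]
  ring

/-- The expansion of `scaledK`, with a remainder that reproduces the function itself. -/
theorem scaledK_eq_sum_add_integral {N : ℕ} (hN : 1 ≤ N) {ν : ℝ} (hν : |ν| < N - 1 / 2) {x : ℝ}
    (hx : 0 < x) :
    (Integrable fun v : ℝ => |v| ^ (2 * N - 1) / (1 + v ^ 2) * Real.exp (-(2 * x * v ^ 2)) *
        scaledK ν (x * v ^ 2)) ∧
    scaledK ν x = ∑ n ∈ Finset.range N, coeffB n ν / x ^ n +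
      (-1) ^ (N + 1) * (Real.cos (Real.pi * ν) / Real.pi) *
      ∫ v : ℝ, |v| ^ (2 * N - 1) / (1 + v ^ 2) * Real.exp (-(2 * x * v ^ 2)) *
        scaledK ν (x * v ^ 2) := by
  have hs : |2 * ν| < 2 * N - 1 := by
    rw [abs_mul, abs_of_pos two_pos]; linarith
  have hs2 : |2 * ν| + 2 < 2 * N + 1 := by linarith
  set c := (-1) ^ (N + 1) * (Real.cos (Real.pi * ν) / Real.pi) with hc
  have hne : ∀ᵐ v : ℝ, v ≠ 0 := by simp [ae_iff, measure_singleton]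
  have hD := integrable_doubleKernel hs2 hx
  have hP := integrable_dispKernel_prod hs2 hx
  have hcongr : (fun v : ℝ => √(2 * x / Real.pi) * ∫ a : ℝ, doubleKernel N (2 * ν) x a v) =ᵐ[volume]
      fun v => |v| ^ (2 * N - 1) / (1 + v ^ 2) * Real.exp (-(2 * x * v ^ 2)) *
        scaledK ν (x * v ^ 2) := by
    filter_upwards [hne] with v hv using integral_doubleKernel_left N hN hx hv
  refine ⟨(hD.integral_prod_right.const_mul _).congr hcongr, ?_⟩
  -- the remainder, as a function of `w = sinh b`
  set g : ℝ → ℝ := fun w => ∫ a : ℝ, w ^ (2 * N) * Real.exp (-(2 * x * w ^ 2)) *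
      (Real.exp (2 * ν * a) * (Real.cosh (2 * a) * dispKernel N (w ^ 2) a)) with hg
  have hgi : Integrable g := hP.integral_prod_left
  have e1 : ∀ b : ℝ, Real.cosh (2 * ν * b) * Real.cosh (2 * b) *
      Real.exp (-(2 * x * Real.sinh b ^ 2)) =
      ∑ n ∈ Finset.range N, derivCoeff n (2 * ν) * (Real.cosh b *
        (Real.sinh b ^ (2 * n) * Real.exp (-(2 * x * Real.sinh b ^ 2)))) +
      c * (Real.cosh b * g (Real.sinh b)) := by
    intro b
    rw [cosh_mul_cosh_two_mul_eq hN hs b, hg]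
    simp only
    rw [integral_const_mul, hc, show Real.pi * (2 * ν) / 2 = Real.pi * ν by ring, mul_add, add_mul,
      Finset.mul_sum, Finset.sum_mul]
    congr 1
    · refine Finset.sum_congr rfl fun n _ => ?_
      ring
    · ring
  have e2 : ∫ w, g w = ∫ v : ℝ, ∫ a : ℝ, doubleKernel N (2 * ν) x a v := by
    rw [hg, integral_integral_swap hP]
    simp only [integral_dispKernel_scale]
    exact integral_integral_swap hD
  have e3 : ∫ b : ℝ, Real.cosh (2 * ν * b) * Real.cosh (2 * b) *
      Real.exp (-(2 * x * Real.sinh b ^ 2)) =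
      ∑ n ∈ Finset.range N, derivCoeff n (2 * ν) * (∫ b : ℝ, Real.cosh b *
        (Real.sinh b ^ (2 * n) * Real.exp (-(2 * x * Real.sinh b ^ 2)))) +
      c * ∫ w, g w := by
    simp only [e1]
    rw [integral_add, integral_finsetSum, integral_const_mul, integral_cosh_mul_comp_sinh g]
    · simp only [integral_const_mul]
    · exact fun n _ => (integral_cosh_mul_sinh_pow_mul_exp n hx).1.const_mul _
    · exact integrable_finsetSum _ fun n _ =>
        (integral_cosh_mul_sinh_pow_mul_exp n hx).1.const_mul _
    · exact (integrable_cosh_mul_comp_sinh hgi).const_mul _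
  rw [scaledK, e3, mul_add, Finset.mul_sum, e2]
  congr 1
  · refine Finset.sum_congr rfl fun n _ => ?_
    rw [mul_left_comm, (integral_cosh_mul_sinh_pow_mul_exp n hx).2, ← derivCoeff_mul_Gamma]
    ring
  · rw [mul_left_comm, ← integral_const_mul]
    congr 1
    exact integral_congr_ae hcongr

/-! ### Complete monotonicity of the normalized derivative -/

/-- The complementary error function, by Craig's formula
`erfc X = (2/π) ∫₀^∞ e^{-X²(1+q²)} / (1+q²) dq` for `X ≥ 0`. -/
def craig (X : ℝ) : ℝ :=
  ∫ q in Set.Ioi (0 : ℝ), 2 / Real.pi / (1 + q ^ 2) * Real.exp (-(X ^ 2 * (1 + q ^ 2)))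

theorem integrable_craig_const : Integrable fun q : ℝ => 2 / Real.pi / (1 + q ^ 2) := by
  simpa [div_eq_mul_inv] using integrable_inv_one_add_sq.const_mul (2 / Real.pi)

theorem integral_craig_const : ∫ q in Set.Ioi (0 : ℝ), 2 / Real.pi / (1 + q ^ 2) = 1 := by
  have : ∫ q in Set.Ioi (0 : ℝ), 2 / Real.pi / (1 + q ^ 2) =
      2 / Real.pi * ∫ q in Set.Ioi (0 : ℝ), (1 + q ^ 2)⁻¹ := by
    rw [← integral_const_mul]; simp [div_eq_mul_inv]
  rw [this, integral_Ioi_inv_one_add_sq, Real.arctan_zero]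
  have := Real.pi_pos
  field_simp
  norm_num

theorem craig_zero : craig 0 = 1 := by
  simp [craig, integral_craig_const]

theorem craig_integrand_le (X q : ℝ) :
    2 / Real.pi / (1 + q ^ 2) * Real.exp (-(X ^ 2 * (1 + q ^ 2))) ≤
      2 / Real.pi / (1 + q ^ 2) * Real.exp (-X ^ 2) := by
  have hpi := Real.pi_pos
  gcongr
  nlinarith [mul_nonneg (sq_nonneg X) (sq_nonneg q)]

theorem continuous_craig_integrand (X : ℝ) :
    Continuous fun q : ℝ => 2 / Real.pi / (1 + q ^ 2) * Real.exp (-(X ^ 2 * (1 + q ^ 2))) := by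
  refine Continuous.mul (Continuous.div (by fun_prop) (by fun_prop) fun q => ?_) (by fun_prop)
  positivity

theorem craig_integrand_nonneg (X q : ℝ) :
    0 ≤ 2 / Real.pi / (1 + q ^ 2) * Real.exp (-(X ^ 2 * (1 + q ^ 2))) := by
  have hpi := Real.pi_pos
  positivity

theorem integrable_craig_integrand (X : ℝ) :
    Integrable fun q : ℝ => 2 / Real.pi / (1 + q ^ 2) * Real.exp (-(X ^ 2 * (1 + q ^ 2))) := by
  refine (integrable_craig_const.mul_const (Real.exp (-X ^ 2))).mono'
    (continuous_craig_integrand X).aestronglyMeasurable (Eventually.of_forall fun q => ?_)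
  rw [Real.norm_eq_abs, abs_of_nonneg (craig_integrand_nonneg X q)]
  exact craig_integrand_le X q

theorem craig_nonneg (X : ℝ) : 0 ≤ craig X :=
  integral_nonneg fun q => craig_integrand_nonneg X q

theorem craig_le (X : ℝ) : craig X ≤ Real.exp (-X ^ 2) := by
  calc craig X ≤ ∫ q in Set.Ioi (0 : ℝ), 2 / Real.pi / (1 + q ^ 2) * Real.exp (-X ^ 2) :=
        integral_mono (integrable_craig_integrand X).integrableOn
          (integrable_craig_const.mul_const _).integrableOn (craig_integrand_le X)
    _ = Real.exp (-X ^ 2) := by rw [integral_mul_const, integral_craig_const, one_mul]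

theorem continuous_craig : Continuous craig := by
  refine continuous_of_dominated (bound := fun q => 2 / Real.pi / (1 + q ^ 2))
    (fun X => (continuous_craig_integrand X).aestronglyMeasurable)
    (fun X => Eventually.of_forall fun q => ?_) integrable_craig_const.integrableOn
    (Eventually.of_forall fun q => by fun_prop)
  rw [Real.norm_eq_abs, abs_of_nonneg (craig_integrand_nonneg X q)]
  refine (craig_integrand_le X q).trans (mul_le_of_le_one_right ?_ ?_)
  · have := Real.pi_pos; positivity
  · rw [Real.exp_le_one_iff]; nlinarith [sq_nonneg X]

theorem hasDerivAt_craig {X : ℝ} (hX : 0 < X) :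
    HasDerivAt craig (-(2 / √Real.pi) * Real.exp (-X ^ 2)) X := by
  have hpi := Real.pi_pos
  have hint : ∀ Y : ℝ, 0 < Y → Integrable fun q : ℝ => Real.exp (-(Y ^ 2 * (1 + q ^ 2))) := by
    intro Y hY
    have := (integrable_exp_neg_mul_sq (b := Y ^ 2) (by positivity)).const_mul (Real.exp (-Y ^ 2))
    refine this.congr (Eventually.of_forall fun q => ?_)
    simp only
    rw [← Real.exp_add]; congr 1; ring
  have h := (hasDerivAt_integral_of_dominated_loc_of_deriv_le
    (μ := volume.restrict (Set.Ioi (0 : ℝ)))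
    (F := fun (Y : ℝ) (q : ℝ) => 2 / Real.pi / (1 + q ^ 2) * Real.exp (-(Y ^ 2 * (1 + q ^ 2))))
    (F' := fun (Y : ℝ) (q : ℝ) => -(4 * Y / Real.pi) * Real.exp (-(Y ^ 2 * (1 + q ^ 2))))
    (bound := fun q => 4 * (2 * X) / Real.pi * Real.exp (-((X / 2) ^ 2 * (1 + q ^ 2))))
    (Ioo_mem_nhds (half_lt_self hX) (show X < 2 * X by linarith))
    (Eventually.of_forall fun Y => (continuous_craig_integrand Y).aestronglyMeasurable)
    (integrable_craig_integrand X).integrableOn (by fun_prop)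
    (Eventually.of_forall fun q Y hY => ?_) ((hint (X / 2) (by positivity)).const_mul _).integrableOn
    (Eventually.of_forall fun q Y hY => ?_)).2
  · refine h.congr_deriv ?_
    rw [integral_const_mul]
    have e : ∫ q in Set.Ioi (0 : ℝ), Real.exp (-(X ^ 2 * (1 + q ^ 2))) =
        Real.exp (-X ^ 2) * (√(Real.pi / X ^ 2) / 2) := by
      rw [← integral_gaussian_Ioi, ← integral_const_mul]
      refine integral_congr_ae (Eventually.of_forall fun q => ?_)
      simp only
      rw [← Real.exp_add]; congr 1; ring
    rw [e, Real.sqrt_div hpi.le, Real.sqrt_sq hX.le]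
    have hs : 0 < √Real.pi := Real.sqrt_pos.2 hpi
    have hs2 : √Real.pi ^ 2 = Real.pi := Real.sq_sqrt hpi.le
    field_simp
    rw [hs2]
    ring
  · have h1 : X / 2 < Y := hY.1
    have h2 : Y < 2 * X := hY.2
    have hY0 : 0 < Y := by linarith
    rw [norm_mul, norm_neg, Real.norm_eq_abs, Real.norm_eq_abs, Real.abs_exp,
      abs_of_pos (by positivity)]
    gcongr
  · have h1 : HasDerivAt (fun Y : ℝ => -(Y ^ 2 * (1 + q ^ 2))) (-(2 * Y * (1 + q ^ 2))) Y := by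
      simpa using! ((hasDerivAt_pow 2 Y).mul_const (1 + q ^ 2)).neg
    refine (h1.exp.const_mul (2 / Real.pi / (1 + q ^ 2))).congr_deriv ?_
    have : 0 < 1 + q ^ 2 := by positivity
    field_simp
    ring

/-- The function `cosh (2νb) cosh (2b) / cosh b`, increasing in `b ≥ 0`. -/
def coshRatio (ν b : ℝ) : ℝ := Real.cosh (2 * ν * b) * Real.cosh (2 * b) / Real.cosh b

/-- The derivative of `coshRatio`. -/
def coshRatioDeriv (ν b : ℝ) : ℝ :=
  2 * ν * Real.sinh (2 * ν * b) * (Real.cosh (2 * b) / Real.cosh b) +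
    Real.cosh (2 * ν * b) * (Real.sinh b * (2 + 1 / Real.cosh b ^ 2))

theorem hasDerivAt_coshRatio (ν b : ℝ) : HasDerivAt (coshRatio ν) (coshRatioDeriv ν b) b := by
  have hc := (Real.cosh_pos b).ne'
  have h1 : HasDerivAt (fun b => Real.cosh (2 * ν * b)) (Real.sinh (2 * ν * b) * (2 * ν)) b := by
    simpa using ((hasDerivAt_id b).const_mul (2 * ν)).cosh
  have h2 : HasDerivAt (fun b => Real.cosh (2 * b)) (Real.sinh (2 * b) * 2) b := by
    simpa using ((hasDerivAt_id b).const_mul (2 : ℝ)).cosh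
  refine ((h1.mul h2).div (Real.hasDerivAt_cosh b) hc).congr_deriv ?_
  simp only [coshRatioDeriv, Pi.mul_apply]
  rw [Real.sinh_two_mul, Real.cosh_two_mul, Real.sinh_sq]
  field_simp
  ring

theorem coshRatioDeriv_nonneg (ν : ℝ) {b : ℝ} (hb : 0 ≤ b) : 0 ≤ coshRatioDeriv ν b := by
  have h1 : 0 ≤ ν * Real.sinh (2 * ν * b) := by
    rcases le_total 0 ν with h | h
    · exact mul_nonneg h (Real.sinh_nonneg_iff.2 (by positivity))
    · exact mul_nonneg_of_nonpos_of_nonpos h (Real.sinh_nonpos_iff.2 (by nlinarith))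
  have h2 : 0 ≤ Real.sinh b := Real.sinh_nonneg_iff.2 hb
  have := Real.cosh_pos b
  have := Real.cosh_pos (2 * b)
  have := Real.cosh_pos (2 * ν * b)
  unfold coshRatioDeriv
  rw [mul_assoc 2 ν]
  positivity

theorem cosh_le_cosh_two_mul (b : ℝ) : Real.cosh b ≤ Real.cosh (2 * b) := by
  rw [Real.cosh_le_cosh, abs_mul, abs_two]
  linarith [abs_nonneg b]

theorem cosh_two_mul_div_cosh_le (b : ℝ) : Real.cosh (2 * b) / Real.cosh b ≤ 2 * Real.cosh b := by
  rw [div_le_iff₀ (Real.cosh_pos b), Real.cosh_two_mul, Real.sinh_sq]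
  nlinarith

theorem abs_sinh_le_cosh (b : ℝ) : |Real.sinh b| ≤ Real.cosh b := by
  rw [Real.abs_sinh, ← Real.cosh_abs b]
  exact (Real.sinh_lt_cosh _).le

theorem abs_coshRatioDeriv_le (ν b : ℝ) :
    |coshRatioDeriv ν b| ≤ (4 * |ν| + 3) * (Real.cosh (2 * ν * b) * Real.cosh (2 * b)) := by
  have h1 := Real.one_le_cosh b
  have h2 := Real.cosh_pos (2 * ν * b)
  have h3 := cosh_le_cosh_two_mul b
  have h5 : 0 < Real.cosh (2 * b) / Real.cosh b := by
    have := Real.cosh_pos (2 * b)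
    positivity
  have h6 : |2 + 1 / Real.cosh b ^ 2| ≤ 3 := by
    rw [abs_of_pos (by positivity)]
    have : 1 / Real.cosh b ^ 2 ≤ 1 := by
      rw [div_le_one (by positivity)]; nlinarith
    linarith
  unfold coshRatioDeriv
  refine (abs_add_le _ _).trans ?_
  rw [abs_mul, abs_mul, abs_mul, abs_mul, abs_mul, abs_of_pos two_pos, abs_of_pos h5, abs_of_pos h2]
  calc 2 * |ν| * |Real.sinh (2 * ν * b)| * (Real.cosh (2 * b) / Real.cosh b) +
        Real.cosh (2 * ν * b) * (|Real.sinh b| * |2 + 1 / Real.cosh b ^ 2|)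
      ≤ 2 * |ν| * Real.cosh (2 * ν * b) * (2 * Real.cosh (2 * b)) +
        Real.cosh (2 * ν * b) * (Real.cosh (2 * b) * 3) := by
        gcongr
        · exact abs_sinh_le_cosh _
        · exact (cosh_two_mul_div_cosh_le b).trans (by linarith)
        · exact (abs_sinh_le_cosh b).trans h3
    _ = _ := by ring

theorem continuous_coshRatio (ν : ℝ) : Continuous (coshRatio ν) := by
  unfold coshRatio
  exact Continuous.div (by fun_prop) (by fun_prop) fun b => (Real.cosh_pos b).ne'

theorem continuous_coshRatioDeriv (ν : ℝ) : Continuous (coshRatioDeriv ν) := by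
  unfold coshRatioDeriv
  refine Continuous.add (Continuous.mul (by fun_prop) (Continuous.div (by fun_prop) (by fun_prop)
    fun b => (Real.cosh_pos b).ne')) (Continuous.mul (by fun_prop) (Continuous.mul (by fun_prop)
    (Continuous.add (by fun_prop) (Continuous.div (by fun_prop) (by fun_prop) fun b => ?_))))
  have := Real.cosh_pos b
  positivity

theorem integrable_coshRatioDeriv_mul_craig (ν : ℝ) {t : ℝ} (ht : 0 < t) :
    Integrable fun b => coshRatioDeriv ν b * craig (√(2 * t) * Real.sinh b) := by
  have h1 := continuous_coshRatioDeriv ν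
  have h2 := continuous_craig
  refine ((integrable_scaledK ν ht).const_mul (4 * |ν| + 3)).mono'
    (Continuous.aestronglyMeasurable (by fun_prop)) (Eventually.of_forall fun b => ?_)
  rw [norm_mul, Real.norm_eq_abs, Real.norm_eq_abs, abs_of_nonneg (craig_nonneg _), ← mul_assoc]
  refine mul_le_mul (abs_coshRatioDeriv_le ν b) ((craig_le _).trans_eq ?_) (craig_nonneg _) ?_
  · rw [mul_pow, Real.sq_sqrt (by positivity)]
  · have := Real.cosh_pos (2 * ν * b)
    have := Real.cosh_pos (2 * b)
    positivity

/-- Integration by parts turns the integral defining `scaledK` into a mixture of complementary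
error functions with the nonnegative weight `coshRatioDeriv`. -/
theorem scaledK_eq_one_add_integral_craig (ν : ℝ) {t : ℝ} (ht : 0 < t) :
    scaledK ν t =
      1 + ∫ b in Set.Ioi (0 : ℝ), coshRatioDeriv ν b * craig (√(2 * t) * Real.sinh b) := by
  have hpi := Real.pi_pos
  have hs : 0 < √(2 * t) := Real.sqrt_pos.2 (by positivity)
  set k : ℝ → ℝ := fun b =>
    Real.cosh (2 * ν * b) * Real.cosh (2 * b) * Real.exp (-(2 * t * Real.sinh b ^ 2)) with hk
  have hki : Integrable k := integrable_scaledK ν ht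
  set f : ℝ → ℝ := fun b => coshRatio ν b * craig (√(2 * t) * Real.sinh b) with hf
  have hfc : Continuous f := by
    have h1 := continuous_coshRatio ν
    have h2 := continuous_craig
    fun_prop
  set f' : ℝ → ℝ := fun b => coshRatioDeriv ν b * craig (√(2 * t) * Real.sinh b) -
    2 * √(2 * t / Real.pi) * k b with hf'
  have hd : ∀ b ∈ Set.Ioi (0 : ℝ), HasDerivAt f (f' b) b := by
    intro b hb
    have hb : 0 < b := hb
    have hsinh : 0 < √(2 * t) * Real.sinh b := mul_pos hs (Real.sinh_pos_iff.2 hb)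
    have h1 := (hasDerivAt_craig hsinh).comp b ((Real.hasDerivAt_sinh b).const_mul (√(2 * t)))
    refine ((hasDerivAt_coshRatio ν b).mul h1).congr_deriv ?_
    have hc := (Real.cosh_pos b).ne'
    have hsp : 0 < √Real.pi := Real.sqrt_pos.2 hpi
    simp only [hf', hk, coshRatio, Function.comp]
    rw [mul_pow, Real.sq_sqrt (by positivity), Real.sqrt_div (by positivity)]
    field_simp
    ring
  have hf'i : IntegrableOn f' (Set.Ioi 0) :=
    ((integrable_coshRatioDeriv_mul_craig ν ht).sub (hki.const_mul _)).integrableOn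
  have hfi : IntegrableOn f (Set.Ioi 0) := by
    refine (hki.mono' hfc.aestronglyMeasurable (Eventually.of_forall fun b => ?_)).integrableOn
    have h1 := Real.one_le_cosh b
    have h2 := Real.cosh_pos (2 * b)
    have h3 := Real.cosh_pos (2 * ν * b)
    have h4 : 0 < coshRatio ν b := by unfold coshRatio; positivity
    rw [norm_mul, Real.norm_eq_abs, Real.norm_eq_abs, abs_of_nonneg (craig_nonneg _),
      abs_of_pos h4]
    refine mul_le_mul (div_le_self (by positivity) h1) ((craig_le _).trans_eq ?_)
      (craig_nonneg _) (by positivity)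
    rw [mul_pow, Real.sq_sqrt (by positivity)]
  have hlim := tendsto_zero_of_hasDerivAt_of_integrableOn_Ioi hd hf'i hfi
  have key := integral_Ioi_of_hasDerivAt_of_tendsto hfc.continuousWithinAt hd hf'i hlim
  have hf0 : f 0 = 1 := by simp [hf, coshRatio, craig_zero]
  have hk2 : ∫ b, k b = 2 * ∫ b in Set.Ioi (0 : ℝ), k b := by
    rw [← integral_comp_abs]
    refine integral_congr_ae (Eventually.of_forall fun b => ?_)
    simp only [hk]
    rcases abs_choice b with h | h <;> rw [h]
    simp
  rw [hf0, hf', integral_sub (integrable_coshRatioDeriv_mul_craig ν ht).integrableOn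
    (hki.const_mul _).integrableOn, integral_const_mul] at key
  have : scaledK ν t = √(2 * t / Real.pi) * ∫ b, k b := rfl
  rw [this, hk2]
  linarith

/-- The normalized derivative is completely monotone: it is the Laplace transform of a positive
measure on the half-line. The measure does not depend on the number of terms of the expansion. -/
theorem exists_measure_scaledK (ν : ℝ) :
    ∃ m : Measure ℝ, SFinite m ∧ (∀ᵐ ρ ∂m, 0 ≤ ρ) ∧ ∀ t : ℝ, 0 < t →
      (Integrable (fun ρ => Real.exp (-(2 * t * ρ))) m ∧
        ∫ ρ, Real.exp (-(2 * t * ρ)) ∂m = scaledK ν t) := by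
  have hpi := Real.pi_pos
  set P : Measure (ℝ × ℝ) :=
    (volume.restrict (Set.Ioi (0 : ℝ))).prod (volume.restrict (Set.Ioi (0 : ℝ))) with hP
  set d : ℝ × ℝ → ℝ := fun z => coshRatioDeriv ν z.1 * (2 / Real.pi / (1 + z.2 ^ 2)) with hd
  set σ : ℝ × ℝ → ℝ := fun z => Real.sinh z.1 ^ 2 * (1 + z.2 ^ 2) with hσ
  have hσm : Measurable σ := by fun_prop
  have hdc : Continuous d := by
    have h1 := continuous_coshRatioDeriv ν
    refine Continuous.mul (by fun_prop) (Continuous.div (by fun_prop) (by fun_prop) fun z => ?_)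
    positivity
  have hd0 : ∀ᵐ z ∂P, 0 ≤ d z := by
    have h1 : ∀ᵐ z ∂P, z ∈ Set.Ioi (0 : ℝ) ×ˢ Set.Ioi (0 : ℝ) := by
      rw [hP, Measure.prod_restrict]
      exact ae_restrict_mem (measurableSet_Ioi.prod measurableSet_Ioi)
    filter_upwards [h1] with z hz
    exact mul_nonneg (coshRatioDeriv_nonneg ν (le_of_lt hz.1)) (by positivity)
  set W : Measure (ℝ × ℝ) := P.withDensity fun z => ENNReal.ofReal (d z) with hW
  -- the point mass stands for the boundary term `1`
  refine ⟨Measure.dirac 0 + W.map σ, inferInstance, ?_, fun t ht => ?_⟩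
  · rw [ae_add_measure_iff]
    refine ⟨by rw [ae_dirac_eq]; simp, ?_⟩
    rw [ae_map_iff hσm.aemeasurable measurableSet_Ici]
    exact Eventually.of_forall fun z => by positivity
  have hs : (√(2 * t)) ^ 2 = 2 * t := Real.sq_sqrt (by positivity)
  have hem : Continuous fun ρ : ℝ => Real.exp (-(2 * t * ρ)) := by fun_prop
  have hslice : ∀ b : ℝ, (fun q : ℝ => d (b, q) * Real.exp (-(2 * t * σ (b, q)))) = fun q =>
      coshRatioDeriv ν b * (2 / Real.pi / (1 + q ^ 2) *
        Real.exp (-((√(2 * t) * Real.sinh b) ^ 2 * (1 + q ^ 2)))) := by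
    intro b; funext q
    simp only [hd, hσ]
    rw [mul_pow, hs]
    ring_nf
  have hprod : Integrable (fun z => d z * Real.exp (-(2 * t * σ z))) P := by
    rw [hP, integrable_prod_iff (Continuous.aestronglyMeasurable (by fun_prop))]
    constructor
    · refine Eventually.of_forall fun b => ?_
      rw [hslice]
      exact ((integrable_craig_integrand _).const_mul _).integrableOn
    · refine ((integrable_coshRatioDeriv_mul_craig ν ht).abs.integrableOn
        (s := Set.Ioi 0)).congr (Eventually.of_forall fun b => ?_)
      simp only [fun q => congrFun (hslice b) q]
      simp only [norm_mul (coshRatioDeriv ν b), integral_const_mul]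
      rw [abs_mul, abs_of_nonneg (craig_nonneg _), Real.norm_eq_abs]
      congr 1
      refine integral_congr_ae (Eventually.of_forall fun q => ?_)
      simp only
      rw [Real.norm_eq_abs, abs_of_nonneg (craig_integrand_nonneg _ _)]
  have hWi : Integrable (fun z => Real.exp (-(2 * t * σ z))) W := by
    rw [hW, integrable_withDensity_iff (by fun_prop) (by simp)]
    refine hprod.congr ?_
    filter_upwards [hd0] with z hz
    rw [ENNReal.toReal_ofReal hz, mul_comm]
  have hmi : Integrable (fun ρ => Real.exp (-(2 * t * ρ))) (W.map σ) := by
    rw [integrable_map_measure hem.aestronglyMeasurable hσm.aemeasurable]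
    exact hWi
  have hdi : Integrable (fun ρ => Real.exp (-(2 * t * ρ))) (Measure.dirac (0 : ℝ)) :=
    integrable_dirac (by simp)
  refine ⟨hdi.add_measure hmi, ?_⟩
  rw [integral_add_measure hdi hmi, integral_dirac,
    integral_map hσm.aemeasurable hem.aestronglyMeasurable, hW,
    integral_withDensity_eq_integral_toReal_smul (by fun_prop) (by simp),
    scaledK_eq_one_add_integral_craig ν ht]
  congr 1
  · simp
  · have e : ∫ z, (ENNReal.ofReal (d z)).toReal • Real.exp (-(2 * t * σ z)) ∂P =
        ∫ z, d z * Real.exp (-(2 * t * σ z)) ∂P := by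
      refine integral_congr_ae ?_
      filter_upwards [hd0] with z hz
      rw [ENNReal.toReal_ofReal hz, smul_eq_mul]
    rw [e, hP, integral_prod _ hprod]
    simp only [hslice, integral_const_mul]
    rfl

/-! ### The basic terminant -/

theorem norm_cpow_one_sub_natCast_sub_one (N : ℕ) {t : ℝ} (ht : 0 < t) :
    ‖(t : ℂ) ^ ((1 - N : ℂ) - 1)‖ = (t ^ N)⁻¹ := by
  rw [Complex.norm_cpow_eq_rpow_re_of_pos ht]
  have : ((1 - N : ℂ) - 1).re = -(N : ℝ) := by simp
  rw [this, Real.rpow_neg ht.le, Real.rpow_natCast]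

theorem norm_incGamma_integrand (N : ℕ) {t : ℝ} (ht : 0 < t) :
    ‖(t : ℂ) ^ ((1 - N : ℂ) - 1) * Complex.exp (-(t : ℂ))‖ = (t ^ N)⁻¹ * Real.exp (-t) := by
  rw [norm_mul, norm_cpow_one_sub_natCast_sub_one N ht, Complex.norm_exp]
  simp

theorem continuousOn_incGamma_integrand (N : ℕ) :
    ContinuousOn (fun t : ℝ => (t : ℂ) ^ ((1 - N : ℂ) - 1) * Complex.exp (-(t : ℂ)))
      (Set.Ioi 0) := by
  intro t ht
  have : ContinuousAt (fun t : ℝ => (t : ℂ) ^ ((1 - N : ℂ) - 1)) t :=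
    Complex.continuousAt_ofReal_cpow_const t _ (Or.inr (ne_of_gt ht))
  exact (this.mul (by fun_prop)).continuousWithinAt

theorem integrableOn_incGamma_integrand (N : ℕ) {c : ℝ} (hc : 0 < c) :
    IntegrableOn (fun t : ℝ => (t : ℂ) ^ ((1 - N : ℂ) - 1) * Complex.exp (-(t : ℂ)))
      (Set.Ioi c) := by
  refine Integrable.mono' ((integrableOn_exp_neg_Ioi c).const_mul (c ^ N)⁻¹)
    (((continuousOn_incGamma_integrand N).mono
      (Set.Ioi_subset_Ioi hc.le)).aestronglyMeasurable measurableSet_Ioi) ?_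
  filter_upwards [ae_restrict_mem measurableSet_Ioi] with t ht
  have ht : c < t := ht
  rw [norm_incGamma_integrand N (hc.trans ht)]
  gcongr

/-- The derivative of the incomplete gamma function in the logarithmic coordinate, in which the
integrand is entire: the integrals over the ray and over the arc are differences of values of one
primitive. -/
theorem hasDerivAt_incGamma (N : ℕ) (ζ : ℂ) :
    HasDerivAt (incGamma (1 - N))
      (-(Complex.exp ((1 - N) * ζ) * Complex.exp (-Complex.exp ζ))) ζ := by
  set h : ℂ → ℂ := fun u => Complex.exp ((1 - N) * u) * Complex.exp (-Complex.exp u) with hh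
  have hhd : Differentiable ℂ h := by fun_prop
  obtain ⟨P, hP⟩ := hhd.isExactOn_univ
  have hP : ∀ u, HasDerivAt P (h u) u := fun u => hP u (Set.mem_univ u)
  have ray : ∀ x : ℝ, ∫ t in Set.Ioi (Real.exp x),
      (t : ℂ) ^ ((1 - N : ℂ) - 1) * Complex.exp (-(t : ℂ)) =
      (∫ t in Set.Ioi (1 : ℝ), (t : ℂ) ^ ((1 - N : ℂ) - 1) * Complex.exp (-(t : ℂ))) -
        (P x - P 0) := by
    intro x
    have hpos : ∀ t ∈ Set.uIcc 1 (Real.exp x), 0 < t := fun t ht =>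
      lt_of_lt_of_le (lt_min one_pos (Real.exp_pos x)) ht.1
    have hd : ∀ t ∈ Set.uIcc 1 (Real.exp x), HasDerivAt (fun t : ℝ => P (Real.log t))
        ((t : ℂ) ^ ((1 - N : ℂ) - 1) * Complex.exp (-(t : ℂ))) t := by
      intro t ht
      have ht := hpos t ht
      have htc : (t : ℂ) ≠ 0 := by exact_mod_cast ht.ne'
      have h1 := (hP (Real.log t)).scomp t (Real.hasDerivAt_log ht.ne').ofReal_comp
      refine h1.congr_deriv ?_
      have h2 : Complex.exp (Real.log t : ℝ) = t := by
        rw [← Complex.ofReal_exp, Real.exp_log ht]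
      simp only [hh, h2]
      rw [Complex.cpow_sub _ _ htc, Complex.cpow_one, Complex.cpow_def_of_ne_zero htc,
        ← Complex.ofReal_log ht.le, mul_comm (1 - (N : ℂ))]
      push_cast
      rw [smul_eq_mul]
      field_simp
    have h1 := intervalIntegral.integral_eq_sub_of_hasDerivAt hd
      (((continuousOn_incGamma_integrand N).mono hpos).intervalIntegrable)
    have h2 := intervalIntegral.integral_interval_add_Ioi
      (integrableOn_incGamma_integrand N one_pos)
      (integrableOn_incGamma_integrand N (Real.exp_pos x))
    rw [h1, Real.log_exp, Real.log_one, Complex.ofReal_zero] at h2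
    rw [← h2]; ring
  have arc : ∀ x y : ℝ, Complex.I * ∫ s in (0 : ℝ)..y, Complex.exp ((1 - N) * (x + s * Complex.I)) *
      Complex.exp (-Complex.exp (x + s * Complex.I)) = P (x + y * Complex.I) - P x := by
    intro x y
    have hd : ∀ s ∈ Set.uIcc 0 y, HasDerivAt (fun s : ℝ => P (x + s * Complex.I))
        (Complex.I * h (x + s * Complex.I)) s := by
      intro s _
      have h1 : HasDerivAt (fun s : ℝ => (x : ℂ) + s * Complex.I) Complex.I s := by
        simpa using ((hasDerivAt_id s).ofReal_comp.mul_const Complex.I).const_add (x : ℂ)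
      have := (hP (x + s * Complex.I)).scomp s h1
      simpa using! this
    have h1 := intervalIntegral.integral_eq_sub_of_hasDerivAt hd
      (Continuous.intervalIntegrable (by fun_prop) _ _)
    rw [intervalIntegral.integral_const_mul] at h1
    simpa using h1
  have e : incGamma (1 - N) = fun ζ => (∫ t in Set.Ioi (1 : ℝ),
      (t : ℂ) ^ ((1 - N : ℂ) - 1) * Complex.exp (-(t : ℂ))) + P 0 - P ζ := by
    funext ζ
    unfold incGamma
    rw [ray, arc, Complex.re_add_im]
    ring
  rw [e]
  exact (hP ζ).const_sub _

theorem differentiable_terminantL (N : ℕ) : Differentiable ℂ (terminantL N) := by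
  have : Differentiable ℂ (incGamma (1 - N)) := fun ζ => (hasDerivAt_incGamma N ζ).differentiableAt
  unfold terminantL
  fun_prop

/-- The estimate of the ray and the arc, for points with modulus at least `1` in the sector
`|arg w| ≤ β < π/2`. -/
theorem norm_incGamma_le {N : ℕ} (hN : 1 ≤ N) {β : ℝ} (hβ : β < Real.pi / 2) {ζ : ℂ}
    (hre : 0 ≤ ζ.re) (him : |ζ.im| ≤ β) :
    ‖incGamma (1 - N) ζ‖ ≤ (1 + β) * Real.exp (-(Real.exp ζ.re * Real.cos β)) := by
  have hβ0 : 0 ≤ β := (abs_nonneg _).trans him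
  have hcos : 0 ≤ Real.cos β := Real.cos_nonneg_of_mem_Icc ⟨by linarith, hβ.le⟩
  have hexp := Real.exp_pos ζ.re
  have h1 : ‖∫ t in Set.Ioi (Real.exp ζ.re),
      (t : ℂ) ^ ((1 - N : ℂ) - 1) * Complex.exp (-(t : ℂ))‖ ≤
      Real.exp (-(Real.exp ζ.re * Real.cos β)) := by
    refine (norm_integral_le_of_norm_le (integrableOn_exp_neg_Ioi _) ?_).trans ?_
    · filter_upwards [ae_restrict_mem measurableSet_Ioi] with t ht
      have ht : Real.exp ζ.re < t := ht
      have h1t : 1 ≤ t := (Real.one_le_exp hre).trans ht.le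
      rw [norm_incGamma_integrand N (by linarith)]
      exact mul_le_of_le_one_left (Real.exp_pos _).le (inv_le_one_of_one_le₀ (one_le_pow₀ h1t))
    · rw [integral_exp_neg_Ioi]
      exact Real.exp_le_exp.2 (by nlinarith [Real.cos_le_one β])
  have h2 : ‖∫ s in (0 : ℝ)..ζ.im, Complex.exp ((1 - N) * (ζ.re + s * Complex.I)) *
      Complex.exp (-Complex.exp (ζ.re + s * Complex.I))‖ ≤
      Real.exp (-(Real.exp ζ.re * Real.cos β)) * |ζ.im - 0| := by
    refine intervalIntegral.norm_integral_le_of_norm_le_const fun s hs => ?_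
    have hs : |s| ≤ β := by
      rcases Set.mem_uIoc.1 hs with h | h
      · rw [abs_of_pos h.1]; exact (h.2.trans (le_abs_self _)).trans him
      · rw [abs_of_nonpos h.2]; linarith [neg_abs_le ζ.im]
    have e1 : ((1 - N : ℂ) * (ζ.re + s * Complex.I)).re = (1 - N) * ζ.re := by simp
    have e2 : (-Complex.exp (ζ.re + s * Complex.I)).re = -(Real.exp ζ.re * Real.cos s) := by
      simp [Complex.exp_re]
    rw [norm_mul, Complex.norm_exp, Complex.norm_exp, e1, e2, ← Real.exp_add]
    refine Real.exp_le_exp.2 ?_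
    have hc : Real.cos β ≤ Real.cos s := by
      rw [← Real.cos_abs s]
      exact Real.cos_le_cos_of_nonneg_of_le_pi (abs_nonneg s) (by linarith [Real.pi_pos]) hs
    have hN' : (1 : ℝ) ≤ N := by exact_mod_cast hN
    nlinarith
  unfold incGamma
  refine (norm_sub_le _ _).trans ?_
  rw [norm_mul, Complex.norm_I, one_mul, add_mul, one_mul]
  rw [sub_zero] at h2
  have := mul_le_mul_of_nonneg_left him (Real.exp_pos (-(Real.exp ζ.re * Real.cos β))).le
  linarith

/-- The distance from `-1` of a ray `ρ e^{iα}` with `|α| ≤ π - δ`. -/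
theorem sin_le_norm_one_add {δ α ρ : ℝ} (hδ : 0 ≤ δ) (hα : |α| ≤ Real.pi - δ) (hρ : 0 ≤ ρ) :
    Real.sin δ ≤ ‖1 + (ρ : ℂ) * Complex.exp (α * Complex.I)‖ := by
  refine Real.le_sqrt_of_sq_le ?_ |>.trans_eq (Complex.norm_def _).symm
  have hcos : -Real.cos δ ≤ Real.cos α := by
    rw [← Real.cos_pi_sub, ← Real.cos_abs α]
    exact Real.cos_le_cos_of_nonneg_of_le_pi (abs_nonneg α) (by linarith) hα
  rw [Complex.normSq_apply]
  have e1 : (1 + (ρ : ℂ) * Complex.exp (α * Complex.I)).re = 1 + ρ * Real.cos α := by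
    simp [Complex.exp_re]
  have e2 : (1 + (ρ : ℂ) * Complex.exp (α * Complex.I)).im = ρ * Real.sin α := by
    simp [Complex.exp_im]
  rw [e1, e2]
  have h1 := mul_le_mul_of_nonneg_left hcos hρ
  have h2 : (1 + ρ * Real.cos α) * (1 + ρ * Real.cos α) + ρ * Real.sin α * (ρ * Real.sin α) =
      1 + 2 * (ρ * Real.cos α) + ρ ^ 2 := by
    linear_combination ρ ^ 2 * Real.sin_sq_add_cos_sq α
  rw [h2]
  nlinarith [Real.sin_sq_add_cos_sq δ, sq_nonneg (ρ - Real.cos δ)]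

theorem one_add_mem_slitPlane {α ρ : ℝ} (hα : |α| < Real.pi) (hρ : 0 ≤ ρ) :
    1 + (ρ : ℂ) * Complex.exp (α * Complex.I) ∈ Complex.slitPlane := by
  rw [Complex.mem_slitPlane_iff]
  have e1 : (1 + (ρ : ℂ) * Complex.exp (α * Complex.I)).re = 1 + ρ * Real.cos α := by
    simp [Complex.exp_re]
  have e2 : (1 + (ρ : ℂ) * Complex.exp (α * Complex.I)).im = ρ * Real.sin α := by
    simp [Complex.exp_im]
  rw [e1, e2]
  by_cases h : ρ * Real.sin α = 0
  · left
    rcases mul_eq_zero.1 h with h | h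
    · rw [h]; norm_num
    · rw [Real.sin_eq_zero_iff_of_lt_of_lt (abs_lt.1 hα).1 (abs_lt.1 hα).2] at h
      rw [h, Real.cos_zero]; linarith
  · exact Or.inr h

theorem ray_direction_eq (ζ : ℂ) (β τ : ℝ) :
    (τ : ℂ) * Complex.exp (β * Complex.I) * Complex.exp (-ζ) =
      ((τ * Real.exp (-ζ.re) : ℝ) : ℂ) * Complex.exp ((β - ζ.im : ℝ) * Complex.I) := by
  push_cast
  rw [mul_assoc, mul_assoc, ← Complex.exp_add, ← Complex.exp_add]
  congr 2
  conv_lhs => rw [← Complex.re_add_im ζ]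
  ring

theorem norm_exp_neg_ray (β τ : ℝ) :
    ‖Complex.exp (β * Complex.I) * Complex.exp (-(τ * Complex.exp (β * Complex.I)))‖ =
      Real.exp (-Real.cos β * τ) := by
  rw [norm_mul, Complex.norm_exp_ofReal_mul_I, one_mul, Complex.norm_exp]
  congr 1
  simp [Complex.exp_re, mul_comm]

theorem norm_terminant_integrand_le (N : ℕ) {ζ : ℂ} {β δ : ℝ} (hδ : 0 < δ) (hδ' : δ < Real.pi)
    (him : |ζ.im - β| ≤ Real.pi - δ) {τ : ℝ} (hτ : 0 ≤ τ) :
    ‖Complex.exp (β * Complex.I) * Complex.exp (-(τ * Complex.exp (β * Complex.I))) *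
      ((1 + τ * Complex.exp (β * Complex.I) * Complex.exp (-ζ)) ^ N)⁻¹‖ ≤
      Real.exp (-Real.cos β * τ) * (1 / Real.sin δ) ^ N := by
  have hs := Real.sin_pos_of_pos_of_lt_pi hδ hδ'
  rw [norm_mul, norm_exp_neg_ray, norm_inv, norm_pow, one_div, inv_pow, ray_direction_eq]
  gcongr
  exact sin_le_norm_one_add hδ.le (by rwa [abs_sub_comm]) (by positivity)

theorem continuousOn_terminant_integrand (N : ℕ) {ζ : ℂ} {β : ℝ} (him : |ζ.im - β| < Real.pi) :
    ContinuousOn (fun τ : ℝ => Complex.exp (β * Complex.I) *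
      Complex.exp (-(τ * Complex.exp (β * Complex.I))) *
      ((1 + τ * Complex.exp (β * Complex.I) * Complex.exp (-ζ)) ^ N)⁻¹) (Set.Ici 0) := by
  refine ContinuousOn.mul (by fun_prop) (ContinuousOn.inv₀ (by fun_prop) fun τ hτ => ?_)
  refine pow_ne_zero N ?_
  rw [ray_direction_eq]
  have hτ : 0 ≤ τ := hτ
  exact Complex.slitPlane_ne_zero
    (one_add_mem_slitPlane (by rwa [abs_sub_comm]) (by positivity))

theorem integrableOn_terminant_integrand (N : ℕ) {ζ : ℂ} {β : ℝ} (hβ : |β| < Real.pi / 2)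
    (him : |ζ.im - β| < Real.pi) :
    IntegrableOn (fun τ : ℝ => Complex.exp (β * Complex.I) *
      Complex.exp (-(τ * Complex.exp (β * Complex.I))) *
      ((1 + τ * Complex.exp (β * Complex.I) * Complex.exp (-ζ)) ^ N)⁻¹) (Set.Ioi 0) := by
  have hcos : 0 < Real.cos β := Real.cos_pos_of_mem_Ioo (abs_lt.1 hβ)
  obtain ⟨δ, hδ, hδ1⟩ := exists_between (sub_pos.2 him)
  refine Integrable.mono' ((exp_neg_integrableOn_Ioi 0 hcos).mul_const ((1 / Real.sin δ) ^ N))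
    (((continuousOn_terminant_integrand N him).mono
      Set.Ioi_subset_Ici_self).aestronglyMeasurable measurableSet_Ioi) ?_
  filter_upwards [ae_restrict_mem measurableSet_Ioi] with τ hτ
  exact norm_terminant_integrand_le N hδ (by linarith [abs_nonneg (ζ.im - β)]) (by linarith)
    (le_of_lt hτ)

/-- The terminant as an integral along a ray in the direction `e^{iβ}`. The path starting from the
point `z` in that direction stays on one sheet, `arg` moving from `arg z` to `β`. -/
theorem terminantL_eq_integral {N : ℕ} (hN : 1 ≤ N) {ζ : ℂ} {β : ℝ} (hβ : |β| < Real.pi / 2)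
    (him : |ζ.im - β| < Real.pi) :
    terminantL N ζ = ∫ τ in Set.Ioi (0 : ℝ), Complex.exp (β * Complex.I) *
      Complex.exp (-(τ * Complex.exp (β * Complex.I))) *
      ((1 + τ * Complex.exp (β * Complex.I) * Complex.exp (-ζ)) ^ N)⁻¹ := by
  have hcos : 0 < Real.cos β := Real.cos_pos_of_mem_Ioo (abs_lt.1 hβ)
  set κ : ℂ := Complex.exp (β * Complex.I) with hκ
  set f : ℝ → ℂ := fun τ => κ * Complex.exp (-(τ * κ)) *
    ((1 + τ * κ * Complex.exp (-ζ)) ^ N)⁻¹ with hf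
  set η : ℝ → ℂ := fun τ => ζ + Complex.log (1 + τ * κ * Complex.exp (-ζ)) with hη
  have hslit : ∀ τ : ℝ, 0 ≤ τ → 1 + τ * κ * Complex.exp (-ζ) ∈ Complex.slitPlane := by
    intro τ hτ
    rw [hκ, ray_direction_eq]
    exact one_add_mem_slitPlane (by rwa [abs_sub_comm]) (by positivity)
  have hηexp : ∀ τ : ℝ, 0 ≤ τ → Complex.exp (η τ) = Complex.exp ζ + τ * κ := by
    intro τ hτ
    rw [hη, Complex.exp_add, Complex.exp_log (Complex.slitPlane_ne_zero (hslit τ hτ)),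
      Complex.exp_neg]
    field_simp
  have hd : ∀ τ : ℝ, 0 ≤ τ → HasDerivAt (fun τ => incGamma (1 - N) (η τ))
      (-(Complex.exp (-(N * ζ)) * Complex.exp (-Complex.exp ζ)) * f τ) τ := by
    intro τ hτ
    have hne := Complex.slitPlane_ne_zero (hslit τ hτ)
    have h1 : HasDerivAt (fun τ : ℝ => 1 + τ * κ * Complex.exp (-ζ)) (κ * Complex.exp (-ζ)) τ := by
      simpa using (((hasDerivAt_id τ).ofReal_comp.mul_const κ).mul_const
        (Complex.exp (-ζ))).const_add 1
    have h2 : HasDerivAt η (κ * Complex.exp (-ζ) / (1 + τ * κ * Complex.exp (-ζ))) τ :=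
      (h1.clog_real (hslit τ hτ)).const_add ζ
    have h3 := (hasDerivAt_incGamma N (η τ)).scomp τ h2
    refine h3.congr_deriv ?_
    rw [hηexp τ hτ, neg_add, Complex.exp_add, smul_eq_mul]
    have e1 : Complex.exp ((1 - N) * η τ) =
        Complex.exp ζ * (1 + τ * κ * Complex.exp (-ζ)) *
          (Complex.exp (-(N * ζ)) * ((1 + τ * κ * Complex.exp (-ζ)) ^ N)⁻¹) := by
      rw [hη]
      simp only
      rw [show (1 - N : ℂ) * (ζ + Complex.log (1 + τ * κ * Complex.exp (-ζ))) =
        ζ + Complex.log (1 + τ * κ * Complex.exp (-ζ)) + (-(N * ζ) +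
          -(N * Complex.log (1 + τ * κ * Complex.exp (-ζ)))) by ring, Complex.exp_add,
        Complex.exp_add, Complex.exp_add, Complex.exp_log hne,
        Complex.exp_neg (N * Complex.log _), Complex.exp_nat_mul, Complex.exp_log hne]
    have e2 : Complex.exp ζ * Complex.exp (-ζ) = 1 := by rw [← Complex.exp_add]; simp
    have e3 : κ * Complex.exp (-ζ) / (1 + τ * κ * Complex.exp (-ζ)) *
        -(Complex.exp ζ * (1 + τ * κ * Complex.exp (-ζ)) *
          (Complex.exp (-(N * ζ)) * ((1 + τ * κ * Complex.exp (-ζ)) ^ N)⁻¹) *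
          (Complex.exp (-Complex.exp ζ) * Complex.exp (-(τ * κ)))) =
        -(Complex.exp ζ * Complex.exp (-ζ)) * (κ / (1 + τ * κ * Complex.exp (-ζ)) *
          (1 + τ * κ * Complex.exp (-ζ))) *
          (Complex.exp (-(N * ζ)) * ((1 + τ * κ * Complex.exp (-ζ)) ^ N)⁻¹ *
          (Complex.exp (-Complex.exp ζ) * Complex.exp (-(τ * κ)))) := by ring
    rw [e1, e3, e2, div_mul_cancel₀ _ hne, hf]
    ring
  -- along the path the modulus tends to infinity and the argument to `β`
  have hre : ∀ τ : ℝ, 0 ≤ τ → Real.exp (η τ).re = ‖Complex.exp ζ + τ * κ‖ := by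
    intro τ hτ
    rw [← hηexp τ hτ, Complex.norm_exp]
  have hnorm : Tendsto (fun τ : ℝ => ‖Complex.exp ζ + τ * κ‖) atTop atTop := by
    refine tendsto_atTop_mono (fun τ => ?_) (tendsto_atTop_add_const_right _
      (-‖Complex.exp ζ‖) tendsto_id)
    have h1 := norm_sub_le (Complex.exp ζ + τ * κ) (Complex.exp ζ)
    rw [add_sub_cancel_left, norm_mul, hκ, Complex.norm_exp_ofReal_mul_I, mul_one,
      Complex.norm_real, Real.norm_eq_abs] at h1
    have h2 := le_abs_self τ
    simp only [id]
    linarith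
  have him_lim : Tendsto (fun τ => (η τ).im) atTop (𝓝 β) := by
    have h1 : ∀ᶠ τ : ℝ in atTop, (η τ).im =
        ζ.im + Complex.arg ((τ : ℂ)⁻¹ + κ * Complex.exp (-ζ)) := by
      filter_upwards [eventually_gt_atTop 0] with τ hτ
      have hτc : (τ : ℂ) ≠ 0 := by exact_mod_cast hτ.ne'
      rw [hη, Complex.add_im, Complex.log_im]
      have : 1 + τ * κ * Complex.exp (-ζ) = (τ : ℂ) * ((τ : ℂ)⁻¹ + κ * Complex.exp (-ζ)) := by
        field_simp
      rw [this, Complex.arg_real_mul _ hτ]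
    have h2 : κ * Complex.exp (-ζ) =
        ((Real.exp (-ζ.re) : ℝ) : ℂ) * Complex.exp ((β - ζ.im : ℝ) * Complex.I) := by
      simpa using ray_direction_eq ζ β 1
    have h3 : Complex.arg (κ * Complex.exp (-ζ)) = β - ζ.im := by
      rw [h2, Complex.arg_real_mul _ (Real.exp_pos _), Complex.arg_exp_mul_I, toIocMod_eq_self]
      rw [abs_sub_comm] at him
      constructor <;> linarith [(abs_lt.1 him).1, (abs_lt.1 him).2]
    have h4 : κ * Complex.exp (-ζ) ∈ Complex.slitPlane := by
      rw [Complex.mem_slitPlane_iff_arg, h3]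
      rw [abs_sub_comm] at him
      exact ⟨(lt_of_abs_lt him).ne, mul_ne_zero (Complex.exp_ne_zero _) (Complex.exp_ne_zero _)⟩
    have h5 : Tendsto (fun τ : ℝ => (τ : ℂ)⁻¹ + κ * Complex.exp (-ζ)) atTop
        (𝓝 (κ * Complex.exp (-ζ))) := by
      have : Tendsto (fun τ : ℝ => ((τ⁻¹ : ℝ) : ℂ)) atTop (𝓝 ((0 : ℝ) : ℂ)) :=
        (Complex.continuous_ofReal.tendsto 0).comp tendsto_inv_atTop_zero
      simpa using this.add_const (κ * Complex.exp (-ζ))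
    have h6 := ((Complex.continuousAt_arg h4).tendsto.comp h5).const_add ζ.im
    rw [h3, add_sub_cancel] at h6
    exact h6.congr' (h1.mono fun τ hτ => hτ.symm)
  have hlim : Tendsto (fun τ => incGamma (1 - N) (η τ)) atTop (𝓝 0) := by
    obtain ⟨β', hβ1, hβ2⟩ := exists_between hβ
    have hcos' : 0 < Real.cos β' :=
      Real.cos_pos_of_mem_Ioo ⟨by linarith [abs_nonneg β, Real.pi_pos], hβ2⟩
    have hb : Tendsto (fun τ : ℝ => (1 + β') *
        Real.exp (-(‖Complex.exp ζ + τ * κ‖ * Real.cos β'))) atTop (𝓝 0) := by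
      simpa using (Real.tendsto_exp_neg_atTop_nhds_zero.comp
        (hnorm.atTop_mul_const hcos')).const_mul (1 + β')
    refine squeeze_zero_norm' ?_ hb
    filter_upwards [eventually_ge_atTop 0, hnorm.eventually_ge_atTop 1,
      him_lim.abs.eventually_lt_const hβ1] with τ h0 h1 h2
    have h3 := norm_incGamma_le hN hβ2 (ζ := η τ) (by
      rw [← hre τ h0] at h1
      exact Real.one_le_exp_iff.1 h1) h2.le
    rwa [hre τ h0] at h3
  have hfi : IntegrableOn f (Set.Ioi 0) := integrableOn_terminant_integrand N hβ him
  have key := integral_Ioi_of_hasDerivAt_of_tendsto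
    (hd 0 le_rfl).continuousAt.continuousWithinAt (fun τ hτ => hd τ (le_of_lt hτ))
    (hfi.const_mul _) hlim
  rw [integral_const_mul] at key
  have hη0 : η 0 = ζ := by simp [hη]
  rw [hη0] at key
  have e4 : Complex.exp (N * ζ) * Complex.exp (-(N * ζ)) = 1 := by rw [← Complex.exp_add]; simp
  have e5 : Complex.exp (Complex.exp ζ) * Complex.exp (-Complex.exp ζ) = 1 := by
    rw [← Complex.exp_add]; simp
  unfold terminantL
  generalize (∫ τ in Set.Ioi (0 : ℝ), f τ) = J at *
  linear_combination (Complex.exp (N * ζ) * Complex.exp (Complex.exp ζ)) * key +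
    J * Complex.exp (Complex.exp ζ) * Complex.exp (-Complex.exp ζ) * e4 + J * e5

/-- The terminant is bounded in every closed subsector of `|arg w| < 3π/2`. -/
theorem norm_terminantL_le {N : ℕ} (hN : 1 ≤ N) {δ : ℝ} (hδ : 0 < δ) (hδ' : δ < Real.pi / 2)
    {ζ : ℂ} (him : |ζ.im| ≤ 3 * Real.pi / 2 - 2 * δ) :
    ‖terminantL N ζ‖ ≤ (1 / Real.sin δ) ^ (N + 1) := by
  have hpi := Real.pi_pos
  have hs := Real.sin_pos_of_pos_of_lt_pi hδ (by linarith)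
  have main : ∀ β : ℝ, |β| = Real.pi / 2 - δ → |ζ.im - β| ≤ Real.pi - δ →
      ‖terminantL N ζ‖ ≤ (1 / Real.sin δ) ^ (N + 1) := by
    intro β hβ hζ
    have hcos : Real.cos β = Real.sin δ := by
      rw [← Real.cos_abs, hβ, Real.cos_pi_div_two_sub]
    rw [terminantL_eq_integral hN (β := β) (by linarith) (by linarith)]
    refine (norm_integral_le_of_norm_le ((exp_neg_integrableOn_Ioi 0 hs).mul_const
      ((1 / Real.sin δ) ^ N)) ?_).trans_eq ?_
    · filter_upwards [ae_restrict_mem measurableSet_Ioi] with τ hτ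
      have := norm_terminant_integrand_le N hδ (by linarith) hζ (le_of_lt hτ)
      rwa [hcos] at this
    · rw [integral_mul_const, integral_exp_mul_Ioi (by linarith), mul_zero, Real.exp_zero, pow_succ,
        neg_div_neg_eq, mul_comm]
  obtain ⟨h1, h2⟩ := abs_le.1 him
  rcases le_total 0 ζ.im with h | h
  · exact main (Real.pi / 2 - δ) (abs_of_pos (by linarith)) (abs_le.2 ⟨by linarith, by linarith⟩)
  · exact main (-(Real.pi / 2 - δ)) (by rw [abs_neg]; exact abs_of_pos (by linarith))
      (abs_le.2 ⟨by linarith, by linarith⟩)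

/-! ### The remainder on the positive half-line as a superposition of terminants -/

theorem integral_abs_pow_two_mul_sub_one_mul_exp {N : ℕ} (hN : 1 ≤ N) {X : ℝ} (hX : 0 < X) :
    ∫ v : ℝ, |v| ^ (2 * N - 1) * Real.exp (-(X * v ^ 2)) = Real.Gamma N / X ^ N := by
  have e : (((2 * N - 1 : ℕ) : ℝ) + 1) = 2 * N := by
    rw [Nat.cast_sub (by omega)]; push_cast; ring
  rw [integral_abs_pow_mul_exp _ hX, neg_div, e, mul_div_cancel_left₀ _ (two_ne_zero' ℝ),
    Real.rpow_neg hX.le, Real.rpow_natCast]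
  ring

theorem integrable_stieltjes_integrand (N : ℕ) {X : ℝ} (hX : 0 < X) :
    Integrable fun v : ℝ => |v| ^ (2 * N - 1) / (1 + v ^ 2) * Real.exp (-(X * v ^ 2)) := by
  have hc : Continuous fun v : ℝ => |v| ^ (2 * N - 1) / (1 + v ^ 2) * Real.exp (-(X * v ^ 2)) := by
    refine Continuous.mul (Continuous.div (by fun_prop) (by fun_prop) fun v => ?_) (by fun_prop)
    positivity
  refine Integrable.mono' (integrable_abs_pow_mul_exp (2 * N - 1) hX) hc.aestronglyMeasurable
    (Eventually.of_forall fun v => ?_)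
  rw [Real.norm_of_nonneg (by positivity)]
  gcongr
  exact div_le_self (by positivity) (by nlinarith [sq_nonneg v])

theorem stieltjes_add_stieltjes_succ {N : ℕ} (hN : 1 ≤ N) {X : ℝ} (hX : 0 < X) :
    stieltjes N X + stieltjes (N + 1) X = Real.Gamma N / X ^ N := by
  rw [← integral_abs_pow_two_mul_sub_one_mul_exp hN hX, stieltjes, stieltjes,
    ← integral_add (integrable_stieltjes_integrand N hX) (integrable_stieltjes_integrand _ hX)]
  refine integral_congr_ae (Eventually.of_forall fun v => ?_)
  have h1 : 1 + v ^ 2 ≠ 0 := by positivity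
  have h2 : |v| ^ (2 * (N + 1) - 1) = |v| ^ (2 * N - 1) * v ^ 2 := by
    rw [← sq_abs v, ← pow_add]; congr 1; omega
  simp only [h2]
  field_simp

/-- Fubini with `1 / (1+v²) = ∫₀^∞ e^{-(1+v²)τ} dτ`. -/
theorem stieltjes_eq_integral {N : ℕ} (hN : 1 ≤ N) {X : ℝ} (hX : 0 < X) :
    stieltjes N X =
      ∫ τ in Set.Ioi (0 : ℝ), Real.exp (-τ) * (Real.Gamma N / (X + τ) ^ N) := by
  set F : ℝ → ℝ → ℝ := fun v τ =>
    |v| ^ (2 * N - 1) * Real.exp (-(X * v ^ 2)) * Real.exp (-(1 + v ^ 2) * τ) with hF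
  have hint : Integrable (Function.uncurry F)
      (volume.prod (volume.restrict (Set.Ioi (0 : ℝ)))) := by
    have h1 := (integrable_abs_pow_mul_exp (2 * N - 1) hX).mul_prod
      (exp_neg_integrableOn_Ioi 0 one_pos)
    refine Integrable.mono' h1 (Continuous.aestronglyMeasurable (by
      simp only [hF, Function.uncurry_def]; fun_prop)) ?_
    have h2 : ∀ᵐ z ∂(volume : Measure ℝ).prod (volume.restrict (Set.Ioi (0 : ℝ))), 0 < z.2 :=
      Measure.quasiMeasurePreserving_snd.ae (ae_restrict_mem measurableSet_Ioi)
    filter_upwards [h2] with z hz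
    simp only [Function.uncurry_def, hF]
    rw [Real.norm_of_nonneg (by positivity)]
    gcongr
    nlinarith [sq_nonneg z.1]
  have h1 : stieltjes N X = ∫ v : ℝ, ∫ τ in Set.Ioi (0 : ℝ), F v τ := by
    unfold stieltjes
    refine integral_congr_ae (Eventually.of_forall fun v => ?_)
    have hv : 0 < 1 + v ^ 2 := by positivity
    simp only [hF]
    rw [integral_const_mul, integral_exp_mul_Ioi (by linarith), mul_zero, Real.exp_zero,
      neg_div_neg_eq]
    ring
  rw [h1, integral_integral_swap hint]
  refine setIntegral_congr_fun measurableSet_Ioi fun τ hτ => ?_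
  have hτ : 0 < τ := hτ
  rw [← integral_abs_pow_two_mul_sub_one_mul_exp hN (by linarith : 0 < X + τ),
    ← integral_const_mul]
  refine integral_congr_ae (Eventually.of_forall fun v => ?_)
  simp only [hF]
  rw [mul_assoc, ← Real.exp_add, mul_left_comm, ← Real.exp_add]
  ring_nf

/-- On the positive half-line the Stieltjes-type integral is a terminant. -/
theorem stieltjes_eq_terminantL {N : ℕ} (hN : 1 ≤ N) {X : ℝ} (hX : 0 < X) :
    (stieltjes N X : ℂ) = ((Real.Gamma N / X ^ N : ℝ) : ℂ) * terminantL N (Real.log X) := by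
  have hpi := Real.pi_pos
  rw [stieltjes_eq_integral hN hX, terminantL_eq_integral hN (β := 0) (by simpa using by positivity)
    (by simpa using hpi), ← integral_complex_ofReal, ← integral_const_mul]
  refine setIntegral_congr_fun measurableSet_Ioi fun τ hτ => ?_
  have hτ : 0 < τ := hτ
  have e : Complex.exp (-(Real.log X : ℂ)) = ((X⁻¹ : ℝ) : ℂ) := by
    rw [← Complex.ofReal_neg, ← Complex.ofReal_exp, Real.exp_neg, Real.exp_log hX]
  have e2 : (X + τ) ^ N = X ^ N * (1 + τ * X⁻¹) ^ N := by
    rw [← mul_pow]; congr 1; field_simp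
  have h1 : 1 + τ * X⁻¹ ≠ 0 := by positivity
  simp only [Complex.ofReal_zero, zero_mul, Complex.exp_zero, mul_one, one_mul, e, e2]
  have : Real.exp (-τ) * (Real.Gamma N / (X ^ N * (1 + τ * X⁻¹) ^ N)) =
      Real.Gamma N / X ^ N * (Real.exp (-τ) * ((1 + τ * X⁻¹) ^ N)⁻¹) := by
    field_simp
  rw [this]
  push_cast
  rfl

/-- Interchanging the integral remainder with the Laplace representation of the normalized
derivative. -/
theorem integral_mul_scaledK_eq {ν : ℝ} {m : Measure ℝ} [SFinite m]
    (hm : ∀ t : ℝ, 0 < t → (Integrable (fun ρ => Real.exp (-(2 * t * ρ))) m ∧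
        ∫ ρ, Real.exp (-(2 * t * ρ)) ∂m = scaledK ν t))
    {N : ℕ} (hN : 1 ≤ N) (hν : |ν| < N - 1 / 2) {x : ℝ} (hx : 0 < x) :
    Integrable (fun ρ => stieltjes N (x * (2 * (1 + ρ)))) m ∧
    ∫ v : ℝ, |v| ^ (2 * N - 1) / (1 + v ^ 2) * Real.exp (-(2 * x * v ^ 2)) *
      scaledK ν (x * v ^ 2) = ∫ ρ, stieltjes N (x * (2 * (1 + ρ))) ∂m := by
  set g : ℝ → ℝ := fun v => |v| ^ (2 * N - 1) / (1 + v ^ 2) * Real.exp (-(2 * x * v ^ 2)) with hg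
  set G : ℝ → ℝ → ℝ := fun v ρ => g v * Real.exp (-(2 * (x * v ^ 2) * ρ)) with hG
  have hg0 : ∀ v, 0 ≤ g v := fun v => by simp only [hg]; positivity
  have hgc : Continuous g := by
    refine Continuous.mul (Continuous.div (by fun_prop) (by fun_prop) fun v => ?_) (by fun_prop)
    positivity
  have hae : ∀ᵐ v : ℝ, v ≠ 0 := by simp [ae_iff]
  have hsec : ∀ᵐ v : ℝ, Integrable (G v) m ∧ ∫ ρ, G v ρ ∂m = g v * scaledK ν (x * v ^ 2) := by
    filter_upwards [hae] with v hv
    obtain ⟨h1, h2⟩ := hm (x * v ^ 2) (by positivity)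
    exact ⟨h1.const_mul _, by rw [← h2, ← integral_const_mul]⟩
  have hint : Integrable (Function.uncurry G) (volume.prod m) := by
    rw [integrable_prod_iff (Continuous.aestronglyMeasurable (by
      simp only [hG, Function.uncurry_def]; fun_prop))]
    refine ⟨hsec.mono fun v hv => hv.1, ?_⟩
    refine (scaledK_eq_sum_add_integral hN hν hx).1.congr ?_
    filter_upwards [hsec] with v hv
    rw [← hv.2]
    refine integral_congr_ae (Eventually.of_forall fun ρ => ?_)
    have := mul_nonneg (hg0 v) (Real.exp_pos (-(2 * (x * v ^ 2) * ρ))).le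
    exact (Real.norm_of_nonneg this).symm
  have hin : ∀ ρ, ∫ v, G v ρ = stieltjes N (x * (2 * (1 + ρ))) := by
    intro ρ
    refine integral_congr_ae (Eventually.of_forall fun v => ?_)
    simp only [hG, hg]
    rw [mul_assoc, ← Real.exp_add]
    ring_nf
  constructor
  · refine hint.integral_prod_right.congr (Eventually.of_forall fun ρ => ?_)
    exact hin ρ
  · rw [← integral_congr_ae (Eventually.of_forall hin), ← integral_integral_swap hint]
    exact integral_congr_ae (hsec.mono fun v hv => hv.2.symm)

/-- On the positive half-line, the remainder after `N` terms is a superposition of terminants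
with respect to a finite measure whose mass is determined by the first neglected coefficient. -/
theorem exists_measure_remainder {N : ℕ} (hN : 1 ≤ N) {ν : ℝ} (hν : |ν| < N - 1 / 2) :
    ∃ (c : ℝ) (μ : Measure ℝ), IsFiniteMeasure μ ∧ (∀ᵐ ρ ∂μ, 0 ≤ ρ) ∧
      coeffB N ν = c * μ.real Set.univ ∧ ∀ x : ℝ, 0 < x →
        ((scaledK ν x - ∑ n ∈ Finset.range N, coeffB n ν / x ^ n : ℝ) : ℂ) =
          c / x ^ N * ∫ ρ, terminantL N (Real.log x + Real.log (2 * (1 + ρ))) ∂μ := by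
  obtain ⟨m, hsf, hρ, hm⟩ := exists_measure_scaledK ν
  set a : ℝ := (-1) ^ (N + 1) * (Real.cos (Real.pi * ν) / Real.pi) with ha
  set w : ℝ → ℝ := fun ρ => ((2 * (1 + ρ)) ^ N)⁻¹ with hw
  have hwm : Measurable w := by fun_prop
  have hw0 : ∀ᵐ ρ ∂m, 0 ≤ w ρ := hρ.mono fun ρ h => by simp only [hw]; positivity
  have hν1 : |ν| < ((N + 1 : ℕ) : ℝ) - 1 / 2 := by push_cast; linarith
  have hG : 0 < Real.Gamma N := Real.Gamma_pos_of_pos (by exact_mod_cast hN)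
  obtain ⟨i1, j1⟩ := integral_mul_scaledK_eq hm hN hν one_pos
  obtain ⟨i2, j2⟩ := integral_mul_scaledK_eq hm (by omega : 1 ≤ N + 1) hν1 one_pos
  have hsum : (fun ρ => stieltjes N (1 * (2 * (1 + ρ))) + stieltjes (N + 1) (1 * (2 * (1 + ρ))))
      =ᵐ[m] fun ρ => Real.Gamma N * w ρ := by
    filter_upwards [hρ] with ρ h
    rw [stieltjes_add_stieltjes_succ hN (by positivity), one_mul, div_eq_mul_inv]
  have hwi : Integrable w m := by
    have := ((i1.add i2).congr hsum).const_mul (Real.Gamma N)⁻¹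
    refine this.congr (Eventually.of_forall fun ρ => ?_)
    simp only
    field_simp
  have hcoeff : coeffB N ν = a * Real.Gamma N * ∫ ρ, w ρ ∂m := by
    -- the expansions with `N` and with `N + 1` terms at `x = 1`, with prefactors of opposite sign
    have h1 := (scaledK_eq_sum_add_integral hN hν one_pos).2
    have h2 := (scaledK_eq_sum_add_integral (by omega : 1 ≤ N + 1) hν1 one_pos).2
    rw [j1] at h1
    rw [j2, Finset.sum_range_succ] at h2
    have h3 := integral_add i1 i2
    rw [integral_congr_ae hsum, integral_const_mul] at h3
    rw [one_pow, div_one, pow_succ (-1 : ℝ)] at h2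
    rw [mul_assoc, h3, ha]
    linear_combination h1 - h2
  -- the powers of `2(1+ρ)` are absorbed into the measure, which makes it finite
  set μ : Measure ℝ := m.withDensity fun ρ => ENNReal.ofReal (w ρ) with hμ
  have hint : ∀ f : ℝ → ℂ, ∫ ρ, f ρ ∂μ = ∫ ρ, (w ρ : ℂ) * f ρ ∂m := by
    intro f
    rw [hμ, integral_withDensity_eq_integral_toReal_smul (by fun_prop) (by simp)]
    refine integral_congr_ae ?_
    filter_upwards [hw0] with ρ h
    rw [ENNReal.toReal_ofReal h, Complex.real_smul]
  refine ⟨a * Real.Gamma N, μ, isFiniteMeasure_withDensity_ofReal hwi.2,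
    (withDensity_absolutelyContinuous m _).ae_le hρ, ?_, fun x hx => ?_⟩
  · rw [hcoeff]
    congr 1
    rw [measureReal_def, hμ, withDensity_apply _ MeasurableSet.univ, Measure.restrict_univ,
      integral_eq_lintegral_of_nonneg_ae hw0 hwm.aestronglyMeasurable]
  · have h1 := (scaledK_eq_sum_add_integral hN hν hx).2
    rw [(integral_mul_scaledK_eq hm hN hν hx).2] at h1
    rw [h1, add_sub_cancel_left, hint, Complex.ofReal_mul, ← integral_complex_ofReal,
      ← integral_const_mul, ← integral_const_mul]
    refine integral_congr_ae ?_
    filter_upwards [hρ] with ρ h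
    have hs : 0 < 2 * (1 + ρ) := by positivity
    rw [stieltjes_eq_terminantL hN (by positivity), Real.log_mul hx.ne' hs.ne', ha, hw, mul_pow]
    push_cast
    field_simp

/-! ### Continuation to the sector `|arg z| < 3π/2` -/

/-- Only the argument is restricted: the bound is uniform in the modulus. -/
theorem exists_norm_terminantL_le_of_im_near {N : ℕ} (hN : 1 ≤ N) {ζ : ℂ}
    (hζ : |ζ.im| < 3 * Real.pi / 2) :
    ∃ R > 0, ∃ C : ℝ, ∀ w : ℂ, |w.im - ζ.im| ≤ R → ‖terminantL N w‖ ≤ C := by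
  have hpi := Real.pi_pos
  set δ := min ((3 * Real.pi / 2 - |ζ.im|) / 4) (Real.pi / 4) with hδ
  have h1 : δ ≤ (3 * Real.pi / 2 - |ζ.im|) / 4 := min_le_left _ _
  have h2 : δ ≤ Real.pi / 4 := min_le_right _ _
  have h3 : 0 < δ := lt_min (by linarith) (by linarith)
  refine ⟨δ, h3, _, fun w hw => norm_terminantL_le hN h3 (by linarith) ?_⟩
  have := abs_add_le ζ.im (w.im - ζ.im)
  rw [add_sub_cancel] at this
  linarith

theorem bddAbove_norm_terminantL {N : ℕ} (hN : 1 ≤ N) {ζ : ℂ} (hζ : |ζ.im| < 3 * Real.pi / 2) :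
    BddAbove (Set.range fun r : Set.Ici (1 : ℝ) =>
      ‖terminantL N (ζ + Real.log (2 * (r : ℝ)))‖) := by
  obtain ⟨R, hR, C, hC⟩ := exists_norm_terminantL_le_of_im_near hN hζ
  refine ⟨C, ?_⟩
  rintro _ ⟨r, rfl⟩
  exact hC _ (by simpa using hR.le)

theorem aestronglyMeasurable_terminantL_shift (N : ℕ) (μ : Measure ℝ) (ζ : ℂ) :
    AEStronglyMeasurable (fun ρ : ℝ => terminantL N (ζ + Real.log (2 * (1 + ρ)))) μ := by
  have h1 : Measurable fun ρ : ℝ => ζ + (Real.log (2 * (1 + ρ)) : ℂ) := by fun_prop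
  exact ((differentiable_terminantL N).continuous.measurable.comp h1).aestronglyMeasurable

theorem integrable_terminantL_shift {N : ℕ} (hN : 1 ≤ N) (μ : Measure ℝ) [IsFiniteMeasure μ] {ζ : ℂ}
    (hζ : |ζ.im| < 3 * Real.pi / 2) :
    Integrable (fun ρ : ℝ => terminantL N (ζ + Real.log (2 * (1 + ρ)))) μ := by
  obtain ⟨R, hR, C, hC⟩ := exists_norm_terminantL_le_of_im_near hN hζ
  exact Integrable.of_bound (aestronglyMeasurable_terminantL_shift N μ ζ) C
    (Eventually.of_forall fun ρ => hC _ (by simpa using hR.le))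

/-- Superpositions of terminants are analytic: Cauchy's estimate dominates the derivatives. -/
theorem differentiableAt_integral_terminantL {N : ℕ} (hN : 1 ≤ N) (μ : Measure ℝ)
    [IsFiniteMeasure μ] {ζ : ℂ} (hζ : |ζ.im| < 3 * Real.pi / 2) :
    DifferentiableAt ℂ (fun ζ => ∫ ρ, terminantL N (ζ + Real.log (2 * (1 + ρ))) ∂μ) ζ := by
  obtain ⟨R, hR, C, hC⟩ := exists_norm_terminantL_le_of_im_near hN hζ
  have hdiff := differentiable_terminantL N
  have hderiv : ∀ w : ℂ, |w.im - ζ.im| ≤ R / 2 → ‖deriv (terminantL N) w‖ ≤ C / (R / 2) := by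
    intro w hw
    refine Complex.norm_deriv_le_of_forall_mem_sphere_norm_le (half_pos hR) hdiff.diffContOnCl
      fun u hu => hC u ?_
    have h1 : |(u - w).im| ≤ R / 2 := (Complex.abs_im_le_norm _).trans_eq (by simpa using hu)
    rw [Complex.sub_im] at h1
    have := abs_add_le (u.im - w.im) (w.im - ζ.im)
    rw [sub_add_sub_cancel] at this
    linarith
  have hm : AEStronglyMeasurable
      (fun ρ : ℝ => deriv (terminantL N) (ζ + Real.log (2 * (1 + ρ)))) μ := by
    have h1 : Measurable fun ρ : ℝ => ζ + (Real.log (2 * (1 + ρ)) : ℂ) := by fun_prop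
    exact ((measurable_deriv _).comp h1).aestronglyMeasurable
  refine (hasDerivAt_integral_of_dominated_loc_of_deriv_le
    (F := fun x (ρ : ℝ) => terminantL N (x + Real.log (2 * (1 + ρ))))
    (F' := fun x (ρ : ℝ) => deriv (terminantL N) (x + Real.log (2 * (1 + ρ))))
    (bound := fun _ => C / (R / 2)) (Metric.ball_mem_nhds ζ (half_pos hR))
    (Eventually.of_forall fun x => aestronglyMeasurable_terminantL_shift N μ x)
    (integrable_terminantL_shift hN μ hζ) hm
    (Eventually.of_forall fun ρ x hx => hderiv _ ?_) (integrable_const _)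
    (Eventually.of_forall fun ρ x _ => ?_)).2.differentiableAt
  · have h1 : |(x - ζ).im| ≤ R / 2 := (Complex.abs_im_le_norm _).trans
      (by rw [← dist_eq_norm]; exact (Metric.mem_ball.1 hx).le)
    simpa using h1
  · exact (hdiff _).hasDerivAt.comp_add_const x _

theorem differentiable_remK' (N : ℕ) (ν : ℝ) : Differentiable ℂ (remK' N ν) := by
  have h1 : Differentiable ℂ (deriv (besselK ν)) := (differentiable_besselK ν).deriv
  intro ζ
  unfold remK' zderiv
  have h2 : prefactorK ζ ≠ 0 := prefactorK_ne_zero ζ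
  have h3 : DifferentiableAt ℂ prefactorK ζ := by unfold prefactorK; fun_prop
  refine DifferentiableAt.sub (DifferentiableAt.div (by fun_prop) h3 h2)
    (DifferentiableAt.fun_sum fun n _ => DifferentiableAt.div (by fun_prop) (by fun_prop)
      (pow_ne_zero n (Complex.exp_ne_zero ζ)))

/-- The remainder for `K_ν'` is a superposition of terminants in the whole sector
`|arg z| < 3π/2`. -/
theorem exists_measure_remK' {N : ℕ} (hN : 1 ≤ N) {ν : ℝ} (hν : |ν| < N - 1 / 2) :
    ∃ (c : ℝ) (μ : Measure ℝ), IsFiniteMeasure μ ∧ (∀ᵐ ρ ∂μ, 0 ≤ ρ) ∧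
      coeffB N ν = c * μ.real Set.univ ∧ ∀ ζ : ℂ, |ζ.im| < 3 * Real.pi / 2 →
        remK' N ν ζ =
          c / Complex.exp ζ ^ N * ∫ ρ, terminantL N (ζ + Real.log (2 * (1 + ρ))) ∂μ := by
  obtain ⟨c, μ, hfin, hρ, hc, h⟩ := exists_measure_remainder hN hν
  refine ⟨c, μ, hfin, hρ, hc, fun ζ hζ => ?_⟩
  set U : Set ℂ := {ζ | |ζ.im| < 3 * Real.pi / 2} with hU
  have hUo : IsOpen U := isOpen_lt (by fun_prop) continuous_const
  have hUe : U = Complex.imLm ⁻¹' Set.Ioo (-(3 * Real.pi / 2)) (3 * Real.pi / 2) := by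
    ext w; exact abs_lt (a := w.im)
  have hUc : IsPreconnected U := by
    rw [hUe]
    exact ((convex_Ioo _ _).linear_preimage Complex.imLm).isPreconnected
  have hf : AnalyticOnNhd ℂ (remK' N ν) U :=
    (differentiable_remK' N ν).differentiableOn.analyticOnNhd hUo
  have hg : AnalyticOnNhd ℂ (fun ζ : ℂ => c / Complex.exp ζ ^ N *
      ∫ ρ, terminantL N (ζ + Real.log (2 * (1 + ρ))) ∂μ) U := by
    refine DifferentiableOn.analyticOnNhd (fun w hw => ?_) hUo
    have h1 : DifferentiableAt ℂ (fun ζ : ℂ => (c : ℂ) / Complex.exp ζ ^ N) w :=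
      DifferentiableAt.div (by fun_prop) (by fun_prop) (pow_ne_zero N (Complex.exp_ne_zero w))
    exact (h1.mul (differentiableAt_integral_terminantL hN μ hw)).differentiableWithinAt
  have h0 : ((0 : ℝ) : ℂ) ∈ U := by
    show |((0 : ℝ) : ℂ).im| < _
    simp [Real.pi_pos]
  refine hf.eqOn_of_preconnected_of_frequently_eq hg hUc h0
    (frequently_ofReal_of_eventually (Eventually.of_forall fun r => ?_)) hζ
  have h1 := h (Real.exp r) (Real.exp_pos r)
  rw [Real.log_exp] at h1
  rw [remK', neg_zderiv_besselK_div_prefactorK, ← Complex.ofReal_exp, ← h1]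
  push_cast
  rfl

/-! ### The remainder for `J_ν'` and `Y_ν'` -/

theorem exp_add_quarter_turn (ζ : ℂ) :
    Complex.exp (ζ + Real.pi / 2 * Complex.I) = Complex.exp ζ * Complex.I := by
  rw [Complex.exp_add, Complex.exp_pi_div_two_mul_I]

theorem exp_sub_quarter_turn (ζ : ℂ) :
    Complex.exp (ζ - Real.pi / 2 * Complex.I) = Complex.exp ζ * -Complex.I := by
  rw [sub_eq_add_neg, Complex.exp_add, Complex.exp_neg (_ * _), Complex.exp_pi_div_two_mul_I,
    Complex.inv_I]

/-- The factor `e^{-ζ}` in `d/dz` contributes `∓i` under a quarter turn. -/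
theorem zderiv_add_quarter_turns {f g : ℂ → ℂ} (hg : Differentiable ℂ g) {A B : ℂ}
    (hf : ∀ ζ, f ζ = A * g (ζ + Real.pi / 2 * Complex.I) + B * g (ζ - Real.pi / 2 * Complex.I))
    (ζ : ℂ) :
    zderiv f ζ = Complex.I * (A * zderiv g (ζ + Real.pi / 2 * Complex.I) -
      B * zderiv g (ζ - Real.pi / 2 * Complex.I)) := by
  have h1 := (hg (ζ + Real.pi / 2 * Complex.I)).hasDerivAt.comp_add_const ζ _
  have h2 := (hg (ζ - Real.pi / 2 * Complex.I)).hasDerivAt.comp_sub_const ζ _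
  have h3 : HasDerivAt f (A * deriv g (ζ + Real.pi / 2 * Complex.I) +
      B * deriv g (ζ - Real.pi / 2 * Complex.I)) ζ := by
    rw [funext hf]
    exact (h1.const_mul A).add (h2.const_mul B)
  have e1 : Complex.exp (-(ζ + Real.pi / 2 * Complex.I)) = Complex.exp (-ζ) * -Complex.I := by
    rw [← exp_sub_quarter_turn]; ring_nf
  have e2 : Complex.exp (-(ζ - Real.pi / 2 * Complex.I)) = Complex.exp (-ζ) * Complex.I := by
    rw [← exp_add_quarter_turn]; ring_nf
  unfold zderiv
  rw [h3.deriv, e1, e2]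
  linear_combination (Complex.exp (-ζ) * (A * deriv g (ζ + Real.pi / 2 * Complex.I) +
      B * deriv g (ζ - Real.pi / 2 * Complex.I))) * Complex.I_sq

theorem zderiv_besselJ_eq (ν ζ : ℂ) : zderiv (besselJ ν) ζ = -(1 / Real.pi) *
    (Complex.exp (ν * (Real.pi / 2 * Complex.I)) *
        zderiv (besselK ν) (ζ + Real.pi / 2 * Complex.I) +
      Complex.exp (-(ν * (Real.pi / 2 * Complex.I))) *
        zderiv (besselK ν) (ζ - Real.pi / 2 * Complex.I)) := by
  rw [zderiv_add_quarter_turns (differentiable_besselK ν)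
    (A := Complex.I / Real.pi * Complex.exp (ν * (Real.pi / 2 * Complex.I)))
    (B := -(Complex.I / Real.pi * Complex.exp (-(ν * (Real.pi / 2 * Complex.I)))))
    (fun ζ => by rw [besselJ_eq_besselK]; ring)]
  ring_nf
  rw [Complex.I_sq]
  ring

theorem zderiv_besselY_eq (ν ζ : ℂ) : zderiv (besselY ν) ζ = -(Complex.I / Real.pi) *
    (Complex.exp (ν * (Real.pi / 2 * Complex.I)) *
        zderiv (besselK ν) (ζ + Real.pi / 2 * Complex.I) -
      Complex.exp (-(ν * (Real.pi / 2 * Complex.I))) *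
        zderiv (besselK ν) (ζ - Real.pi / 2 * Complex.I)) := by
  rw [zderiv_add_quarter_turns (differentiable_besselK ν)
    (A := -(1 / Real.pi) * Complex.exp (ν * (Real.pi / 2 * Complex.I)))
    (B := -(1 / Real.pi) * Complex.exp (-(ν * (Real.pi / 2 * Complex.I))))
    (fun ζ => by rw [besselY_eq_besselK]; ring)]
  ring

theorem sqrt_pi_div_two_eq : (√(Real.pi / 2) : ℂ) = Real.pi / 2 * √(2 / Real.pi) := by
  have hpi := Real.pi_pos
  have h : √(Real.pi / 2) = Real.pi / 2 * √(2 / Real.pi) := by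
    rw [show 2 / Real.pi = (Real.pi / 2)⁻¹ by rw [inv_div], Real.sqrt_inv, ← div_eq_mul_inv,
      Real.div_sqrt]
  exact_mod_cast h

theorem prefactorK_add_quarter_turn (ν : ℝ) (ζ : ℂ) :
    Complex.exp (ν * (Real.pi / 2 * Complex.I)) * prefactorK (ζ + Real.pi / 2 * Complex.I) =
      Real.pi / 2 * prefactorJ ζ *
        (-Complex.I * (Complex.cos (phase ν ζ) - Complex.sin (phase ν ζ) * Complex.I)) := by
  have e : -Complex.I * (Complex.cos (phase ν ζ) - Complex.sin (phase ν ζ) * Complex.I) =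
      Complex.exp (-(Real.pi / 2 * Complex.I)) * Complex.exp (-(phase ν ζ * Complex.I)) := by
    rw [Complex.exp_neg, Complex.exp_pi_div_two_mul_I, Complex.inv_I, ← neg_mul,
      Complex.exp_mul_I, Complex.cos_neg, Complex.sin_neg]
    ring
  unfold prefactorK prefactorJ
  rw [sqrt_pi_div_two_eq, e, exp_add_quarter_turn]
  have : Complex.exp (ν * (Real.pi / 2 * Complex.I)) *
      (Complex.exp (-(ζ + Real.pi / 2 * Complex.I) / 2) *
        Complex.exp (-(Complex.exp ζ * Complex.I))) = Complex.exp (-ζ / 2) *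
      (Complex.exp (-(Real.pi / 2 * Complex.I)) * Complex.exp (-(phase ν ζ * Complex.I))) := by
    rw [← Complex.exp_add, ← Complex.exp_add, ← Complex.exp_add, ← Complex.exp_add, phase]
    ring_nf
  linear_combination (Real.pi / 2 * √(2 / Real.pi) : ℂ) * this

theorem prefactorK_sub_quarter_turn (ν : ℝ) (ζ : ℂ) :
    Complex.exp (-(ν * (Real.pi / 2 * Complex.I))) * prefactorK (ζ - Real.pi / 2 * Complex.I) =
      Real.pi / 2 * prefactorJ ζ *
        (Complex.I * (Complex.cos (phase ν ζ) + Complex.sin (phase ν ζ) * Complex.I)) := by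
  have e : Complex.I * (Complex.cos (phase ν ζ) + Complex.sin (phase ν ζ) * Complex.I) =
      Complex.exp (Real.pi / 2 * Complex.I) * Complex.exp (phase ν ζ * Complex.I) := by
    rw [Complex.exp_pi_div_two_mul_I, Complex.exp_mul_I]
  unfold prefactorK prefactorJ
  rw [sqrt_pi_div_two_eq, e, exp_sub_quarter_turn]
  have : Complex.exp (-(ν * (Real.pi / 2 * Complex.I))) *
      (Complex.exp (-(ζ - Real.pi / 2 * Complex.I) / 2) *
        Complex.exp (-(Complex.exp ζ * -Complex.I))) = Complex.exp (-ζ / 2) *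
      (Complex.exp (Real.pi / 2 * Complex.I) * Complex.exp (phase ν ζ * Complex.I)) := by
    rw [← Complex.exp_add, ← Complex.exp_add, ← Complex.exp_add, ← Complex.exp_add, phase]
    ring_nf
  linear_combination (Real.pi / 2 * √(2 / Real.pi) : ℂ) * this

/-- The normalized derivative `-K_ν'(z) / ((π/(2z))^{1/2} e^{-z})`. -/
def normK (ν : ℝ) (ζ : ℂ) : ℂ := -zderiv (besselK ν) ζ / prefactorK ζ

theorem zderiv_besselK_eq_normK (ν : ℝ) (ζ : ℂ) :
    zderiv (besselK ν) ζ = -(prefactorK ζ * normK ν ζ) := by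
  rw [normK, mul_div_cancel₀ _ (prefactorK_ne_zero ζ), neg_neg]

theorem zderiv_besselJ_eq_normK (ν : ℝ) (ζ : ℂ) :
    zderiv (besselJ ν) ζ = prefactorJ ζ * (Complex.I / 2 *
      ((Complex.cos (phase ν ζ) + Complex.sin (phase ν ζ) * Complex.I) *
          normK ν (ζ - Real.pi / 2 * Complex.I) -
        (Complex.cos (phase ν ζ) - Complex.sin (phase ν ζ) * Complex.I) *
          normK ν (ζ + Real.pi / 2 * Complex.I))) := by
  have hpi : (Real.pi : ℂ) ≠ 0 := by exact_mod_cast Real.pi_ne_zero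
  rw [zderiv_besselJ_eq, zderiv_besselK_eq_normK, zderiv_besselK_eq_normK, mul_neg, mul_neg,
    ← mul_assoc (Complex.exp _), ← mul_assoc (Complex.exp _), prefactorK_add_quarter_turn,
    prefactorK_sub_quarter_turn]
  field_simp
  ring

theorem zderiv_besselY_eq_normK (ν : ℝ) (ζ : ℂ) :
    zderiv (besselY ν) ζ = prefactorJ ζ * (1 / 2 *
      ((Complex.cos (phase ν ζ) + Complex.sin (phase ν ζ) * Complex.I) *
          normK ν (ζ - Real.pi / 2 * Complex.I) +
        (Complex.cos (phase ν ζ) - Complex.sin (phase ν ζ) * Complex.I) *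
          normK ν (ζ + Real.pi / 2 * Complex.I))) := by
  have hpi : (Real.pi : ℂ) ≠ 0 := by exact_mod_cast Real.pi_ne_zero
  rw [zderiv_besselY_eq, zderiv_besselK_eq_normK, zderiv_besselK_eq_normK, mul_neg, mul_neg,
    ← mul_assoc (Complex.exp _), ← mul_assoc (Complex.exp _), prefactorK_add_quarter_turn,
    prefactorK_sub_quarter_turn]
  generalize Complex.cos (phase ν ζ) = C
  generalize Complex.sin (phase ν ζ) = S
  generalize normK ν (ζ - Real.pi / 2 * Complex.I) = Qm
  generalize normK ν (ζ + Real.pi / 2 * Complex.I) = Qp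
  field_simp
  linear_combination (prefactorJ ζ * (-(C + S * Complex.I) * Qm - (C - S * Complex.I) * Qp)) *
    Complex.I_sq

/-- The even part of the expansion is the mean of the normalized derivatives at `z e^{±iπ/2}`. -/
theorem zderiv_cos_sub_sin_div_prefactorJ (ν : ℝ) (ζ : ℂ) :
    (zderiv (besselY ν) ζ * Complex.cos (phase ν ζ) -
      zderiv (besselJ ν) ζ * Complex.sin (phase ν ζ)) / prefactorJ ζ =
    (normK ν (ζ + Real.pi / 2 * Complex.I) + normK ν (ζ - Real.pi / 2 * Complex.I)) / 2 := by
  have hs := Complex.sin_sq_add_cos_sq (phase ν ζ)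
  rw [div_eq_iff (prefactorJ_ne_zero ζ), zderiv_besselJ_eq_normK, zderiv_besselY_eq_normK]
  generalize Complex.cos (phase ν ζ) = C at *
  generalize Complex.sin (phase ν ζ) = S at *
  generalize normK ν (ζ - Real.pi / 2 * Complex.I) = Qm
  generalize normK ν (ζ + Real.pi / 2 * Complex.I) = Qp
  linear_combination (prefactorJ ζ * (Qp + Qm) / 2) * hs -
    prefactorJ ζ / 2 * S ^ 2 * (Qp + Qm) * Complex.I_sq

/-- The odd part of the expansion is a difference of the normalized derivatives at
`z e^{±iπ/2}`. -/
theorem zderiv_cos_add_sin_div_prefactorJ (ν : ℝ) (ζ : ℂ) :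
    (zderiv (besselJ ν) ζ * Complex.cos (phase ν ζ) +
      zderiv (besselY ν) ζ * Complex.sin (phase ν ζ)) / prefactorJ ζ =
    Complex.I / 2 *
      (normK ν (ζ - Real.pi / 2 * Complex.I) - normK ν (ζ + Real.pi / 2 * Complex.I)) := by
  have hs := Complex.sin_sq_add_cos_sq (phase ν ζ)
  rw [div_eq_iff (prefactorJ_ne_zero ζ), zderiv_besselJ_eq_normK, zderiv_besselY_eq_normK]
  generalize Complex.cos (phase ν ζ) = C at *
  generalize Complex.sin (phase ν ζ) = S at *
  generalize normK ν (ζ - Real.pi / 2 * Complex.I) = Qm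
  generalize normK ν (ζ + Real.pi / 2 * Complex.I) = Qp
  linear_combination (Complex.I * prefactorJ ζ * (Qm - Qp) / 2) * hs +
    prefactorJ ζ / 2 * S * C * (Qp + Qm) * Complex.I_sq

theorem sum_even_terms (b : ℕ → ℂ) {z : ℂ} (hz : z ≠ 0) (M : ℕ) :
    ∑ n ∈ Finset.range (2 * M), b n / (z * Complex.I) ^ n +
      ∑ n ∈ Finset.range (2 * M), b n / (z * -Complex.I) ^ n =
    2 * ∑ n ∈ Finset.range M, (-1) ^ n * b (2 * n) / z ^ (2 * n) := by
  induction M with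
  | zero => simp
  | succ M ih =>
    rw [show 2 * (M + 1) = 2 * M + 1 + 1 by ring]
    simp only [Finset.sum_range_succ]
    have e1 : (z * Complex.I) ^ (2 * M) = z ^ (2 * M) * (-1) ^ M := by
      rw [mul_pow, pow_mul Complex.I, Complex.I_sq]
    have e2 : (z * -Complex.I) ^ (2 * M) = z ^ (2 * M) * (-1) ^ M := by
      rw [mul_pow, pow_mul (-Complex.I), neg_sq, Complex.I_sq]
    have e3 : (-1 : ℂ) ^ M * (-1) ^ M = 1 := by rw [← mul_pow]; norm_num
    have e4 : (-1 : ℂ) ^ M ≠ 0 := pow_ne_zero _ (by norm_num)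
    have e5 : b (2 * M) / (z ^ (2 * M) * (-1) ^ M) = (-1) ^ M * b (2 * M) / z ^ (2 * M) := by
      rw [div_eq_div_iff (mul_ne_zero (pow_ne_zero _ hz) e4) (pow_ne_zero _ hz)]
      linear_combination (-b (2 * M) * z ^ (2 * M)) * e3
    have e6 : b (2 * M + 1) / (z * Complex.I) ^ (2 * M + 1) +
        b (2 * M + 1) / (z * -Complex.I) ^ (2 * M + 1) = 0 := by
      rw [mul_neg, Odd.neg_pow ⟨M, rfl⟩, div_neg, add_neg_cancel]
    rw [e1, e2, e5]
    linear_combination ih + e6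

theorem sum_odd_terms (b : ℕ → ℂ) {z : ℂ} (hz : z ≠ 0) (M : ℕ) :
    ∑ n ∈ Finset.range (2 * M + 1), b n / (z * -Complex.I) ^ n -
      ∑ n ∈ Finset.range (2 * M + 1), b n / (z * Complex.I) ^ n =
    2 * Complex.I * ∑ n ∈ Finset.range M, (-1) ^ n * b (2 * n + 1) / z ^ (2 * n + 1) := by
  induction M with
  | zero => simp
  | succ M ih =>
    rw [show 2 * (M + 1) + 1 = 2 * M + 1 + 1 + 1 by ring]
    rw [Finset.sum_range_succ _ (2 * M + 1 + 1), Finset.sum_range_succ _ (2 * M + 1),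
      Finset.sum_range_succ _ (2 * M + 1 + 1), Finset.sum_range_succ _ (2 * M + 1),
      Finset.sum_range_succ _ M]
    have e1 : (z * Complex.I) ^ (2 * M + 1) = z ^ (2 * M + 1) * ((-1) ^ M * Complex.I) := by
      rw [mul_pow, pow_succ Complex.I, pow_mul Complex.I, Complex.I_sq]
    have e3 : (-1 : ℂ) ^ M * (-1) ^ M = 1 := by rw [← mul_pow]; norm_num
    have e4 : (-1 : ℂ) ^ M ≠ 0 := pow_ne_zero _ (by norm_num)
    have e5 : b (2 * M + 1) / (z ^ (2 * M + 1) * ((-1) ^ M * Complex.I)) =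
        -Complex.I * ((-1) ^ M * b (2 * M + 1) / z ^ (2 * M + 1)) := by
      rw [← mul_div_assoc, div_eq_div_iff (mul_ne_zero (pow_ne_zero _ hz)
        (mul_ne_zero e4 Complex.I_ne_zero)) (pow_ne_zero _ hz)]
      linear_combination (-b (2 * M + 1) * z ^ (2 * M + 1)) * e3 +
        b (2 * M + 1) * z ^ (2 * M + 1) * (-1) ^ M * (-1) ^ M * Complex.I_sq
    have e6 : (z * -Complex.I) ^ (2 * M + 1 + 1) = (z * Complex.I) ^ (2 * M + 1 + 1) := by
      rw [mul_neg, Even.neg_pow ⟨M + 1, by ring⟩]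
    have e7 : (z * -Complex.I) ^ (2 * M + 1) = -(z * Complex.I) ^ (2 * M + 1) := by
      rw [mul_neg, Odd.neg_pow ⟨M, rfl⟩]
    rw [e6, e7, div_neg, e1, e5]
    linear_combination ih

theorem remK'_eq_normK_sub (N : ℕ) (ν : ℝ) (ζ : ℂ) : remK' N ν ζ =
    normK ν ζ - ∑ n ∈ Finset.range N, (coeffB n ν : ℂ) / Complex.exp ζ ^ n := rfl

theorem remJ'Even_eq (M : ℕ) (ν : ℝ) (ζ : ℂ) :
    remJ'Even M ν ζ = (remK' (2 * M) ν (ζ + Real.pi / 2 * Complex.I) +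
      remK' (2 * M) ν (ζ - Real.pi / 2 * Complex.I)) / 2 := by
  have h := sum_even_terms (fun n => (coeffB n ν : ℂ)) (Complex.exp_ne_zero ζ) M
  rw [remJ'Even, zderiv_cos_sub_sin_div_prefactorJ, remK'_eq_normK_sub, remK'_eq_normK_sub,
    exp_add_quarter_turn, exp_sub_quarter_turn]
  linear_combination h / 2

theorem remJ'Odd_eq (M : ℕ) (ν : ℝ) (ζ : ℂ) :
    remJ'Odd M ν ζ = Complex.I / 2 * (remK' (2 * M + 1) ν (ζ - Real.pi / 2 * Complex.I) -
      remK' (2 * M + 1) ν (ζ + Real.pi / 2 * Complex.I)) := by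
  have h := sum_odd_terms (fun n => (coeffB n ν : ℂ)) (Complex.exp_ne_zero ζ) M
  rw [remJ'Odd, zderiv_cos_add_sin_div_prefactorJ, remK'_eq_normK_sub, remK'_eq_normK_sub,
    exp_add_quarter_turn, exp_sub_quarter_turn]
  generalize ∑ n ∈ Finset.range M, (-1) ^ n * (coeffB (2 * n + 1) ν : ℂ) /
    Complex.exp ζ ^ (2 * n + 1) = T at *
  linear_combination Complex.I / 2 * h + T * Complex.I_sq

theorem abs_im_add_quarter_turn {ζ : ℂ} (hζ : |ζ.im| < Real.pi) :
    |(ζ + Real.pi / 2 * Complex.I).im| < 3 * Real.pi / 2 ∧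
      |(ζ - Real.pi / 2 * Complex.I).im| < 3 * Real.pi / 2 := by
  have e : ((Real.pi : ℂ) / 2 * Complex.I).im = Real.pi / 2 := by
    rw [← Complex.ofReal_ofNat, ← Complex.ofReal_div, Complex.mul_I_im, Complex.ofReal_re]
  rw [Complex.add_im, Complex.sub_im, e, abs_lt, abs_lt]
  obtain ⟨h1, h2⟩ := abs_lt.1 hζ
  refine ⟨⟨?_, ?_⟩, ?_, ?_⟩ <;> linarith

/-- The remainder for `J_ν'` and `Y_ν'` is, up to sign, the superposition of the terminants `Π_N`
with respect to the same measure. -/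
theorem norm_remJ'_eq {N : ℕ} (hN : 1 ≤ N) {ν c : ℝ} {μ : Measure ℝ} [IsFiniteMeasure μ]
    (h : ∀ ζ : ℂ, |ζ.im| < 3 * Real.pi / 2 → remK' N ν ζ =
      c / Complex.exp ζ ^ N * ∫ ρ, terminantL N (ζ + Real.log (2 * (1 + ρ))) ∂μ)
    {ζ : ℂ} (hζ : |ζ.im| < Real.pi) :
    ‖remJ' N ν ζ‖ = ‖(c / Complex.exp ζ ^ N : ℂ) *
      ∫ ρ, terminantP N (ζ + Real.log (2 * (1 + ρ))) ∂μ‖ := by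
  obtain ⟨hp, hm⟩ := abs_im_add_quarter_turn hζ
  have hP : ∫ ρ, terminantP N (ζ + Real.log (2 * (1 + ρ))) ∂μ =
      ((∫ ρ, terminantL N (ζ + Real.pi / 2 * Complex.I + Real.log (2 * (1 + ρ))) ∂μ) +
        ∫ ρ, terminantL N (ζ - Real.pi / 2 * Complex.I + Real.log (2 * (1 + ρ))) ∂μ) / 2 := by
    rw [← integral_add (integrable_terminantL_shift hN μ hp) (integrable_terminantL_shift hN μ hm),
      ← integral_div]
    refine integral_congr_ae (Eventually.of_forall fun ρ => ?_)
    simp only [terminantP]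
    congr 3 <;> ring
  have hz := Complex.exp_ne_zero ζ
  have h1 := h _ hp
  have h2 := h _ hm
  rw [exp_add_quarter_turn] at h1
  rw [exp_sub_quarter_turn] at h2
  rw [hP]
  generalize (∫ ρ, terminantL N (ζ + Real.pi / 2 * Complex.I + Real.log (2 * (1 + ρ))) ∂μ) = A at *
  generalize (∫ ρ, terminantL N (ζ - Real.pi / 2 * Complex.I + Real.log (2 * (1 + ρ))) ∂μ) = B at *
  have e4 : ∀ M : ℕ, (-1 : ℂ) ^ M ≠ 0 := fun M => pow_ne_zero _ (by norm_num)
  rcases Nat.even_or_odd' N with ⟨M, rfl | rfl⟩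
  · have e0 : remJ' (2 * M) ν ζ = remJ'Even M ν ζ := by simp [remJ']
    have e1 : Complex.I ^ (2 * M) = (-1) ^ M := by rw [pow_mul, Complex.I_sq]
    have e2 : (-Complex.I) ^ (2 * M) = (-1) ^ M := by rw [pow_mul, neg_sq, Complex.I_sq]
    rw [mul_pow, e1] at h1
    rw [mul_pow, e2] at h2
    have e3 : remJ' (2 * M) ν ζ * (-1) ^ M = c / Complex.exp ζ ^ (2 * M) * ((A + B) / 2) := by
      have := e4 M
      rw [e0, remJ'Even_eq, h1, h2]
      field_simp
    rw [← e3, norm_mul, norm_pow, norm_neg, norm_one, one_pow, mul_one]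
  · have e0 : remJ' (2 * M + 1) ν ζ = remJ'Odd M ν ζ := by
      simp [remJ', show (2 * M + 1) / 2 = M by omega]
    have e1 : Complex.I ^ (2 * M + 1) = (-1) ^ M * Complex.I := by
      rw [pow_succ, pow_mul, Complex.I_sq]
    have e2 : (-Complex.I) ^ (2 * M + 1) = -((-1) ^ M * Complex.I) := by
      rw [Odd.neg_pow ⟨M, rfl⟩, e1]
    rw [mul_pow, e1] at h1
    rw [mul_pow, e2] at h2
    have e3 : remJ' (2 * M + 1) ν ζ * -(-1) ^ M =
        c / Complex.exp ζ ^ (2 * M + 1) * ((A + B) / 2) := by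
      have := e4 M
      have hI := Complex.I_ne_zero
      rw [e0, remJ'Odd_eq, h1, h2]
      field_simp
      ring
    rw [← e3, norm_mul, norm_neg, norm_pow, norm_neg, norm_one, one_pow, mul_one]

/-! ### The error bounds -/

theorem bddAbove_norm_terminantP {N : ℕ} (hN : 1 ≤ N) {ζ : ℂ} (hζ : |ζ.im| < Real.pi) :
    BddAbove (Set.range fun r : Set.Ici (1 : ℝ) =>
      ‖terminantP N (ζ + Real.log (2 * (r : ℝ)))‖) := by
  obtain ⟨hp, hm⟩ := abs_im_add_quarter_turn hζ
  obtain ⟨R, hR, C, hC⟩ := exists_norm_terminantL_le_of_im_near hN hp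
  obtain ⟨R', hR', C', hC'⟩ := exists_norm_terminantL_le_of_im_near hN hm
  refine ⟨(C + C') / 2, ?_⟩
  rintro _ ⟨r, rfl⟩
  simp only [terminantP, norm_div, Complex.norm_ofNat]
  gcongr
  refine (norm_add_le _ _).trans (add_le_add (hC _ ?_) (hC' _ ?_)) <;> simp [hR.le, hR'.le]

/-- The points `2z(1+ρ)` of the superposition are among those of the supremum, as `ρ ≥ 0`. -/
theorem norm_mul_integral_le_iSup {f : ℂ → ℂ} {c : ℝ} {μ : Measure ℝ} [IsFiniteMeasure μ]
    (hρ : ∀ᵐ ρ ∂μ, 0 ≤ ρ) {N : ℕ} {ζ : ℂ}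
    (hf : BddAbove (Set.range fun r : Set.Ici (1 : ℝ) => ‖f (ζ + Real.log (2 * (r : ℝ)))‖)) :
    ‖(c / Complex.exp ζ ^ N : ℂ) * ∫ ρ, f (ζ + Real.log (2 * (1 + ρ))) ∂μ‖ ≤
      |c * μ.real Set.univ| / ‖Complex.exp ζ‖ ^ N *
        ⨆ r : Set.Ici (1 : ℝ), ‖f (ζ + Real.log (2 * (r : ℝ)))‖ := by
  have h : ‖∫ ρ, f (ζ + Real.log (2 * (1 + ρ))) ∂μ‖ ≤
      (⨆ r : Set.Ici (1 : ℝ), ‖f (ζ + Real.log (2 * (r : ℝ)))‖) * μ.real Set.univ := by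
    refine norm_integral_le_of_norm_le_const (hρ.mono fun ρ h0 => ?_)
    exact le_ciSup hf (⟨1 + ρ, le_add_of_nonneg_right h0⟩ : Set.Ici (1 : ℝ))
  rw [norm_mul, norm_div, norm_pow, Complex.norm_real, Real.norm_eq_abs, abs_mul,
    abs_of_nonneg (measureReal_nonneg : 0 ≤ μ.real Set.univ)]
  calc |c| / ‖Complex.exp ζ‖ ^ N * ‖∫ ρ, f (ζ + Real.log (2 * (1 + ρ))) ∂μ‖
      ≤ |c| / ‖Complex.exp ζ‖ ^ N *
        ((⨆ r : Set.Ici (1 : ℝ), ‖f (ζ + Real.log (2 * (r : ℝ)))‖) * μ.real Set.univ) := by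
        gcongr
    _ = _ := by ring

end BesselExpansion

end

theorem theorem4 (N : ℕ) (hN : 1 ≤ N) (ν : ℝ) (hν : |ν| < (N : ℝ) - 1 / 2) :
    (∀ ζ : ℂ, |ζ.im| < 3 * Real.pi / 2 →
      BddAbove (Set.range fun r : Set.Ici (1 : ℝ) =>
        ‖BesselExpansion.terminantL N (ζ + Real.log (2 * (r : ℝ)))‖) ∧
      ‖BesselExpansion.remK' N ν ζ‖ ≤
        |BesselExpansion.coeffB N ν| / ‖Complex.exp ζ‖ ^ N *
          ⨆ r : Set.Ici (1 : ℝ),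
            ‖BesselExpansion.terminantL N (ζ + Real.log (2 * (r : ℝ)))‖) ∧
    (∀ ζ : ℂ, |ζ.im| < Real.pi →
      BddAbove (Set.range fun r : Set.Ici (1 : ℝ) =>
        ‖BesselExpansion.terminantP N (ζ + Real.log (2 * (r : ℝ)))‖) ∧
      ‖BesselExpansion.remJ' N ν ζ‖ ≤
        |BesselExpansion.coeffB N ν| / ‖Complex.exp ζ‖ ^ N *
          ⨆ r : Set.Ici (1 : ℝ),
            ‖BesselExpansion.terminantP N (ζ + Real.log (2 * (r : ℝ)))‖) := by
  obtain ⟨c, μ, hfin, hρ, hc, h⟩ := BesselExpansion.exists_measure_remK' hN hν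
  rw [hc]
  refine ⟨fun ζ hζ => ?_, fun ζ hζ => ?_⟩
  · have hb := BesselExpansion.bddAbove_norm_terminantL hN hζ
    refine ⟨hb, ?_⟩
    rw [h ζ hζ]
    exact BesselExpansion.norm_mul_integral_le_iSup hρ hb
  · have hb := BesselExpansion.bddAbove_norm_terminantP hN hζ
    refine ⟨hb, ?_⟩
    rw [BesselExpansion.norm_remJ'_eq hN h hζ]
    exact BesselExpansion.norm_mul_integral_le_iSup hρ hb
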